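/- Let $n \ge 0$, and let $S_n$ be the symmetric group on $[n]=\{1,\dots,n\}$ with the Bruhat order: $\sigma\le\tau$ if and only if $|\{i\le k : \sigma(i)\ge l\}| \le |\{i\le k : \tau(i)\ge l\}|$ for all $k,l\in[n]$. Let $A\subseteq\{0,1,\dots,n\}$ be a set all of whose elements have the same parity as $n$, and let $F_n^A$ be the set of all $\sigma\in S_n$ with $\sigma^2=\mathrm{id}$ whose number of fixed points belongs to $A$, with the order induced by the Bruhat order. A finite poset is called graded (of rank $r$) if all its maximal chains have the same length ($r$), the length of a chain being its number of elements minus one; its rank function $\rho$ is then the function with $\rho(x)=0$ for every minimal element $x$ and $\rho(y)=\rho(x)+1$ whenever $y$ covers $x$. Let $\mathrm{inv}(\sigma)$ be the number of pairs $i<j$ with $\sigma(i)>\sigma(j)$, and let $\mathrm{exc}(\sigma)$ be the number of $i$ with $\sigma(i)>i$. **Theorem 1.** The poset $F_n^A$ is graded if and only if $A\setminus\{n\}=\emptyset$, or $A\setminus\{n\}=\{a_1,a_1+2,\dots,a_2\}$ for some $a_1\le a_2$ of the same parity such that $a_1\in\{0,1\}$, or $a_2=n-2$, or $a_2-a_1\ge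 2$. Suppose that $F_n^A$ is graded, with rank function $\rho$, and put $\epsilon=1$ if $n\in A$ and $\epsilon=0$ otherwise. If $n\in A$, then $\rho(\mathrm{id})=0$. If $A\setminus\{n\}\neq\emptyset$ and $\tilde a=\max(A\setminus\{n\})$, then $$\rho(\sigma)=\frac{\mathrm{inv}(\sigma)+\mathrm{exc}(\sigma)-n+\tilde a}{2}+\epsilon\qquad\text{for all }\sigma\in F_n^A,\ \sigma\neq\mathrm{id},$$ and the rank of $F_n^A$ is $$\frac{\frac{n-a}{2}(n+a)-n+\tilde a}{2}+\epsilon,\qquad\text{where } a=\min A.$$ -/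

import Mathlib

/-- The number `σ[k, l] = |{i ≤ k : σ(i) ≥ l}|`. -/
def bruhatCount {n : ℕ} (σ : Equiv.Perm (Fin n)) (k l : Fin n) : ℕ :=
  (Finset.univ.filter (fun i : Fin n => i ≤ k ∧ l ≤ σ i)).card

theorem bruhatCount_injective (n : ℕ) :
    Function.Injective (bruhatCount : Equiv.Perm (Fin n) → Fin n → Fin n → ℕ) := by
  intro σ τ h
  have hsplit : ∀ (π : Equiv.Perm (Fin n)) (k l : Fin n), bruhatCount π k l =
      (Finset.univ.filter (fun i : Fin n => i < k ∧ l ≤ π i)).card + if l ≤ π k then 1 else 0 := by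
    intro π k l
    have he : Finset.univ.filter (fun i : Fin n => i ≤ k ∧ l ≤ π i) =
        Finset.univ.filter (fun i : Fin n => i < k ∧ l ≤ π i) ∪
          (if l ≤ π k then {k} else ∅) := by
      ext i
      by_cases hk : l ≤ π k <;> simp [hk, le_iff_lt_or_eq (a := i)] <;> grind
    rw [bruhatCount, he, Finset.card_union_of_disjoint]
    · split_ifs <;> simp
    · split_ifs <;> simp
  have hmain : ∀ (m : ℕ) (k : Fin n), k.val = m → σ k = τ k := by
    intro m
    induction m using Nat.strong_induction_on with
    | _ m ih =>
      intro k hk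
      have hlow : ∀ l, Finset.univ.filter (fun i : Fin n => i < k ∧ l ≤ σ i) =
          Finset.univ.filter (fun i : Fin n => i < k ∧ l ≤ τ i) := by
        intro l
        ext i
        simp only [Finset.mem_filter, Finset.mem_univ, true_and]
        refine and_congr_right fun hi => ?_
        rw [ih i.val (by rw [← hk]; exact hi) i rfl]
      have hiff : ∀ l, l ≤ σ k ↔ l ≤ τ k := by
        intro l
        have h1 := congrFun (congrFun h k) l
        rw [hsplit, hsplit, hlow] at h1
        by_cases ha : l ≤ σ k <;> by_cases hb : l ≤ τ k <;> simp [ha, hb] at h1 ⊢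
      exact le_antisymm ((hiff _).1 le_rfl) ((hiff _).2 le_rfl)
  exact Equiv.ext fun k => hmain k.val k rfl

/-- The Bruhat order on `S_n`: `σ ≤ τ` if and only if `σ[k, l] ≤ τ[k, l]` for all `k`, `l`. -/
instance bruhatOrder (n : ℕ) : PartialOrder (Equiv.Perm (Fin n)) :=
  PartialOrder.lift bruhatCount (bruhatCount_injective n)

/-- The number of fixed points of `σ`. -/
def fixCount {n : ℕ} (σ : Equiv.Perm (Fin n)) : ℕ :=
  (Finset.univ.filter (fun i : Fin n => σ i = i)).card

/-- The number of inversions of `σ`. -/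
def invCount {n : ℕ} (σ : Equiv.Perm (Fin n)) : ℕ :=
  (Finset.univ.filter (fun p : Fin n × Fin n => p.1 < p.2 ∧ σ p.2 < σ p.1)).card

/-- The number of exceedances of `σ`. -/
def excCount {n : ℕ} (σ : Equiv.Perm (Fin n)) : ℕ :=
  (Finset.univ.filter (fun i : Fin n => i < σ i)).card

/-- The poset of all involutions in `S_n` (the identity included) whose number of fixed points
lies in `A`, with the order induced by the Bruhat order. -/
abbrev InvPoset (n : ℕ) (A : Finset ℕ) : Type :=
  {σ : Equiv.Perm (Fin n) // σ * σ = 1 ∧ fixCount σ ∈ A}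

/-- A finite poset is graded of rank `r` if every maximal chain has length `r`, where the length
of a chain is its number of elements minus one (so the empty poset is graded of rank `-1`). -/
def IsGradedOfRank (P : Type*) [PartialOrder P] [Finite P] (r : ℤ) : Prop :=
  ∀ c : Set P, IsMaxChain (· ≤ ·) c → (c.ncard : ℤ) - 1 = r

/-- A finite poset is graded if all maximal chains have the same length. -/
def IsGraded (P : Type*) [PartialOrder P] [Finite P] : Prop :=
  ∃ r : ℤ, IsGradedOfRank P r

/-- `ρ` is a rank function: it vanishes at minimal elements and increases by one along every
covering relation. (On a finite poset there is at most one such function.) -/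
def IsRankFunction {P : Type*} [PartialOrder P] (ρ : P → ℕ) : Prop :=
  (∀ x, IsMin x → ρ x = 0) ∧ ∀ x y, x ⋖ y → ρ y = ρ x + 1

/-! View an involution as a set of arcs and fixed points, and measure it by `inv + exc`. Call `cnt y
k m - cnt x k m` the surplus of `y` over `x` at `(k, m)`; then `x ≤ y` means that no surplus is
negative. Let `i` be the first position where the involutions `x < y` differ, with `x i = p < q = y
i`, and let `j > i` be the first position with `p < x j ≤ q`. The surplus is positive on the
rectangle `(i, j] × (p, q]` and, because involutions are symmetric, on its transpose. This leaves
room for a move up from `x` that stays below `y` and raises `inv + exc` by two (`FirstDiff.step`): a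
conjugation by a transposition, which keeps the number of fixed points, the joining of two fixed
points into an arc, or the merging of two arcs side by side into one long arc over two new fixed
points. So `inv + exc` is strictly monotone on involutions, and numbers of fixed points satisfy a
discrete intermediate value theorem (`exists_fixCount_eq`).

Let the allowed numbers of fixed points form an interval from `a₁` to `a₂` as in the theorem. The
point is that every cover between non-identity elements raises `inv + exc` by exactly two
(`exists_involution_between`). The move up from `x` can only fail by leaving the interval. A
different element strictly between `x` and `y` is then needed. It comes from the intermediate value
theorem, from a move down from `y` (`FirstDiff.exists_between_of_join`), or, when merging fails,
from `FirstDiff.exists_between_of_merge`, whose core is a parity argument for the surplus on the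
diagonal. Minimal non-identity elements have `inv + exc = n - a₂`, and the reversal of the outer
letters is the maximum; this fixes the rank function and the rank.

Conversely, two configurations destroy gradedness. If consecutive elements `a < b < n` of `A` differ
by at least four, some interval has maximal chains of different lengths (`not_isGraded_of_gap`). If
only `a` with `2 ≤ a ≤ n - 4` remains besides `n`, then `(0 3)(4 5)` covers `(0 1)(2 3)`, up to
common further arcs, although `inv + exc` jumps by four (`not_isGraded_of_single`). -/

/-! ### The counting function and the Bruhat order -/

/-- The number of `a < k` with `m ≤ σ a`, for natural numbers `k` and `m`. -/
def cnt {n : ℕ} (σ : Equiv.Perm (Fin n)) (k m : ℕ) : ℕ :=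
  (Finset.univ.filter (fun a : Fin n => (a : ℕ) < k ∧ m ≤ (σ a : ℕ))).card

variable {n : ℕ}

theorem cnt_eq_sum (σ : Equiv.Perm (Fin n)) (k m : ℕ) :
    cnt σ k m = ∑ a : Fin n, if (a : ℕ) < k ∧ m ≤ (σ a : ℕ) then 1 else 0 := by
  rw [cnt, Finset.card_filter]

theorem bruhatCount_eq_cnt (σ : Equiv.Perm (Fin n)) (k l : Fin n) :
    bruhatCount σ k l = cnt σ (k + 1) l := by
  unfold bruhatCount cnt
  refine congrArg Finset.card (Finset.filter_congr fun a _ => ?_)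
  rw [Fin.le_def, Fin.le_def, Nat.lt_succ_iff]

theorem cnt_zero_left (σ : Equiv.Perm (Fin n)) (m : ℕ) : cnt σ 0 m = 0 := by
  simp [cnt]

theorem cnt_eq_zero_of_le (σ : Equiv.Perm (Fin n)) (k : ℕ) {m : ℕ} (h : n ≤ m) :
    cnt σ k m = 0 := by
  rw [cnt, Finset.card_eq_zero, Finset.filter_eq_empty_iff]
  intro a _ h'
  have := (σ a).isLt
  omega

theorem bruhat_le_iff (σ τ : Equiv.Perm (Fin n)) :
    σ ≤ τ ↔ ∀ k m : ℕ, k ≤ n → m ≤ n → cnt σ k m ≤ cnt τ k m := by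
  have h0 : σ ≤ τ ↔ ∀ k l, bruhatCount σ k l ≤ bruhatCount τ k l := Iff.rfl
  rw [h0]
  constructor
  · intro h k m hk hm
    rcases Nat.eq_zero_or_pos k with rfl | hk0
    · simp [cnt_zero_left]
    · rcases Nat.lt_or_ge m n with hm' | hm'
      · have := h ⟨k - 1, by omega⟩ ⟨m, hm'⟩
        rw [bruhatCount_eq_cnt, bruhatCount_eq_cnt] at this
        simpa [Nat.sub_add_cancel hk0] using this
      · simp [cnt_eq_zero_of_le _ _ hm']
  · intro h k l
    rw [bruhatCount_eq_cnt, bruhatCount_eq_cnt]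
    exact h _ _ (by omega) (by omega)

theorem card_filter_val_lt {k : ℕ} (hk : k ≤ n) :
    (Finset.univ.filter (fun a : Fin n => (a : ℕ) < k)).card = k := by
  rw [Fin.card_filter_val_lt]; omega

theorem cnt_add_low (σ : Equiv.Perm (Fin n)) {k : ℕ} (m : ℕ) (hk : k ≤ n) :
    cnt σ k m + (Finset.univ.filter (fun a : Fin n => (a : ℕ) < k ∧ (σ a : ℕ) < m)).card = k := by
  conv_rhs => rw [← card_filter_val_lt hk]
  rw [cnt, ← Finset.card_filter_add_card_filter_not
    (s := Finset.univ.filter (fun a : Fin n => (a : ℕ) < k)) (fun a => m ≤ (σ a : ℕ)),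
    Finset.filter_filter, Finset.filter_filter]
  simp only [not_le]

theorem apply_apply_of_mul_self {σ : Equiv.Perm (Fin n)} (h : σ * σ = 1) (a : Fin n) :
    σ (σ a) = a := by
  have := congrArg (fun τ : Equiv.Perm (Fin n) => τ a) h
  simpa using this

theorem mul_self_of_apply_apply {σ : Equiv.Perm (Fin n)} (h : ∀ a, σ (σ a) = a) : σ * σ = 1 := by
  ext a; simp [h]

/-- Applying `σ` exchanges the points `a < k` with `σ a < m` and the points `a < m` with `σ a < k`;
complements turn this into a relation for `cnt`. It transfers every estimate on a rectangle to the
transposed rectangle. -/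
theorem cnt_symm {σ : Equiv.Perm (Fin n)} (h : σ * σ = 1) {k m : ℕ} (hk : k ≤ n) (hm : m ≤ n) :
    cnt σ k m + m = cnt σ m k + k := by
  have h1 := cnt_add_low σ m hk
  have h2 := cnt_add_low σ k hm
  have h3 : (Finset.univ.filter (fun a : Fin n => (a : ℕ) < k ∧ (σ a : ℕ) < m)).card =
      (Finset.univ.filter (fun a : Fin n => (a : ℕ) < m ∧ (σ a : ℕ) < k)).card := by
    refine Finset.card_nbij' (fun a => σ a) (fun a => σ a) ?_ ?_ ?_ ?_
    · intro a ha; simpa [apply_apply_of_mul_self h, and_comm] using ha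
    · intro a ha; simpa [apply_apply_of_mul_self h, and_comm] using ha
    · intro a _; exact apply_apply_of_mul_self h a
    · intro a _; exact apply_apply_of_mul_self h a
  omega

/-! ### Right multiplication by a transposition -/

theorem sum_eq_pair_add {M : Type*} [AddCommMonoid M] (f : Fin n → M) {a b : Fin n}
    (hab : a ≠ b) : ∑ t, f t = f a + (f b + ∑ t ∈ (Finset.univ.erase a).erase b, f t) := by
  rw [← Finset.add_sum_erase _ f (Finset.mem_univ a),
    ← Finset.add_sum_erase _ f (Finset.mem_erase.2 ⟨hab.symm, Finset.mem_univ b⟩)]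

theorem cnt_mul_swap (σ : Equiv.Perm (Fin n)) {a b : Fin n} (hab : (a : ℕ) < b)
    (hs : (σ a : ℕ) < σ b) (k m : ℕ) :
    cnt (σ * Equiv.swap a b) k m = cnt σ k m +
      if (a : ℕ) < k ∧ k ≤ b ∧ (σ a : ℕ) < m ∧ m ≤ σ b then 1 else 0 := by
  have hne : a ≠ b := by rintro rfl; omega
  rw [cnt_eq_sum, cnt_eq_sum, sum_eq_pair_add _ hne, sum_eq_pair_add _ hne]
  have hrest : ∑ t ∈ (Finset.univ.erase a).erase b,
      (if (t : ℕ) < k ∧ m ≤ ((σ * Equiv.swap a b) t : ℕ) then 1 else 0) =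
      ∑ t ∈ (Finset.univ.erase a).erase b, (if (t : ℕ) < k ∧ m ≤ (σ t : ℕ) then 1 else 0) := by
    refine Finset.sum_congr rfl fun t ht => ?_
    simp only [Finset.mem_erase, Finset.mem_univ, and_true] at ht
    rw [Equiv.Perm.mul_apply, Equiv.swap_apply_of_ne_of_ne ht.2 ht.1]
  rw [hrest]
  simp only [Equiv.Perm.mul_apply, Equiv.swap_apply_left, Equiv.swap_apply_right]
  split_ifs <;> omega

/-- Inversions are sorted by their right end. Allowing equality of values in `cnt` is harmless,
since `σ` is injective. -/
theorem invCount_eq_sum (σ : Equiv.Perm (Fin n)) :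
    invCount σ = ∑ a : Fin n, cnt σ a (σ a) := by
  simp only [cnt]
  rw [invCount, ← Finset.card_sigma]
  refine Finset.card_nbij' (fun p => ⟨p.2, p.1⟩) (fun q => (q.2, q.1)) ?_ ?_ ?_ ?_
  · rintro ⟨a, b⟩ h
    simp only [Finset.mem_coe, Finset.mem_filter, Finset.mem_univ, true_and,
      Finset.mem_sigma, Fin.lt_def] at h ⊢
    omega
  · rintro ⟨a, b⟩ h
    simp only [Finset.mem_coe, Finset.mem_filter, Finset.mem_univ, true_and,
      Finset.mem_sigma, Fin.lt_def] at h ⊢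
    refine ⟨h.1, lt_of_le_of_ne h.2 fun he => ?_⟩
    have : a = b := σ.injective (Fin.ext he)
    subst this; exact lt_irrefl _ h.1
  · intro _ _; rfl
  · intro _ _; rfl

/-- Counting the `a < k` with `m ≤ σ a` by whether `σ a < m'`. -/
theorem cnt_eq_add_between (σ : Equiv.Perm (Fin n)) (k : ℕ) {m m' : ℕ} (h : m ≤ m') :
    cnt σ k m = cnt σ k m' +
      (Finset.univ.filter (fun a : Fin n => (a : ℕ) < k ∧ m ≤ (σ a : ℕ) ∧ (σ a : ℕ) < m')).card := by
  rw [cnt, ← Finset.card_filter_add_card_filter_not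
    (s := Finset.univ.filter (fun a : Fin n => (a : ℕ) < k ∧ m ≤ (σ a : ℕ)))
    (fun a => m' ≤ (σ a : ℕ)), Finset.filter_filter, Finset.filter_filter, cnt]
  congr 2
  · ext a; simp only [Finset.mem_filter, Finset.mem_univ, true_and]; omega
  · ext a; simp only [Finset.mem_filter, Finset.mem_univ, true_and]; omega

theorem invCount_mul_swap (σ : Equiv.Perm (Fin n)) {a b : Fin n} (hab : (a : ℕ) < b)
    (hs : (σ a : ℕ) < σ b)
    (hfree : ∀ t : Fin n, (a : ℕ) < t → (t : ℕ) < b → ¬ ((σ a : ℕ) < σ t ∧ (σ t : ℕ) < σ b)) :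
    invCount (σ * Equiv.swap a b) = invCount σ + 1 := by
  have hne : a ≠ b := by rintro rfl; omega
  rw [invCount_eq_sum, invCount_eq_sum, sum_eq_pair_add _ hne, sum_eq_pair_add _ hne]
  have hrest : ∑ t ∈ (Finset.univ.erase a).erase b,
      cnt (σ * Equiv.swap a b) t ((σ * Equiv.swap a b) t) =
      ∑ t ∈ (Finset.univ.erase a).erase b, cnt σ t (σ t) := by
    refine Finset.sum_congr rfl fun t ht => ?_
    simp only [Finset.mem_erase, Finset.mem_univ, and_true] at ht
    rw [cnt_mul_swap σ hab hs, Equiv.Perm.mul_apply, Equiv.swap_apply_of_ne_of_ne ht.2 ht.1,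
      if_neg]
    · rfl
    · rintro ⟨h1, h2, h3, h4⟩
      have hb : (t : ℕ) ≠ b := fun h => ht.1 (Fin.ext h)
      have hb' : (σ t : ℕ) ≠ σ b := fun h => ht.1 (σ.injective (Fin.ext h))
      exact hfree t h1 (by omega) ⟨h3, by omega⟩
  rw [hrest, cnt_mul_swap σ hab hs, cnt_mul_swap σ hab hs]
  simp only [Equiv.Perm.mul_apply, Equiv.swap_apply_left, Equiv.swap_apply_right]
  rw [if_neg (by omega), if_neg (by omega)]
  -- Only the terms at `a` and `b` change. By `hfree`, the positions before `b` with value in `[σ a,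
  -- σ b)` are those before `a` together with `a` itself, which is the extra inversion.
  have h1 := cnt_eq_add_between σ a hs.le
  have h2 := cnt_eq_add_between σ b hs.le
  have h3 : Finset.univ.filter (fun t : Fin n => (t : ℕ) < b ∧ (σ a : ℕ) ≤ σ t ∧ (σ t : ℕ) < σ b) =
      insert a (Finset.univ.filter
        (fun t : Fin n => (t : ℕ) < a ∧ (σ a : ℕ) ≤ σ t ∧ (σ t : ℕ) < σ b)) := by
    ext t
    simp only [Finset.mem_filter, Finset.mem_univ, true_and, Finset.mem_insert]
    constructor
    · rintro ⟨h1, h2, h3⟩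
      by_cases hta : t = a
      · exact Or.inl hta
      · right
        have h4 : (σ t : ℕ) ≠ σ a := fun h => hta (σ.injective (Fin.ext h))
        have h5 : (t : ℕ) ≠ a := fun h => hta (Fin.ext h)
        have := hfree t
        omega
    · rintro (rfl | h)
      · omega
      · omega
  rw [h3, Finset.card_insert_of_notMem (by simp)] at h2
  omega

/-! ### Exceedances, fixed points and the identity -/

theorem two_mul_excCount_add_fixCount {σ : Equiv.Perm (Fin n)} (h : σ * σ = 1) :
    2 * excCount σ + fixCount σ = n := by
  have h1 : (Finset.univ.filter (fun i : Fin n => σ i < i)).card = excCount σ := by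
    refine Finset.card_nbij' (fun a => σ a) (fun a => σ a) ?_ ?_ ?_ ?_
    · intro a ha; simpa [apply_apply_of_mul_self h] using ha
    · intro a ha; simpa [apply_apply_of_mul_self h] using ha
    · intro a _; exact apply_apply_of_mul_self h a
    · intro a _; exact apply_apply_of_mul_self h a
  have h2 : ∑ i : Fin n, (((if i < σ i then 1 else 0) + (if σ i < i then 1 else 0)) +
      if σ i = i then 1 else 0) = n := by
    have : ∀ i : Fin n, (((if i < σ i then 1 else 0) + (if σ i < i then 1 else 0)) +
      if σ i = i then 1 else 0) = 1 := by
      intro i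
      rcases lt_trichotomy i (σ i) with h | h | h
      · simp [h, h.not_gt, h.ne']
      · simp [h.symm]
      · simp [h, h.not_gt, h.ne]
    simp [this]
  rw [Finset.sum_add_distrib, Finset.sum_add_distrib, ← Finset.card_filter, ← Finset.card_filter,
    ← Finset.card_filter, h1] at h2
  unfold fixCount
  unfold excCount at h2 ⊢
  omega

theorem fixCount_conj (σ τ : Equiv.Perm (Fin n)) : fixCount (τ * σ * τ⁻¹) = fixCount σ := by
  unfold fixCount
  symm
  refine Finset.card_bij (fun a _ => τ a) ?_ (fun a _ b _ h => τ.injective h) ?_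
  · intro a ha
    rw [Finset.mem_filter] at ha ⊢
    simp [ha.2]
  · intro b hb
    rw [Finset.mem_filter] at hb
    refine ⟨τ⁻¹ b, ?_, by simp⟩
    rw [Finset.mem_filter]
    refine ⟨Finset.mem_univ _, ?_⟩
    rw [Equiv.Perm.eq_inv_iff_eq]
    exact hb.2

theorem fixCount_eq_sum (σ : Equiv.Perm (Fin n)) :
    fixCount σ = ∑ a : Fin n, if σ a = a then 1 else 0 := by
  rw [fixCount, Finset.card_filter]

theorem fixCount_eq_iff (σ : Equiv.Perm (Fin n)) : fixCount σ = n ↔ σ = 1 := by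
  constructor
  · intro h
    have : Finset.univ.filter (fun i : Fin n => σ i = i) = Finset.univ := by
      apply Finset.eq_univ_of_card
      rw [Fintype.card_fin]; exact h
    ext a
    have ha := Finset.mem_univ a
    rw [← this, Finset.mem_filter] at ha
    simp [ha.2]
  · rintro rfl; simp [fixCount]

/-- The number of `a < k` with `σ a < m` is at most `min k m`, and the identity attains this bound.
-/
theorem one_le_bruhat (σ : Equiv.Perm (Fin n)) : 1 ≤ σ := by
  rw [bruhat_le_iff]
  intro k m hk hm
  have h1 := cnt_add_low (1 : Equiv.Perm (Fin n)) m hk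
  have h2 := cnt_add_low σ m hk
  have h3 : (Finset.univ.filter (fun a : Fin n => (a : ℕ) < k ∧ (σ a : ℕ) < m)).card ≤
      (Finset.univ.filter
        (fun a : Fin n => (a : ℕ) < k ∧ ((1 : Equiv.Perm (Fin n)) a : ℕ) < m)).card := by
    have h4 : (Finset.univ.filter
        (fun a : Fin n => (a : ℕ) < k ∧ ((1 : Equiv.Perm (Fin n)) a : ℕ) < m)) =
        Finset.univ.filter (fun a : Fin n => (a : ℕ) < min k m) := by
      refine Finset.filter_congr fun a _ => ?_
      rw [Equiv.Perm.one_apply, lt_min_iff]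
    rw [h4, card_filter_val_lt (by omega)]
    refine le_min ?_ ?_
    · refine (Finset.card_le_card (t := Finset.univ.filter (fun a : Fin n => (a : ℕ) < k)) ?_).trans
        (card_filter_val_lt hk).le
      intro a; simp +contextual
    · refine (Finset.card_le_card_of_injOn (t := Finset.univ.filter (fun a : Fin n => (a : ℕ) < m))
        σ ?_ σ.injective.injOn).trans (card_filter_val_lt hm).le
      intro a; simp +contextual
  omega

/-! ### Conjugation by a transposition -/

theorem conj_swap_mul_self {x : Equiv.Perm (Fin n)} (hx : x * x = 1) (a b : Fin n) :
    (Equiv.swap a b * x * Equiv.swap a b) * (Equiv.swap a b * x * Equiv.swap a b) = 1 := by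
  apply mul_self_of_apply_apply
  intro t
  simp [apply_apply_of_mul_self hx]

theorem fixCount_conj_swap (x : Equiv.Perm (Fin n)) (a b : Fin n) :
    fixCount (Equiv.swap a b * x * Equiv.swap a b) = fixCount x := by
  have := fixCount_conj x (Equiv.swap a b)
  rwa [Equiv.swap_inv] at this

theorem conj_swap_conj_swap (x : Equiv.Perm (Fin n)) (a b : Fin n) :
    Equiv.swap a b * (Equiv.swap a b * x * Equiv.swap a b) * Equiv.swap a b = x := by
  ext t; simp

/-- Moving the left transposition through `x * swap a b` turns the conjugation into two right
multiplications, so the rectangle formulas for one transposition apply twice. -/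
theorem conj_swap_eq {x : Equiv.Perm (Fin n)} (hx : x * x = 1) (a b : Fin n) :
    Equiv.swap a b * x * Equiv.swap a b =
      x * Equiv.swap a b * Equiv.swap (Equiv.swap a b (x a)) (Equiv.swap a b (x b)) := by
  rw [Equiv.mul_swap_eq_swap_mul (x * Equiv.swap a b), mul_assoc]
  simp [apply_apply_of_mul_self hx]

section raise
variable {x : Equiv.Perm (Fin n)} (hx : x * x = 1) {a b u v : Fin n} (hab : (a : ℕ) < b)
  (hs : (x a : ℕ) < x b) (hu : Equiv.swap a b (x a) = u) (hv : Equiv.swap a b (x b) = v)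
  (huv : (u : ℕ) < v)
include hx hab hs hu hv huv

theorem cnt_conj_swap (k m : ℕ) :
    cnt (Equiv.swap a b * x * Equiv.swap a b) k m = cnt x k m +
      (if (a : ℕ) < k ∧ k ≤ b ∧ (x a : ℕ) < m ∧ m ≤ x b then 1 else 0) +
      (if (u : ℕ) < k ∧ k ≤ v ∧ (a : ℕ) < m ∧ m ≤ b then 1 else 0) := by
  have h1 : (x * Equiv.swap a b) u = a := by subst hu; simp [apply_apply_of_mul_self hx]
  have h2 : (x * Equiv.swap a b) v = b := by subst hv; simp [apply_apply_of_mul_self hx]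
  rw [conj_swap_eq hx, hu, hv, cnt_mul_swap _ huv (by rw [h1, h2]; exact hab),
    cnt_mul_swap _ hab hs, h1, h2]

theorem invCount_conj_swap
    (hfree : ∀ t : Fin n, (a : ℕ) < t → (t : ℕ) < b → ¬ ((x a : ℕ) < x t ∧ (x t : ℕ) < x b))
    (hfree' : ∀ t : Fin n, (u : ℕ) < t → (t : ℕ) < v →
      ¬ ((a : ℕ) < x (Equiv.swap a b t) ∧ (x (Equiv.swap a b t) : ℕ) < b)) :
    invCount (Equiv.swap a b * x * Equiv.swap a b) = invCount x + 2 := by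
  have h1 : (x * Equiv.swap a b) u = a := by subst hu; simp [apply_apply_of_mul_self hx]
  have h2 : (x * Equiv.swap a b) v = b := by subst hv; simp [apply_apply_of_mul_self hx]
  rw [conj_swap_eq hx, hu, hv, invCount_mul_swap _ huv (by rw [h1, h2]; exact hab),
    invCount_mul_swap _ hab hs hfree]
  intro t ht1 ht2
  rw [h1, h2]
  exact hfree' t ht1 ht2

end raise

/-- The change of `cnt` under conjugation that lowers an involution. -/
theorem cnt_eq_conj_swap_add {y : Equiv.Perm (Fin n)} (hy : y * y = 1) {a b u v : Fin n}
    (hab : (a : ℕ) < b) (hs : (y b : ℕ) < y a) (hu : Equiv.swap a b (y b) = u)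
    (hv : Equiv.swap a b (y a) = v) (huv : (u : ℕ) < v) (k m : ℕ) :
    cnt y k m = cnt (Equiv.swap a b * y * Equiv.swap a b) k m +
      (if (a : ℕ) < k ∧ k ≤ b ∧ (u : ℕ) < m ∧ m ≤ v then 1 else 0) +
      (if (y b : ℕ) < k ∧ k ≤ y a ∧ (a : ℕ) < m ∧ m ≤ b then 1 else 0) := by
  have h := cnt_conj_swap (conj_swap_mul_self hy a b) (a := a) (b := b) (u := y b) (v := y a) hab
    (by simp [hu, hv, huv]) (by simp) (by simp) hs k m
  rw [conj_swap_conj_swap] at h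
  simpa [hu, hv] using h

/-! ### Joining two fixed points and merging two arcs -/

section join
variable {x : Equiv.Perm (Fin n)} {a b : Fin n}

theorem join_apply_of_ne (x : Equiv.Perm (Fin n)) {a b t : Fin n} (ha : t ≠ a) (hb : t ≠ b) :
    (x * Equiv.swap a b) t = x t := by
  rw [Equiv.Perm.mul_apply, Equiv.swap_apply_of_ne_of_ne ha hb]

theorem join_mul_self (hx : x * x = 1) (ha : x a = a) (hb : x b = b) :
    (x * Equiv.swap a b) * (x * Equiv.swap a b) = 1 := by
  have h : x * Equiv.swap a b = Equiv.swap a b * x := by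
    rw [Equiv.mul_swap_eq_swap_mul, ha, hb]
  rw [← mul_assoc, mul_assoc x, ← h]
  simp only [mul_assoc, Equiv.swap_mul_self, mul_one, hx]

theorem fixCount_join (hab : a ≠ b) (ha : x a = a) (hb : x b = b) :
    fixCount (x * Equiv.swap a b) + 2 = fixCount x := by
  rw [fixCount_eq_sum, fixCount_eq_sum, sum_eq_pair_add _ hab, sum_eq_pair_add _ hab]
  have hrest : ∑ t ∈ (Finset.univ.erase a).erase b,
      (if (x * Equiv.swap a b) t = t then 1 else 0) =
      ∑ t ∈ (Finset.univ.erase a).erase b, (if x t = t then 1 else 0) := by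
    refine Finset.sum_congr rfl fun t ht => ?_
    simp only [Finset.mem_erase, Finset.mem_univ, and_true] at ht
    rw [join_apply_of_ne x ht.2 ht.1]
  rw [hrest]
  simp only [Equiv.Perm.mul_apply, Equiv.swap_apply_left, Equiv.swap_apply_right, ha, hb,
    if_neg hab, if_neg hab.symm, if_true]
  omega

end join

section uncross
variable {x : Equiv.Perm (Fin n)} (hx : x * x = 1) {i p j l : Fin n} (hip : (i : ℕ) < p)
  (hpj : (p : ℕ) < j) (hjl : (j : ℕ) < l) (hi : x i = p) (hj : x j = l)

/-- The product of `x` with transpositions that turns two arcs `(i p)`, `(j l)` with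
`i < p < j < l` into the single arc `(i l)`. -/
def mergeArcs (x : Equiv.Perm (Fin n)) (i p j l : Fin n) : Equiv.Perm (Fin n) :=
  x * Equiv.swap i j * Equiv.swap p j * Equiv.swap j l

include hx hip hpj hjl hi hj

theorem mergeArcs_apply (t : Fin n) : mergeArcs x i p j l t =
    if t = i then l else if t = l then i else if t = p then p else if t = j then j else x t := by
  have hp : x p = i := by rw [← hi, apply_apply_of_mul_self hx]
  have hl : x l = j := by rw [← hj, apply_apply_of_mul_self hx]
  have h1 : i ≠ p := by rintro rfl; omega
  have h2 : i ≠ j := by rintro rfl; omega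
  have h3 : i ≠ l := by rintro rfl; omega
  have h4 : p ≠ j := by rintro rfl; omega
  have h5 : p ≠ l := by rintro rfl; omega
  have h6 : j ≠ l := by rintro rfl; omega
  simp only [mergeArcs, Equiv.Perm.mul_apply]
  by_cases e1 : t = i
  · subst e1; simp [Equiv.swap_apply_def, h1, h2, h3, hj]
  by_cases e2 : t = l
  · subst e2; simp [Equiv.swap_apply_def, h4, h1.symm, h3.symm, hp]
  by_cases e3 : t = p
  · subst e3; simp [Equiv.swap_apply_def, h4, h5, h1.symm, hi]
  by_cases e4 : t = j
  · subst e4; simp [Equiv.swap_apply_def, h6, h2.symm, h3.symm, h4.symm, h5.symm, h6.symm, hl]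
  simp [Equiv.swap_apply_def, e1, e2, e3, e4]

theorem mergeArcs_mul_self : mergeArcs x i p j l * mergeArcs x i p j l = 1 := by
  have hp : x p = i := by rw [← hi, apply_apply_of_mul_self hx]
  have hl : x l = j := by rw [← hj, apply_apply_of_mul_self hx]
  have h1 : i ≠ p := by rintro rfl; omega
  have h2 : i ≠ j := by rintro rfl; omega
  have h3 : i ≠ l := by rintro rfl; omega
  have h4 : p ≠ j := by rintro rfl; omega
  have h5 : p ≠ l := by rintro rfl; omega
  have h6 : j ≠ l := by rintro rfl; omega
  have H := mergeArcs_apply hx hip hpj hjl hi hj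
  apply mul_self_of_apply_apply
  intro t
  rw [H t]
  by_cases e1 : t = i
  · subst e1; rw [H]; simp [h3.symm]
  by_cases e2 : t = l
  · subst e2; rw [H]; simp [e1]
  by_cases e3 : t = p
  · subst e3; rw [H]; simp [e1, e2]
  by_cases e4 : t = j
  · subst e4; rw [H]; simp [e1, e2, e3]
  rw [if_neg e1, if_neg e2, if_neg e3, if_neg e4, H, apply_apply_of_mul_self hx, if_neg, if_neg,
    if_neg, if_neg]
  · exact fun h => e2 (by rw [← apply_apply_of_mul_self hx t, h, hj])
  · exact fun h => e1 (by rw [← apply_apply_of_mul_self hx t, h, hp])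
  · exact fun h => e4 (by rw [← apply_apply_of_mul_self hx t, h, hl])
  · exact fun h => e3 (by rw [← apply_apply_of_mul_self hx t, h, hi])

theorem fixCount_mergeArcs : fixCount (mergeArcs x i p j l) = fixCount x + 2 := by
  have hp : x p = i := by rw [← hi, apply_apply_of_mul_self hx]
  have hl : x l = j := by rw [← hj, apply_apply_of_mul_self hx]
  have h1 : i ≠ p := by rintro rfl; omega
  have h2 : i ≠ j := by rintro rfl; omega
  have h3 : i ≠ l := by rintro rfl; omega
  have h4 : p ≠ j := by rintro rfl; omega
  have h5 : p ≠ l := by rintro rfl; omega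
  have h6 : j ≠ l := by rintro rfl; omega
  have H := mergeArcs_apply hx hip hpj hjl hi hj
  have : Finset.univ.filter (fun t => mergeArcs x i p j l t = t) =
      insert p (insert j (Finset.univ.filter (fun t => x t = t))) := by
    ext t
    simp only [Finset.mem_filter, Finset.mem_univ, true_and, Finset.mem_insert, H]
    by_cases e1 : t = i
    · subst e1; simp [h3.symm, h1, h2, hi, h1.symm]
    by_cases e2 : t = l
    · subst e2; simp [h3, h5.symm, h6.symm, hl, h6, h3.symm]
    by_cases e3 : t = p
    · simp [e3, h1.symm, h5]
    by_cases e4 : t = j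
    · simp [e4, h2.symm, h6, h4.symm]
    simp [e1, e2, e3, e4]
  rw [fixCount, this, Finset.card_insert_of_notMem, Finset.card_insert_of_notMem, fixCount]
  · simp [hj, h6.symm]
  · simp [h4, hp, h1]

/-- The values needed to see that each of the three transpositions in `mergeArcs` goes up in the
Bruhat order. -/
theorem mergeArcs_steps : (x i : ℕ) < x j ∧
    ((x * Equiv.swap i j) p = i ∧ (x * Equiv.swap i j) j = p) ∧
    ((x * Equiv.swap i j * Equiv.swap p j) j = i ∧
      (x * Equiv.swap i j * Equiv.swap p j) l = j) := by
  have hp : x p = i := by rw [← hi, apply_apply_of_mul_self hx]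
  have hl : x l = j := by rw [← hj, apply_apply_of_mul_self hx]
  have h1 : i ≠ p := by rintro rfl; omega
  have h3 : i ≠ l := by rintro rfl; omega
  have h4 : p ≠ j := by rintro rfl; omega
  have h5 : p ≠ l := by rintro rfl; omega
  have h6 : j ≠ l := by rintro rfl; omega
  refine ⟨by rw [hi, hj]; omega, ⟨?_, ?_⟩, ?_, ?_⟩
  · rw [join_apply_of_ne x h1.symm h4, hp]
  · simp [hi]
  · simp [Equiv.swap_apply_of_ne_of_ne h1.symm h4, hp]
  · simp [Equiv.swap_apply_of_ne_of_ne h5.symm h6.symm, Equiv.swap_apply_of_ne_of_ne h3.symm h6.symm,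
      hl]

/-- The three rectangles are disjoint. Their union is `(i, j] × (p, l]` together with its transpose,
so a surplus of one on these two rectangles suffices for merging. -/
theorem cnt_mergeArcs (k m : ℕ) : cnt (mergeArcs x i p j l) k m = cnt x k m +
    (if (i : ℕ) < k ∧ k ≤ j ∧ (p : ℕ) < m ∧ m ≤ l then 1 else 0) +
    (if (p : ℕ) < k ∧ k ≤ j ∧ (i : ℕ) < m ∧ m ≤ p then 1 else 0) +
    (if (j : ℕ) < k ∧ k ≤ l ∧ (i : ℕ) < m ∧ m ≤ j then 1 else 0) := by
  obtain ⟨s1, ⟨s2, s3⟩, s4, s5⟩ := mergeArcs_steps hx hip hpj hjl hi hj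
  rw [mergeArcs, cnt_mul_swap _ hjl (by rw [s4, s5]; omega),
    cnt_mul_swap _ hpj (by rw [s2, s3]; omega), cnt_mul_swap _ (by omega) s1, s2, s3, s4, s5, hi, hj]

/-- Each transposition adds one inversion. As merging loses one exceedance, `inv + exc` grows by
two. -/
theorem invCount_mergeArcs
    (h1 : ∀ t : Fin n, (i : ℕ) < t → (t : ℕ) < j → ¬ ((p : ℕ) < x t ∧ (x t : ℕ) < l))
    (h2 : ∀ t : Fin n, (p : ℕ) < t → (t : ℕ) < l → ¬ ((i : ℕ) < x t ∧ (x t : ℕ) < j)) :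
    invCount (mergeArcs x i p j l) = invCount x + 3 := by
  obtain ⟨s1, ⟨s2, s3⟩, s4, s5⟩ := mergeArcs_steps hx hip hpj hjl hi hj
  rw [mergeArcs, invCount_mul_swap _ hjl (by rw [s4, s5]; omega),
    invCount_mul_swap _ hpj (by rw [s2, s3]; omega), invCount_mul_swap _ (by omega) s1]
  · rw [hi, hj]; exact h1
  · intro t ht1 ht2
    rw [s2, s3, join_apply_of_ne x (by rintro rfl; omega) (by rintro rfl; omega)]
    have := h2 t ht1 (by omega)
    omega
  · intro t ht1 ht2
    rw [s4, s5, join_apply_of_ne _ (by rintro rfl; omega) (by rintro rfl; omega),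
      join_apply_of_ne x (by rintro rfl; omega) (by rintro rfl; omega)]
    exact h2 t (by omega) ht2

end uncross

/-- Splitting the arc `(i q)` at two fixed points `g < g'` of `y` between `i` and `q`. -/
theorem exists_mergeArcs_eq {y : Equiv.Perm (Fin n)} (hy : y * y = 1) {i g g' q : Fin n}
    (hig : (i : ℕ) < g) (hgg : (g : ℕ) < g') (hgq : (g' : ℕ) < q) (hi : y i = q) (hg : y g = g)
    (hg' : y g' = g') : ∃ z : Equiv.Perm (Fin n), z * z = 1 ∧ z i = g ∧ z g' = q ∧
      mergeArcs z i g g' q = y ∧ ∀ t, t ≠ i → t ≠ g → t ≠ g' → t ≠ q → z t = y t := by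
  have hq : y q = i := by rw [← hi, apply_apply_of_mul_self hy]
  have h1 : i ≠ g := by rintro rfl; omega
  have h2 : i ≠ g' := by rintro rfl; omega
  have h3 : i ≠ q := by rintro rfl; omega
  have h4 : g ≠ g' := by rintro rfl; omega
  have h5 : g ≠ q := by rintro rfl; omega
  have h6 : g' ≠ q := by rintro rfl; omega
  let z := y * Equiv.swap g' q * Equiv.swap g g' * Equiv.swap i g'
  have z1 : z i = g := by
    simp [z, h4, h5, Equiv.swap_apply_of_ne_of_ne, hg]
  have z2 : z g' = q := by
    simp [z, h1, h2, h3, Equiv.swap_apply_of_ne_of_ne, hi]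
  have z3 : z g = i := by
    simp [z, h1.symm, h4, Equiv.swap_apply_of_ne_of_ne, hq]
  have z4 : z q = g' := by
    simp [z, h3.symm, h5.symm, h6.symm, Equiv.swap_apply_of_ne_of_ne, hg']
  have z5 : ∀ t, t ≠ i → t ≠ g → t ≠ g' → t ≠ q → z t = y t := by
    intro t e1 e2 e3 e4
    simp [z, e1, e2, e3, e4, Equiv.swap_apply_of_ne_of_ne]
  refine ⟨z, ?_, z1, z2, ?_, z5⟩
  · apply mul_self_of_apply_apply
    intro t
    by_cases e1 : t = i
    · subst e1; rw [z1, z3]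
    by_cases e2 : t = g
    · subst e2; rw [z3, z1]
    by_cases e3 : t = g'
    · subst e3; rw [z2, z4]
    by_cases e4 : t = q
    · subst e4; rw [z4, z2]
    rw [z5 t e1 e2 e3 e4, z5, apply_apply_of_mul_self hy]
    · exact fun h => e4 (by rw [← apply_apply_of_mul_self hy t, h, hi])
    · exact fun h => e2 (by rw [← apply_apply_of_mul_self hy t, h, hg])
    · exact fun h => e3 (by rw [← apply_apply_of_mul_self hy t, h, hg'])
    · exact fun h => e1 (by rw [← apply_apply_of_mul_self hy t, h, hq])
  · simp [mergeArcs, z, mul_assoc]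

/-! ### Staying inside a Bruhat interval -/

/-- Conjugation raises `cnt` by one on each of two rectangles, hence by two where they overlap; the
surplus of `y` has to pay for this. -/
theorem raise_between {x y : Equiv.Perm (Fin n)} (hx : x * x = 1) (hxy : x ≤ y)
    {a b u v : Fin n} (hab : (a : ℕ) < b)
    (hs : (x a : ℕ) < x b) (hu : Equiv.swap a b (x a) = u) (hv : Equiv.swap a b (x b) = v)
    (huv : (u : ℕ) < v)
    (h1 : ∀ k m : ℕ, (a : ℕ) < k → k ≤ b → (x a : ℕ) < m → m ≤ x b → cnt x k m < cnt y k m)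
    (h2 : ∀ k m : ℕ, (u : ℕ) < k → k ≤ v → (a : ℕ) < m → m ≤ b → cnt x k m < cnt y k m)
    (h3 : ∀ k m : ℕ, (a : ℕ) < k → k ≤ b → (x a : ℕ) < m → m ≤ x b → (u : ℕ) < k → k ≤ v →
      (a : ℕ) < m → m ≤ b → cnt x k m + 2 ≤ cnt y k m) :
    x ≤ Equiv.swap a b * x * Equiv.swap a b ∧ Equiv.swap a b * x * Equiv.swap a b ≤ y := by
  rw [bruhat_le_iff] at hxy
  constructor
  · rw [bruhat_le_iff]
    intro k m _ _
    rw [cnt_conj_swap hx hab hs hu hv huv]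
    omega
  · rw [bruhat_le_iff]
    intro k m hk hm
    rw [cnt_conj_swap hx hab hs hu hv huv]
    have h0 := hxy k m hk hm
    have h1 := h1 k m
    have h2 := h2 k m
    have h3 := h3 k m
    split_ifs with c1 c2 c2
    · have := h3 c1.1 c1.2.1 c1.2.2.1 c1.2.2.2 c2.1 c2.2.1 c2.2.2.1 c2.2.2.2
      omega
    · have := h1 c1.1 c1.2.1 c1.2.2.1 c1.2.2.2
      omega
    · have := h2 c2.1 c2.2.1 c2.2.2.1 c2.2.2.2
      omega
    · omega

theorem lower_between {x y : Equiv.Perm (Fin n)} (hy : y * y = 1) (hxy : x ≤ y)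
    {a b u v : Fin n} (hab : (a : ℕ) < b)
    (hs : (y b : ℕ) < y a) (hu : Equiv.swap a b (y b) = u) (hv : Equiv.swap a b (y a) = v)
    (huv : (u : ℕ) < v)
    (h1 : ∀ k m : ℕ, (a : ℕ) < k → k ≤ b → (u : ℕ) < m → m ≤ v → cnt x k m < cnt y k m)
    (h2 : ∀ k m : ℕ, (y b : ℕ) < k → k ≤ y a → (a : ℕ) < m → m ≤ b → cnt x k m < cnt y k m)
    (h3 : ∀ k m : ℕ, (a : ℕ) < k → k ≤ b → (u : ℕ) < m → m ≤ v → (y b : ℕ) < k → k ≤ y a →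
      (a : ℕ) < m → m ≤ b → cnt x k m + 2 ≤ cnt y k m) :
    x ≤ Equiv.swap a b * y * Equiv.swap a b ∧ Equiv.swap a b * y * Equiv.swap a b ≤ y := by
  rw [bruhat_le_iff] at hxy
  have hc := cnt_eq_conj_swap_add hy hab hs hu hv huv
  constructor
  · rw [bruhat_le_iff]
    intro k m hk hm
    have h0 := hxy k m hk hm
    have h1 := h1 k m
    have h2 := h2 k m
    have h3 := h3 k m
    have hc := hc k m
    split_ifs at hc with c1 c2 c2
    · have := h3 c1.1 c1.2.1 c1.2.2.1 c1.2.2.2 c2.1 c2.2.1 c2.2.2.1 c2.2.2.2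
      omega
    · have := h1 c1.1 c1.2.1 c1.2.2.1 c1.2.2.2
      omega
    · have := h2 c2.1 c2.2.1 c2.2.2.1 c2.2.2.2
      omega
    · omega
  · rw [bruhat_le_iff]
    intro k m _ _
    rw [hc k m]
    omega

theorem cnt_diff_symm {x y : Equiv.Perm (Fin n)} (hx : x * x = 1) (hy : y * y = 1) {k m : ℕ}
    (hk : k ≤ n) (hm : m ≤ n) : cnt x k m + cnt y m k = cnt y k m + cnt x m k := by
  have := cnt_symm hx hk hm
  have := cnt_symm hy hk hm
  omega

/-! ### The first difference of two involutions -/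

theorem card_filter_lt_split (σ : Equiv.Perm (Fin n)) (P : ℕ → Prop) [DecidablePred P] {i : Fin n}
    {k : ℕ} (hik : (i : ℕ) < k) :
    (Finset.univ.filter (fun a : Fin n => (a : ℕ) < k ∧ P (σ a))).card =
      (Finset.univ.filter (fun a : Fin n => (a : ℕ) < i ∧ P (σ a))).card +
      (if P (σ i) then 1 else 0) +
      (Finset.univ.filter (fun a : Fin n => (i : ℕ) < a ∧ (a : ℕ) < k ∧ P (σ a))).card := by
  have h : (if P (σ i) then 1 else 0) = ∑ a : Fin n, if a = i then (if P (σ i) then 1 else 0) else 0 := by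
    simp
  rw [Finset.card_filter, Finset.card_filter, Finset.card_filter, h, ← Finset.sum_add_distrib,
    ← Finset.sum_add_distrib]
  refine Finset.sum_congr rfl fun a _ => ?_
  by_cases ha : a = i
  · subst ha; simp [hik]
  · have : (a : ℕ) ≠ i := fun h => ha (Fin.ext h)
    by_cases hp : P (σ a)
    · simp only [hp, and_true, ha, if_false]
      split_ifs <;> omega
    · simp [hp, ha]

/-- `i` is the first position where the involutions `x ≤ y` differ, and `x i = p`, `y i = q`. -/
structure FirstDiff (x y : Equiv.Perm (Fin n)) (i p q : Fin n) : Prop where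
  hx : x * x = 1
  hy : y * y = 1
  le : x ≤ y
  xi : x i = p
  yi : y i = q
  agree : ∀ a : Fin n, (a : ℕ) < i → x a = y a
  pq : (p : ℕ) < q
  ip : (i : ℕ) ≤ p

/-- At `(i + 1, x i)` the positions before `i` contribute equally, so `y i < x i` would contradict
`x ≤ y`. If `x i < i`, then `x` and `y` agree at `x i`, and being involutions they also agree at
`i`. -/
theorem exists_firstDiff {x y : Equiv.Perm (Fin n)} (hx : x * x = 1) (hy : y * y = 1) (hle : x ≤ y)
    (hne : x ≠ y) : ∃ i p q, FirstDiff x y i p q := by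
  classical
  have hex : ∃ m : ℕ, ∃ i : Fin n, (i : ℕ) = m ∧ x i ≠ y i := by
    by_contra h
    push Not at h
    exact hne (Equiv.ext fun i => h i i rfl)
  obtain ⟨i, hi, hi'⟩ := Nat.find_spec hex
  have hagree : ∀ a : Fin n, (a : ℕ) < i → x a = y a := by
    intro a ha
    by_contra h
    exact Nat.find_min hex (hi ▸ ha) ⟨a, rfl, h⟩
  refine ⟨i, x i, y i, hx, hy, hle, rfl, rfl, hagree, ?_, ?_⟩
  · by_contra hc
    have hlt : (y i : ℕ) < x i :=
      lt_of_le_of_ne (not_lt.1 hc) fun h => hi' (Fin.ext h.symm)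
    have h1 := (bruhat_le_iff x y).1 hle (i + 1) (x i) (by omega) (by omega)
    have e : ∀ σ : Equiv.Perm (Fin n), cnt σ (i + 1) (x i) =
        (Finset.univ.filter (fun a : Fin n => (a : ℕ) < i ∧ (x i : ℕ) ≤ (σ a))).card +
        (if (x i : ℕ) ≤ (σ i) then 1 else 0) := by
      intro σ
      rw [cnt, card_filter_lt_split σ (fun t => (x i : ℕ) ≤ t) (Nat.lt_succ_self i)]
      have : (Finset.univ.filter (fun a : Fin n => (i : ℕ) < a ∧ (a : ℕ) < i + 1 ∧
          (x i : ℕ) ≤ (σ a))) = ∅ := by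
        rw [Finset.filter_eq_empty_iff]
        intro a _ h
        omega
      rw [this, Finset.card_empty, add_zero]
    rw [e, e, if_pos le_rfl, if_neg (by omega)] at h1
    have e2 : (Finset.univ.filter (fun a : Fin n => (a : ℕ) < i ∧ (x i : ℕ) ≤ (x a))) =
        (Finset.univ.filter (fun a : Fin n => (a : ℕ) < i ∧ (x i : ℕ) ≤ (y a))) := by
      refine Finset.filter_congr fun a _ => and_congr_right fun ha => ?_
      rw [hagree a ha]
    rw [e2] at h1
    omega
  · by_contra hc
    have h1 := hagree (x i) (by omega)
    rw [apply_apply_of_mul_self hx] at h1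
    exact hi' (by conv_rhs => rw [h1, apply_apply_of_mul_self hy])

namespace FirstDiff
variable {x y : Equiv.Perm (Fin n)} {i p q : Fin n} (h : FirstDiff x y i p q)
include h

theorem xp : x p = i := by rw [← h.xi, apply_apply_of_mul_self h.hx]
theorem yq : y q = i := by rw [← h.yi, apply_apply_of_mul_self h.hy]

/-- Count the values in the band `[m, q]`. Positions before `i` contribute equally, and at `i` only
`y` has a value in the band. The surplus at `(k, m)` is therefore the surplus at `(k, q + 1)`, plus
one, corrected by the band values at positions strictly between `i` and `k`. -/
theorem formula {k m : ℕ} (hik : (i : ℕ) < k) (hpm : (p : ℕ) < m) (hmq : m ≤ q) :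
    cnt y k m + cnt x k (q + 1) +
      (Finset.univ.filter (fun a : Fin n => (i : ℕ) < a ∧ (a : ℕ) < k ∧
        (m ≤ (x a : ℕ) ∧ (x a : ℕ) < q + 1))).card =
    cnt x k m + cnt y k (q + 1) + 1 +
      (Finset.univ.filter (fun a : Fin n => (i : ℕ) < a ∧ (a : ℕ) < k ∧
        (m ≤ (y a : ℕ) ∧ (y a : ℕ) < q + 1))).card := by
  have h1 := cnt_eq_add_between x k (m := m) (m' := q + 1) (by omega)
  have h2 := cnt_eq_add_between y k (m := m) (m' := q + 1) (by omega)
  rw [card_filter_lt_split x (fun t => m ≤ t ∧ t < q + 1) hik, h.xi, if_neg (by omega)] at h1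
  rw [card_filter_lt_split y (fun t => m ≤ t ∧ t < q + 1) hik, h.yi, if_pos (by omega)] at h2
  have h3 : (Finset.univ.filter (fun a : Fin n => (a : ℕ) < i ∧ (m ≤ (x a : ℕ) ∧ (x a : ℕ) < q + 1)))
      = (Finset.univ.filter (fun a : Fin n => (a : ℕ) < i ∧ (m ≤ (y a : ℕ) ∧ (y a : ℕ) < q + 1))) := by
    refine Finset.filter_congr fun a _ => and_congr_right fun ha => ?_
    rw [h.agree a ha]
  rw [h3] at h1
  omega

/-- The same count for the band `[p, m)` below `m`, which at position `i` contains only the value of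
`x`; the roles of `x` and `y` in the correction are exchanged. -/
theorem formula' {k m : ℕ} (hik : (i : ℕ) < k) (hpm : (p : ℕ) < m) (hmq : m ≤ q) :
    cnt y k m + cnt x k p +
      (Finset.univ.filter (fun a : Fin n => (i : ℕ) < a ∧ (a : ℕ) < k ∧
        ((p : ℕ) ≤ (y a : ℕ) ∧ (y a : ℕ) < m))).card =
    cnt x k m + cnt y k p + 1 +
      (Finset.univ.filter (fun a : Fin n => (i : ℕ) < a ∧ (a : ℕ) < k ∧
        ((p : ℕ) ≤ (x a : ℕ) ∧ (x a : ℕ) < m))).card := by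
  have h1 := cnt_eq_add_between x k (m := p) (m' := m) (by omega)
  have h2 := cnt_eq_add_between y k (m := p) (m' := m) (by omega)
  rw [card_filter_lt_split x (fun t => p ≤ t ∧ t < m) hik, h.xi, if_pos (by omega)] at h1
  rw [card_filter_lt_split y (fun t => p ≤ t ∧ t < m) hik, h.yi, if_neg (by omega)] at h2
  have h3 : (Finset.univ.filter (fun a : Fin n => (a : ℕ) < i ∧ (p ≤ (x a : ℕ) ∧ (x a : ℕ) < m)))
      = (Finset.univ.filter (fun a : Fin n => (a : ℕ) < i ∧ (p ≤ (y a : ℕ) ∧ (y a : ℕ) < m))) := by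
    refine Finset.filter_congr fun a _ => and_congr_right fun ha => ?_
    rw [h.agree a ha]
  rw [h3] at h1
  omega

theorem cnt_le {k m : ℕ} (hk : k ≤ n) (hm : m ≤ n) : cnt x k m ≤ cnt y k m :=
  (bruhat_le_iff x y).1 h.le k m hk hm

theorem cnt_lt {k m : ℕ} (hik : (i : ℕ) < k) (hk : k ≤ n) (hpm : (p : ℕ) < m) (hmq : m ≤ q)
    (hx : ∀ t : Fin n, (i : ℕ) < t → (t : ℕ) < k → (m : ℕ) ≤ x t → ¬ (x t : ℕ) ≤ q) :
    cnt x k m < cnt y k m := by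
  have h1 := h.formula hik hpm hmq
  have h2 := h.cnt_le hk (m := q + 1) (by omega)
  have h3 : (Finset.univ.filter (fun a : Fin n => (i : ℕ) < a ∧ (a : ℕ) < k ∧
        (m ≤ (x a : ℕ) ∧ (x a : ℕ) < q + 1))) = ∅ := by
    rw [Finset.filter_eq_empty_iff]
    rintro t - ⟨h1, h2, h3, h4⟩
    exact hx t h1 h2 h3 (by omega)
  rw [h3, Finset.card_empty] at h1
  omega

theorem symm_lt {k m : ℕ} (hk : k ≤ n) (hm : m ≤ n) (hlt : cnt x k m < cnt y k m) :
    cnt x m k < cnt y m k := by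
  have := cnt_diff_symm h.hx h.hy hk hm
  omega

/-- The first `j > i` with `p < x j ≤ q`. -/
theorem exists_index : ∃ j l : Fin n, (i : ℕ) < j ∧ x j = l ∧ (p : ℕ) < l ∧ (l : ℕ) ≤ q ∧
    ∀ t : Fin n, (i : ℕ) < t → (t : ℕ) < j → (p : ℕ) < x t → ¬ (x t : ℕ) ≤ q := by
  classical
  have hex : ∃ m : ℕ, ∃ j : Fin n, (j : ℕ) = m ∧ (i : ℕ) < j ∧ (p : ℕ) < x j ∧ (x j : ℕ) ≤ q := by
    -- The position `x q` qualifies, since `x` takes the value `q` there.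
    refine ⟨x q, x q, rfl, ?_, ?_, ?_⟩
    · by_contra hc
      rcases Nat.lt_or_ge (x q) i with h1 | h1
      · have h2 := h.agree _ h1
        rw [apply_apply_of_mul_self h.hx] at h2
        have h3 : x q = y q := by
          conv_rhs => rw [h2, apply_apply_of_mul_self h.hy]
        rw [h3, h.yq] at h1
        omega
      · have h2 : x q = i := Fin.ext (by omega)
        have h3 : q = p := by rw [← apply_apply_of_mul_self h.hx q, h2, h.xi]
        have := h.pq
        rw [h3] at this
        omega
    · rw [apply_apply_of_mul_self h.hx]; exact h.pq
    · rw [apply_apply_of_mul_self h.hx]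
  obtain ⟨j, hj, h1, h2, h3⟩ := Nat.find_spec hex
  refine ⟨j, x j, h1, rfl, h2, h3, fun t ht1 ht2 ht3 ht4 => ?_⟩
  exact Nat.find_min hex (hj ▸ ht2) ⟨t, rfl, ht1, ht3, ht4⟩

end FirstDiff

/-! ### The move up from the smaller involution -/

theorem excCount_eq_of_fixCount_eq {x z : Equiv.Perm (Fin n)} (hx : x * x = 1) (hz : z * z = 1)
    (h : fixCount z = fixCount x) : excCount z = excCount x := by
  have := two_mul_excCount_add_fixCount hx
  have := two_mul_excCount_add_fixCount hz
  omega

theorem raise_step {x y : Equiv.Perm (Fin n)} (hx : x * x = 1) (hxy : x ≤ y)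
    {a b u v : Fin n} (hab : (a : ℕ) < b)
    (hs : (x a : ℕ) < x b) (hu : Equiv.swap a b (x a) = u) (hv : Equiv.swap a b (x b) = v)
    (huv : (u : ℕ) < v)
    (hfree : ∀ t : Fin n, (a : ℕ) < t → (t : ℕ) < b → ¬ ((x a : ℕ) < x t ∧ (x t : ℕ) < x b))
    (hfree' : ∀ t : Fin n, (u : ℕ) < t → (t : ℕ) < v →
      ¬ ((a : ℕ) < x (Equiv.swap a b t) ∧ (x (Equiv.swap a b t) : ℕ) < b))
    (h1 : ∀ k m : ℕ, (a : ℕ) < k → k ≤ b → (x a : ℕ) < m → m ≤ x b → cnt x k m < cnt y k m)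
    (h2 : ∀ k m : ℕ, (u : ℕ) < k → k ≤ v → (a : ℕ) < m → m ≤ b → cnt x k m < cnt y k m)
    (h3 : ∀ k m : ℕ, (a : ℕ) < k → k ≤ b → (x a : ℕ) < m → m ≤ x b → (u : ℕ) < k → k ≤ v →
      (a : ℕ) < m → m ≤ b → cnt x k m + 2 ≤ cnt y k m) :
    ∃ z : Equiv.Perm (Fin n), z * z = 1 ∧ x ≤ z ∧ z ≤ y ∧ fixCount z = fixCount x ∧
      invCount z + excCount z = invCount x + excCount x + 2 := by
  have hz := conj_swap_mul_self hx a b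
  have hf := fixCount_conj_swap x a b
  obtain ⟨h4, h5⟩ := raise_between hx hxy hab hs hu hv huv h1 h2 h3
  refine ⟨_, hz, h4, h5, hf, ?_⟩
  rw [excCount_eq_of_fixCount_eq hx hz hf, invCount_conj_swap hx hab hs hu hv huv hfree hfree']
  omega

namespace FirstDiff
variable {x y : Equiv.Perm (Fin n)} {i p q : Fin n} (h : FirstDiff x y i p q)
include h

/-- From the first difference of `x < y`, one goes up by a conjugation, or by joining two fixed
points, or by merging two arcs. -/
theorem step : (∃ z : Equiv.Perm (Fin n), z * z = 1 ∧ x ≤ z ∧ z ≤ y ∧ fixCount z = fixCount x ∧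
      invCount z + excCount z = invCount x + excCount x + 2) ∨
    (p = i ∧ ∃ j : Fin n, (i : ℕ) < j ∧ (j : ℕ) ≤ q ∧ x j = j ∧
      (∀ t : Fin n, (i : ℕ) < t → (t : ℕ) < j → (p : ℕ) < x t → ¬ (x t : ℕ) ≤ q) ∧
      x ≤ x * Equiv.swap i j ∧ x * Equiv.swap i j ≤ y ∧
      invCount (x * Equiv.swap i j) + excCount (x * Equiv.swap i j) =
        invCount x + excCount x + 2) ∨
    (∃ j l : Fin n, (i : ℕ) < p ∧ (p : ℕ) < j ∧ (j : ℕ) < l ∧ (l : ℕ) ≤ q ∧ x j = l ∧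
      (∀ t : Fin n, (i : ℕ) < t → (t : ℕ) < j → (p : ℕ) < x t → ¬ (x t : ℕ) ≤ q) ∧
      x ≤ mergeArcs x i p j l ∧ mergeArcs x i p j l ≤ y ∧
      invCount (mergeArcs x i p j l) + excCount (mergeArcs x i p j l) =
        invCount x + excCount x + 2) := by
  obtain ⟨j, l, hij, hxj, hpl, hlq, hmin⟩ := h.exists_index
  have hxl : x l = j := by rw [← hxj, apply_apply_of_mul_self h.hx]
  have hxp := h.xp
  have hpq := h.pq
  have hxi := h.xi
  have hx := h.hx
  have hq := q.isLt
  have hj := j.isLt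
  -- the rectangle where `cnt` increases strictly
  have hD : ∀ k m : ℕ, (i : ℕ) < k → k ≤ j → (p : ℕ) < m → m ≤ q → cnt x k m < cnt y k m :=
    fun k m h1 h2 h3 h4 => h.cnt_lt h1 (by omega) h3 h4
      fun t ht1 ht2 ht3 => hmin t ht1 (by omega) (by omega)
  have hD' : ∀ k m : ℕ, (i : ℕ) < m → m ≤ j → (p : ℕ) < k → k ≤ q → cnt x k m < cnt y k m :=
    fun k m h1 h2 h3 h4 => h.symm_lt (by omega) (by omega) (hD m k h1 h2 h3 h4)
  have hinv := fun t => apply_apply_of_mul_self hx t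
  -- an argument `t` with `p < t ≤ q` is not mapped into the interval from `i` to `j`
  have hmin' : ∀ t : Fin n, (p : ℕ) < t → (t : ℕ) ≤ q → (i : ℕ) < x t → ¬ (x t : ℕ) < j := by
    intro t h1 h2 h3 h4
    exact hmin (x t) h3 h4 (by rw [hinv]; exact h1) (by rw [hinv]; exact h2)
  have hne : ∀ {a b : Fin n}, (a : ℕ) ≠ b → a ≠ b := fun h1 h2 => h1 (by rw [h2])
  rcases Nat.lt_or_ge j l with hjl | hjl
  · rcases Nat.lt_or_ge i p with hip | hip
    · rcases Nat.lt_or_ge p j with hpj | hpj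
      · -- two arcs side by side
        refine Or.inr (Or.inr ⟨j, l, hip, hpj, hjl, hlq, hxj, hmin, ?_, ?_, ?_⟩)
        · rw [bruhat_le_iff]
          intro k m _ _
          rw [cnt_mergeArcs hx hip hpj hjl hxi hxj]
          omega
        · rw [bruhat_le_iff]
          intro k m hk hm
          rw [cnt_mergeArcs hx hip hpj hjl hxi hxj]
          have h1 := hD k m
          have h2 := hD' k m
          have h3 := h.cnt_le hk hm
          split_ifs <;> omega
        · have h1 := invCount_mergeArcs hx hip hpj hjl hxi hxj
            (fun t h1 h2 h3 => hmin t h1 h2 h3.1 (by omega))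
            (fun t h1 h2 h3 => hmin' t h1 (by omega) h3.1 h3.2)
          have h2 := fixCount_mergeArcs hx hip hpj hjl hxi hxj
          have h3 := two_mul_excCount_add_fixCount hx
          have h4 := two_mul_excCount_add_fixCount
            (mergeArcs_mul_self hx hip hpj hjl hxi hxj)
          omega
      · -- crossing arcs
        have hpj' : (j : ℕ) < p := by
          refine lt_of_le_of_ne hpj fun he => ?_
          have : j = p := Fin.ext he
          rw [this, hxp] at hxj
          rw [hxj] at hip
          omega
        left
        have hu : Equiv.swap i j (x i) = p := by
          rw [hxi, Equiv.swap_apply_of_ne_of_ne (hne (by omega)) (hne (by omega))]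
        have hv : Equiv.swap i j (x j) = l := by
          rw [hxj, Equiv.swap_apply_of_ne_of_ne (hne (by omega)) (hne (by omega))]
        refine raise_step hx h.le hij (by rw [hxi, hxj]; exact hpl) hu hv hpl ?_ ?_ ?_ ?_ ?_
        · intro t h1 h2 h3
          rw [hxi, hxj] at h3
          exact hmin t h1 h2 h3.1 (by omega)
        · intro t h1 h2 h3
          rw [Equiv.swap_apply_of_ne_of_ne (hne (by omega)) (hne (by omega))] at h3
          exact hmin' t h1 (by omega) h3.1 h3.2
        · intro k m h1 h2 h3 h4
          rw [hxi] at h3; rw [hxj] at h4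
          exact hD k m h1 h2 h3 (by omega)
        · intro k m h1 h2 h3 h4
          exact hD' k m h3 h4 h1 (by omega)
        · intros; omega
    · -- a fixed point and an arc to the right of it
      have hpi : p = i := Fin.ext (by have := h.ip; omega)
      subst hpi
      left
      have hu : Equiv.swap p j (x p) = j := by rw [hxi, Equiv.swap_apply_left]
      have hv : Equiv.swap p j (x j) = l := by
        rw [hxj, Equiv.swap_apply_of_ne_of_ne (hne (by omega)) (hne (by omega))]
      refine raise_step hx h.le hij (by rw [hxi, hxj]; exact hpl) hu hv hjl ?_ ?_ ?_ ?_ ?_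
      · intro t h1 h2 h3
        rw [hxi, hxj] at h3
        exact hmin t h1 h2 h3.1 (by omega)
      · intro t h1 h2 h3
        rw [Equiv.swap_apply_of_ne_of_ne (hne (by omega)) (hne (by omega))] at h3
        exact hmin' t (by omega) (by omega) h3.1 h3.2
      · intro k m h1 h2 h3 h4
        rw [hxi] at h3; rw [hxj] at h4
        exact hD k m h1 h2 h3 (by omega)
      · intro k m h1 h2 h3 h4
        exact hD' k m h3 h4 (by omega) (by omega)
      · intros; omega
  · rcases Nat.lt_or_ge l j with hlj | hlj
    · have hqj : (q : ℕ) < j := by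
        by_contra hc
        exact hmin l (by have := h.ip; omega) hlj (by rw [hxl]; omega) (by rw [hxl]; omega)
      rcases Nat.lt_or_ge i p with hip | hip
      · -- an arc inside another one, to the right of `p`
        left
        have hu : Equiv.swap p l (x p) = i := by
          rw [hxp, Equiv.swap_apply_of_ne_of_ne (hne (by omega)) (hne (by omega))]
        have hv : Equiv.swap p l (x l) = j := by
          rw [hxl, Equiv.swap_apply_of_ne_of_ne (hne (by omega)) (hne (by omega))]
        refine raise_step hx h.le hpl (by rw [hxp, hxl]; exact hij) hu hv hij ?_ ?_ ?_ ?_ ?_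
        · intro t h1 h2 h3
          rw [hxp, hxl] at h3
          exact hmin' t h1 (by omega) h3.1 h3.2
        · intro t h1 h2 h3
          by_cases e1 : t = p
          · subst e1
            rw [Equiv.swap_apply_left, hxl] at h3
            omega
          by_cases e2 : t = l
          · subst e2
            rw [Equiv.swap_apply_right, hxp] at h3
            omega
          rw [Equiv.swap_apply_of_ne_of_ne e1 e2] at h3
          exact hmin t h1 h2 h3.1 (by omega)
        · intro k m h1 h2 h3 h4
          rw [hxp] at h3; rw [hxl] at h4
          exact hD' k m h3 h4 h1 (by omega)
        · intro k m h1 h2 h3 h4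
          exact hD k m h1 h2 h3 (by omega)
        · intro k m h1 h2 _ _ _ _ h7 h8
          -- On the overlap a surplus of two is needed. No value of `x` lies in the band, and the
          -- surplus at `(k, q + 1)` is already positive because `q + 1 ≤ j`.
          have h9 := h.formula (k := k) (m := m) (by omega) (by omega) (by omega)
          have h10 : (Finset.univ.filter (fun a : Fin n => (i : ℕ) < a ∧ (a : ℕ) < k ∧
              (m ≤ (x a : ℕ) ∧ (x a : ℕ) < q + 1))) = ∅ := by
            rw [Finset.filter_eq_empty_iff]
            rintro t - ⟨h1, h2, h3, h4⟩
            exact hmin t h1 (by omega) (by omega) (by omega)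
          rw [h10, Finset.card_empty] at h9
          have h11 := hD' k (q + 1) (by omega) (by omega) h1 (by omega)
          omega
      · -- a fixed point followed by a descending arc: impossible
        exfalso
        have hpi : p = i := Fin.ext (by have := h.ip; omega)
        subst hpi
        have h1 := hD' (p + 1) (q + 1) (by omega) (by omega) (by omega) (by omega)
        rw [cnt, cnt] at h1
        rw [card_filter_lt_split y (fun t => (q + 1 : ℕ) ≤ t) (Nat.lt_succ_self _),
          card_filter_lt_split x (fun t => (q + 1 : ℕ) ≤ t) (Nat.lt_succ_self _), h.xi, h.yi,
          if_neg (by omega), if_neg (by omega)] at h1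
        have e : ∀ σ : Equiv.Perm (Fin n), (Finset.univ.filter (fun a : Fin n => (p : ℕ) < a ∧
            (a : ℕ) < p.val.succ ∧ ((q : ℕ) + 1 ≤ (σ a : ℕ)))) = ∅ := by
          intro σ
          rw [Finset.filter_eq_empty_iff]
          rintro t - ⟨h1, h2, h3⟩
          omega
        rw [e, e] at h1
        have h3 : (Finset.univ.filter (fun a : Fin n => (a : ℕ) < p ∧ ((q : ℕ) + 1 ≤ (x a : ℕ)))) =
            (Finset.univ.filter (fun a : Fin n => (a : ℕ) < p ∧ ((q : ℕ) + 1 ≤ (y a : ℕ)))) := by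
          refine Finset.filter_congr fun a _ => and_congr_right fun ha => ?_
          rw [h.agree a ha]
        rw [h3] at h1
        omega
    · have hl : l = j := Fin.ext (by omega)
      subst hl
      rcases Nat.lt_or_ge i p with hip | hip
      · -- an arc and a fixed point to the right of it
        left
        have hu : Equiv.swap p l (x p) = i := by
          rw [hxp, Equiv.swap_apply_of_ne_of_ne (hne (by omega)) (hne (by omega))]
        have hv : Equiv.swap p l (x l) = p := by rw [hxl, Equiv.swap_apply_right]
        refine raise_step hx h.le hpl (by rw [hxp, hxl]; exact hij) hu hv hip ?_ ?_ ?_ ?_ ?_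
        · intro t h1 h2 h3
          rw [hxp, hxl] at h3
          exact hmin' t h1 (by omega) h3.1 h3.2
        · intro t h1 h2 h3
          rw [Equiv.swap_apply_of_ne_of_ne (hne (by omega)) (hne (by omega))] at h3
          exact hmin t h1 (by omega) h3.1 (by omega)
        · intro k m h1 h2 h3 h4
          rw [hxp] at h3; rw [hxl] at h4
          exact hD' k m h3 h4 h1 (by omega)
        · intro k m h1 h2 h3 h4
          exact hD k m h1 (by omega) h3 (by omega)
        · intros; omega
      · -- two fixed points
        have hpi : p = i := Fin.ext (by have := h.ip; omega)
        subst hpi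
        have hlt : (x p : ℕ) < x l := by rw [hxi, hxl]; exact hij
        refine Or.inr (Or.inl ⟨rfl, l, hij, hlq, hxl, hmin, ?_, ?_, ?_⟩)
        · rw [bruhat_le_iff]
          intro k m _ _
          rw [cnt_mul_swap x hij hlt]
          omega
        · rw [bruhat_le_iff]
          intro k m hk hm
          rw [cnt_mul_swap x hij hlt, hxi, hxl]
          have h1 := hD k m
          have h3 := h.cnt_le hk hm
          split_ifs <;> omega
        · have h1 := invCount_mul_swap x hij hlt (fun t h1 h2 h3 => by
            rw [hxi, hxl] at h3
            exact hmin t h1 h2 h3.1 (by omega))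
          have h2 := fixCount_join (hne (by omega)) hxi hxl
          have h3 := two_mul_excCount_add_fixCount hx
          have h4 := two_mul_excCount_add_fixCount (join_mul_self hx hxi hxl)
          omega

end FirstDiff

theorem exists_step {x y : Equiv.Perm (Fin n)} (hx : x * x = 1) (hy : y * y = 1) (hle : x ≤ y)
    (hne : x ≠ y) : ∃ z : Equiv.Perm (Fin n), z * z = 1 ∧ x ≤ z ∧ z ≤ y ∧
      invCount z + excCount z = invCount x + excCount x + 2 ∧
      (fixCount z = fixCount x ∨ fixCount z + 2 = fixCount x ∨ fixCount z = fixCount x + 2) := by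
  obtain ⟨i, p, q, h⟩ := exists_firstDiff hx hy hle hne
  rcases h.step with ⟨z, h1, h2, h3, h4, h5⟩ | ⟨rfl, j, h1, h2, h3, h4, h5, h6, h7⟩ |
    ⟨j, l, h1, h2, h3, h4, h5, h6, h7, h8, h9⟩
  · exact ⟨z, h1, h2, h3, h5, Or.inl h4⟩
  · have hne : p ≠ j := by rintro rfl; omega
    exact ⟨_, join_mul_self hx h.xi h3, h5, h6, h7, Or.inr (Or.inl (fixCount_join hne h.xi h3))⟩
  · exact ⟨_, mergeArcs_mul_self hx h1 h2 h3 h.xi h5, h7, h8, h9,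
      Or.inr (Or.inr (fixCount_mergeArcs hx h1 h2 h3 h.xi h5))⟩

/-- Iterating the move up from `x` reaches `y`, and each move adds two. -/
theorem rank_lt_rank {x y : Equiv.Perm (Fin n)} (hx : x * x = 1) (hy : y * y = 1) (hle : x ≤ y)
    (hne : x ≠ y) : invCount x + excCount x < invCount y + excCount y := by
  induction x using WellFoundedGT.induction with
  | _ x ih =>
    obtain ⟨z, h1, h2, h3, h4, -⟩ := exists_step hx hy hle hne
    by_cases hzy : z = y
    · subst hzy; omega
    · have hxz : x < z := lt_of_le_of_ne h2 (by rintro rfl; omega)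
      have := ih z hxz h1 h3 hzy
      omega

/-- Between two involutions every intermediate number of fixed points of the right parity
occurs. -/
theorem exists_fixCount_eq {x y : Equiv.Perm (Fin n)} (hx : x * x = 1) (hy : y * y = 1)
    (hle : x ≤ y) {c : ℕ} (hc : c % 2 = n % 2)
    (h : (fixCount y < c ∧ c < fixCount x) ∨ (fixCount x < c ∧ c < fixCount y)) :
    ∃ w : Equiv.Perm (Fin n), w * w = 1 ∧ x ≤ w ∧ w ≤ y ∧ fixCount w = c := by
  induction x using WellFoundedGT.induction with
  | _ x ih =>
    obtain ⟨z, h1, h2, h3, h4, h5⟩ := exists_step hx hy hle (by rintro rfl; omega)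
    have hxz : x < z := lt_of_le_of_ne h2 (by rintro rfl; omega)
    have h6 := two_mul_excCount_add_fixCount h1
    have h7 := two_mul_excCount_add_fixCount hx
    by_cases hzc : fixCount z = c
    · exact ⟨z, h1, h2, h3, hzc⟩
    -- A move changes the number of fixed points by at most two, and parity is constant, so `c`
    -- cannot be jumped over.
    · obtain ⟨w, h8, h9, h10, h11⟩ := ih z hxz h1 h3 (by omega)
      exact ⟨w, h8, h2.trans h9, h10, h11⟩

/-! ### Moves down from the larger involution -/

section lower
variable {x y : Equiv.Perm (Fin n)} (hx : x * x = 1) (hy : y * y = 1) (hxy : x ≤ y)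
  {i q : Fin n} (hi : y i = q)
include hx hy hxy hi

/-- The nested arcs `(i q)` and `(a w)` of `y` are replaced by the crossing arcs `(i w)` and `(a
q)`. The hypothesis covers one of the two rectangles that lose a unit; the other is its transpose.
-/
theorem exists_lower_nested {a w : Fin n} (hia : (i : ℕ) < a)
    (haw : (a : ℕ) < w) (hwq : (w : ℕ) < q) (ha : y a = w)
    (hD : ∀ k m : ℕ, (i : ℕ) < k → k ≤ a → (w : ℕ) < m → m ≤ q → cnt x k m < cnt y k m) :
    ∃ z : Equiv.Perm (Fin n), z * z = 1 ∧ x ≤ z ∧ z ≤ y ∧ fixCount z = fixCount y ∧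
      z i = w ∧ z a = q := by
  have hq : y q = i := by rw [← hi, apply_apply_of_mul_self hy]
  have hw : y w = a := by rw [← ha, apply_apply_of_mul_self hy]
  have hne : ∀ {a b : Fin n}, (a : ℕ) ≠ b → a ≠ b := fun h1 h2 => h1 (by rw [h2])
  have hu : Equiv.swap w q (y q) = i := by
    rw [hq, Equiv.swap_apply_of_ne_of_ne (hne (by omega)) (hne (by omega))]
  have hv : Equiv.swap w q (y w) = a := by
    rw [hw, Equiv.swap_apply_of_ne_of_ne (hne (by omega)) (hne (by omega))]
  obtain ⟨h1, h2⟩ := lower_between hy hxy hwq (by rw [hq, hw]; exact hia) hu hv hia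
    (fun k m h1 h2 h3 h4 => by
      have := cnt_diff_symm hx hy (k := k) (m := m) (by omega) (by omega)
      have := hD m k h3 h4 h1 h2
      omega)
    (fun k m h1 h2 h3 h4 => by
      rw [hq] at h1; rw [hw] at h2
      exact hD k m h1 h2 h3 h4)
    (fun k m h1 h2 _ _ h5 h6 => by
      rw [hw] at h6; omega)
  refine ⟨_, conj_swap_mul_self hy w q, h1, h2, fixCount_conj_swap y w q, ?_, ?_⟩
  · rw [Equiv.Perm.mul_apply, Equiv.Perm.mul_apply,
      Equiv.swap_apply_of_ne_of_ne (x := i) (hne (by omega)) (hne (by omega)), hi,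
      Equiv.swap_apply_right]
  · rw [Equiv.Perm.mul_apply, Equiv.Perm.mul_apply,
      Equiv.swap_apply_of_ne_of_ne (x := a) (hne (by omega)) (hne (by omega)), ha,
      Equiv.swap_apply_left]

/-- The arc `(i q)` is shortened to `(i g)` at a fixed point `g` under it, and `q` becomes fixed. -/
theorem exists_lower_fixed_left {g : Fin n} (hig : (i : ℕ) < g) (hgq : (g : ℕ) < q) (hg : y g = g)
    (hD : ∀ k m : ℕ, (i : ℕ) < k → k ≤ q → (g : ℕ) < m → m ≤ q → cnt x k m < cnt y k m) :
    ∃ z : Equiv.Perm (Fin n), z * z = 1 ∧ x ≤ z ∧ z ≤ y ∧ fixCount z = fixCount y ∧ z i = g ∧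
      ∀ t, t ≠ i → t ≠ g → t ≠ q → z t = y t := by
  have hq : y q = i := by rw [← hi, apply_apply_of_mul_self hy]
  have hne : ∀ {a b : Fin n}, (a : ℕ) ≠ b → a ≠ b := fun h1 h2 => h1 (by rw [h2])
  have hu : Equiv.swap g q (y q) = i := by
    rw [hq, Equiv.swap_apply_of_ne_of_ne (hne (by omega)) (hne (by omega))]
  have hv : Equiv.swap g q (y g) = q := by rw [hg, Equiv.swap_apply_left]
  obtain ⟨h1, h2⟩ := lower_between hy hxy hgq (by rw [hq, hg]; exact hig) hu hv (by omega)
    (fun k m h1 h2 h3 h4 => by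
      have := cnt_diff_symm hx hy (k := k) (m := m) (by omega) (by omega)
      have := hD m k h3 h4 h1 h2
      omega)
    (fun k m h1 h2 h3 h4 => by
      rw [hq] at h1; rw [hg] at h2
      exact hD k m h1 (by omega) h3 h4)
    (fun k m h1 h2 _ _ h5 h6 => by
      rw [hg] at h6; omega)
  refine ⟨_, conj_swap_mul_self hy g q, h1, h2, fixCount_conj_swap y g q, ?_, ?_⟩
  · rw [Equiv.Perm.mul_apply, Equiv.Perm.mul_apply,
      Equiv.swap_apply_of_ne_of_ne (x := i) (hne (by omega)) (hne (by omega)), hi,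
      Equiv.swap_apply_right]
  · intro t e1 e2 e3
    rw [Equiv.Perm.mul_apply, Equiv.Perm.mul_apply, Equiv.swap_apply_of_ne_of_ne e2 e3,
      Equiv.swap_apply_of_ne_of_ne]
    · exact fun h => e2 (by rw [← apply_apply_of_mul_self hy t, h, hg])
    · exact fun h => e1 (by rw [← apply_apply_of_mul_self hy t, h, hq])

/-- The arc `(i q)` is shortened from the other side to `(g q)`, and `i` becomes fixed. -/
theorem exists_lower_fixed_right {g : Fin n} (hig : (i : ℕ) < g) (hgq : (g : ℕ) < q) (hg : y g = g)
    (hD : ∀ k m : ℕ, (i : ℕ) < k → k ≤ g → (i : ℕ) < m → m ≤ q → cnt x k m < cnt y k m) :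
    ∃ z : Equiv.Perm (Fin n), z * z = 1 ∧ x ≤ z ∧ z ≤ y ∧ fixCount z = fixCount y ∧ z i = i ∧
      z g = q ∧ z q = g ∧ ∀ t, t ≠ i → t ≠ g → t ≠ q → z t = y t := by
  have hq : y q = i := by rw [← hi, apply_apply_of_mul_self hy]
  have hne : ∀ {a b : Fin n}, (a : ℕ) ≠ b → a ≠ b := fun h1 h2 => h1 (by rw [h2])
  have hu : Equiv.swap i g (y g) = i := by rw [hg, Equiv.swap_apply_right]
  have hv : Equiv.swap i g (y i) = q := by
    rw [hi, Equiv.swap_apply_of_ne_of_ne (hne (by omega)) (hne (by omega))]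
  obtain ⟨h1, h2⟩ := lower_between hy hxy hig (by rw [hi, hg]; exact hgq) hu hv (by omega)
    (fun k m h1 h2 h3 h4 => hD k m h1 h2 h3 h4)
    (fun k m h1 h2 h3 h4 => by
      rw [hg] at h1; rw [hi] at h2
      have := cnt_diff_symm hx hy (k := k) (m := m) (by omega) (by omega)
      have := hD m k h3 h4 (by omega) h2
      omega)
    (fun k m h1 h2 _ _ h5 h6 => by
      rw [hg] at h5; omega)
  refine ⟨_, conj_swap_mul_self hy i g, h1, h2, fixCount_conj_swap y i g, ?_, ?_, ?_, ?_⟩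
  · rw [Equiv.Perm.mul_apply, Equiv.Perm.mul_apply, Equiv.swap_apply_left, hg,
      Equiv.swap_apply_right]
  · rw [Equiv.Perm.mul_apply, Equiv.Perm.mul_apply, Equiv.swap_apply_right, hi,
      Equiv.swap_apply_of_ne_of_ne (hne (by omega)) (hne (by omega))]
  · rw [Equiv.Perm.mul_apply, Equiv.Perm.mul_apply,
      Equiv.swap_apply_of_ne_of_ne (x := q) (hne (by omega)) (hne (by omega)), hq,
      Equiv.swap_apply_left]
  · intro t e1 e2 e3
    rw [Equiv.Perm.mul_apply, Equiv.Perm.mul_apply, Equiv.swap_apply_of_ne_of_ne e1 e2,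
      Equiv.swap_apply_of_ne_of_ne]
    · exact fun h => e3 (by rw [← apply_apply_of_mul_self hy t, h, hi])
    · exact fun h => e2 (by rw [← apply_apply_of_mul_self hy t, h, hg])

-- The inverse of joining: the arc `(i q)` is removed. Here `cnt` drops on a single square, so
-- transposition is not needed.
omit hx in
theorem exists_lower_split (hiq : (i : ℕ) < q)
    (hD : ∀ k m : ℕ, (i : ℕ) < k → k ≤ q → (i : ℕ) < m → m ≤ q → cnt x k m < cnt y k m) :
    ∃ z : Equiv.Perm (Fin n), z * z = 1 ∧ x ≤ z ∧ z ≤ y ∧ fixCount z = fixCount y + 2 ∧ z i = i ∧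
      z q = q ∧ ∀ t, t ≠ i → t ≠ q → z t = y t := by
  have hq : y q = i := by rw [← hi, apply_apply_of_mul_self hy]
  have hne : i ≠ q := fun h => by rw [h] at hiq; omega
  let z := y * Equiv.swap i q
  have z1 : z i = i := by simp [z, hq]
  have z2 : z q = q := by simp [z, hi]
  have z3 : ∀ t, t ≠ i → t ≠ q → z t = y t := fun t e1 e2 => join_apply_of_ne y e1 e2
  have hzy : z * Equiv.swap i q = y := by simp [z, mul_assoc]
  have hzz : z * z = 1 := by
    apply mul_self_of_apply_apply
    intro t
    by_cases e1 : t = i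
    · rw [e1, z1, z1]
    by_cases e2 : t = q
    · rw [e2, z2, z2]
    rw [z3 t e1 e2, z3, apply_apply_of_mul_self hy]
    · exact fun h => e2 (by rw [← apply_apply_of_mul_self hy t, h, hi])
    · exact fun h => e1 (by rw [← apply_apply_of_mul_self hy t, h, hq])
  have hc := cnt_mul_swap z hiq (by rw [z1, z2]; exact hiq)
  rw [hzy, z1, z2] at hc
  rw [bruhat_le_iff] at hxy
  refine ⟨z, hzz, ?_, ?_, ?_, z1, z2, z3⟩
  · rw [bruhat_le_iff]
    intro k m hk hm
    have := hD k m
    have := hxy k m hk hm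
    have := hc k m
    split_ifs at this <;> omega
  · rw [bruhat_le_iff]
    intro k m hk hm
    rw [hc]; omega
  · have := fixCount_join hne z1 z2
    rw [hzy] at this
    exact this.symm

/-- The inverse of merging: an arc `(i q)` over two fixed points is broken into `(i g)` and `(g'
q)`. -/
theorem exists_lower_unmerge {g g' : Fin n} (hig : (i : ℕ) < g) (hgg : (g : ℕ) < g')
    (hgq : (g' : ℕ) < q) (hg : y g = g) (hg' : y g' = g')
    (hD : ∀ k m : ℕ, (i : ℕ) < k → k ≤ g' → (g : ℕ) < m → m ≤ q → cnt x k m < cnt y k m) :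
    ∃ z : Equiv.Perm (Fin n), z * z = 1 ∧ x ≤ z ∧ z ≤ y ∧ fixCount z + 2 = fixCount y ∧ z i = g ∧
      z g' = q ∧ mergeArcs z i g g' q = y ∧ ∀ t, t ≠ i → t ≠ g → t ≠ g' → t ≠ q → z t = y t := by
  obtain ⟨z, z1, z2, z3, z4, z5⟩ := exists_mergeArcs_eq hy hig hgg hgq hi hg hg'
  have hc := cnt_mergeArcs z1 hig hgg hgq z2 z3
  have hf := fixCount_mergeArcs z1 hig hgg hgq z2 z3
  rw [z4] at hc hf
  rw [bruhat_le_iff] at hxy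
  refine ⟨z, z1, ?_, ?_, hf.symm, z2, z3, z4, z5⟩
  · rw [bruhat_le_iff]
    intro k m hk hm
    have h1 := hD k m
    have h2 := hD m k
    have h3 := hxy k m hk hm
    have h4 := cnt_diff_symm hx hy hk hm
    have h5 := hc k m
    split_ifs at h5 <;> omega
  · rw [bruhat_le_iff]
    intro k m hk hm
    rw [hc]; omega

end lower

/-! ### When merging leaves the allowed range -/

theorem cnt_succ (σ : Equiv.Perm (Fin n)) (t : Fin n) (m : ℕ) :
    cnt σ (t + 1) m = cnt σ t m + if m ≤ σ t then 1 else 0 := by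
  rw [cnt, card_filter_lt_split σ (fun s => m ≤ s) (Nat.lt_succ_self t), cnt]
  have : (Finset.univ.filter (fun a : Fin n => (t : ℕ) < a ∧ (a : ℕ) < t.val.succ ∧
      (m ≤ (σ a : ℕ)))) = ∅ := by
    rw [Finset.filter_eq_empty_iff]
    rintro t - ⟨h1, h2, h3⟩
    omega
  rw [this, Finset.card_empty, add_zero]

/-- The count at `(t, t)` is the number of arcs crossing the gap before `t`. Passing a point that is
not fixed opens or closes one arc, so the parity changes. -/
theorem cnt_diag_succ {σ : Equiv.Perm (Fin n)} (hσ : σ * σ = 1) {t : Fin n} (ht : σ t ≠ t) :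
    (cnt σ (t + 1) (t + 1) + cnt σ t t) % 2 = 1 := by
  have h1 := cnt_succ σ t (t + 1)
  have h2 := cnt_symm hσ (k := t) (m := t + 1) (by omega) (by omega)
  have h3 := cnt_succ σ t t
  have h4 : (σ t : ℕ) ≠ t := fun h => ht (Fin.ext h)
  split_ifs at h1 h3 <;> omega

namespace FirstDiff
variable {x y : Equiv.Perm (Fin n)} {i p q : Fin n} (h : FirstDiff x y i p q)
include h

/-- If going up from the first difference means merging two arcs of `x` (and this does not lead
to `y` at once), there is another involution between `x` and `y` with few fixed points. -/
theorem exists_between_of_merge {j l : Fin n} (hip : (i : ℕ) < p) (hpj : (p : ℕ) < j)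
    (hjl : (j : ℕ) < l) (hlq : (l : ℕ) ≤ q) (hxj : x j = l)
    (hmin : ∀ t : Fin n, (i : ℕ) < t → (t : ℕ) < j → (p : ℕ) < x t → ¬ (x t : ℕ) ≤ q)
    (hmerge : mergeArcs x i p j l ≠ y) :
    ∃ z : Equiv.Perm (Fin n), z * z = 1 ∧ x ≤ z ∧ z ≤ y ∧ z ≠ x ∧ z ≠ y ∧
      (fixCount z = fixCount x ∨ fixCount z = fixCount y ∨ fixCount z + 2 = fixCount y) := by
  by_contra hno
  have hx := h.hx
  have hy := h.hy
  have hxi := h.xi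
  have hyi := h.yi
  have hxp := h.xp
  have hyq := h.yq
  have hq := q.isLt
  have hj := j.isLt
  have hD : ∀ k m : ℕ, (i : ℕ) < k → k ≤ j → (p : ℕ) < m → m ≤ q → cnt x k m < cnt y k m :=
    fun k m h1 h2 h3 h4 => h.cnt_lt h1 (by omega) h3 h4
      fun t ht1 ht2 ht3 => hmin t ht1 (by omega) (by omega)
  have hD' : ∀ k m : ℕ, (i : ℕ) < m → m ≤ j → (p : ℕ) < k → k ≤ q → cnt x k m < cnt y k m :=
    fun k m h1 h2 h3 h4 => h.symm_lt (by omega) (by omega) (hD m k h1 h2 h3 h4)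
  have hne : ∀ {a b : Fin n}, (a : ℕ) ≠ b → a ≠ b := fun h1 h2 => h1 (by rw [h2])
  have hyinv := fun t => apply_apply_of_mul_self hy t
  -- An arc of `y` under `(i q)` could be crossed with `(i q)` from above, giving a forbidden `z`;
  -- so there is none wherever the surplus allows this move.
  have nested : ∀ a w : Fin n, y a = w → (i : ℕ) < a → (a : ℕ) < w → (w : ℕ) < q → (p : ℕ) ≤ w →
      (∀ k m : ℕ, (i : ℕ) < k → k ≤ a → (w : ℕ) < m → m ≤ q → cnt x k m < cnt y k m) → False := by
    intro a w h1 h2 h3 h4 h5 h6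
    obtain ⟨z, z1, z2, z3, z4, z5, z6⟩ := exists_lower_nested hx hy h.le hyi h2 h3 h4 h1 h6
    refine hno ⟨z, z1, z2, z3, ?_, ?_, Or.inr (Or.inl z4)⟩
    · rintro rfl
      rw [hxi] at z5
      subst z5
      exact hmin a h2 (by omega) (by rw [z6]; exact h4) (by rw [z6])
    · rintro rfl
      rw [hyi] at z5
      subst z5
      omega
  -- crossing the two arcs fails, hence `cnt` increases by one only at some place
  obtain ⟨k, m, hpk, hkm, hmj, hkm1⟩ : ∃ k m : ℕ, (p : ℕ) < k ∧ k ≤ m ∧ m ≤ j ∧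
      cnt y k m ≤ cnt x k m + 1 := by
    by_contra hR
    have hR' : ∀ k m : ℕ, (p : ℕ) < k → k ≤ j → (p : ℕ) < m → m ≤ j →
        cnt x k m + 2 ≤ cnt y k m := by
      intro k m h1 h2 h3 h4
      by_contra hc
      rcases le_total k m with h5 | h5
      · exact hR ⟨k, m, h1, h5, h4, by omega⟩
      · have := cnt_diff_symm hx hy (k := k) (m := m) (by omega) (by omega)
        exact hR ⟨m, k, h3, h5, h2, by omega⟩
    have hu : Equiv.swap p j (x p) = i := by
      rw [hxp, Equiv.swap_apply_of_ne_of_ne (hne (by omega)) (hne (by omega))]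
    have hv : Equiv.swap p j (x j) = l := by
      rw [hxj, Equiv.swap_apply_of_ne_of_ne (hne (by omega)) (hne (by omega))]
    obtain ⟨z2, z3⟩ := raise_between hx h.le hpj (by rw [hxp, hxj]; omega) hu hv (by omega)
      (fun k m h1 h2 h3 h4 => by
        rw [hxp] at h3; rw [hxj] at h4
        rcases Nat.lt_or_ge j m with h5 | h5
        · exact hD k m (by omega) h2 (by omega) (by omega)
        · exact hD' k m h3 h5 h1 (by omega))
      (fun k m h1 h2 h3 h4 => by
        rcases Nat.lt_or_ge j k with h5 | h5
        · exact hD' k m (by omega) h4 (by omega) (by omega)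
        · exact hD k m h1 h5 h3 (by omega))
      (fun k m h1 h2 _ _ _ _ h7 h8 => hR' k m h1 h2 h7 h8)
    have z4 : (Equiv.swap p j * x * Equiv.swap p j) i = j := by
      rw [Equiv.Perm.mul_apply, Equiv.Perm.mul_apply,
        Equiv.swap_apply_of_ne_of_ne (x := i) (hne (by omega)) (hne (by omega)), hxi,
        Equiv.swap_apply_left]
    refine hno ⟨_, conj_swap_mul_self hx p j, z2, z3, fun he => ?_, fun he => ?_,
      Or.inl (fixCount_conj_swap x p j)⟩
    · rw [he, hxi] at z4; rw [z4] at hpj; omega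
    · rw [he, hyi] at z4; rw [← z4] at hjl; omega
  have hXe : ∀ m' : ℕ, k ≤ m' → (Finset.univ.filter (fun a : Fin n => (i : ℕ) < a ∧ (a : ℕ) < k ∧
      (m' ≤ (x a : ℕ) ∧ (x a : ℕ) < q + 1))) = ∅ := by
    intro m' hm'
    rw [Finset.filter_eq_empty_iff]
    rintro t - ⟨h1, h2, h3, h4⟩
    exact hmin t h1 (by omega) (by omega) (by omega)
  -- The surplus at `(k, m)` is at most one, while `formula` makes it at least one plus the surplus
  -- at `(k, q + 1)`.
  have hkq : cnt y k (q + 1) = cnt x k (q + 1) := by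
    have h1 := h.formula (k := k) (m := m) (by omega) (by omega) (by omega)
    have h2 := h.cnt_le (k := k) (m := q + 1) (by omega) (by omega)
    rw [hXe m hkm, Finset.card_empty] at h1
    omega
  have hyq' : ∀ t : Fin n, (i : ℕ) < t → (y t : ℕ) ≠ q := by
    intro t h1 h2
    have h3 : y t = q := Fin.ext h2
    have h4 : t = i := by rw [← hyinv t, h3, hyq]
    rw [h4] at h1; omega
  -- A value of `y` in the band would belong to a nested arc, so nothing is left but the unit from
  -- position `i`.
  have hkk : cnt y k k = cnt x k k + 1 := by
    have h1 := h.formula (k := k) (m := k) (by omega) (by omega) (by omega)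
    have h2 : (Finset.univ.filter (fun a : Fin n => (i : ℕ) < a ∧ (a : ℕ) < k ∧
        (k ≤ (y a : ℕ) ∧ (y a : ℕ) < q + 1))) = ∅ := by
      rw [Finset.filter_eq_empty_iff]
      rintro t - ⟨h1, h2, h3, h4⟩
      have := hyq' t h1
      exact nested t (y t) rfl h1 (by omega) (by omega) (by omega)
        (fun k' m' h5 h6 h7 h8 => hD k' m' h5 (by omega) (by omega) h8)
    rw [hXe k le_rfl, h2, Finset.card_empty] at h1
    omega
  -- `y` has a fixed point `g` between `p` and `k`
  obtain ⟨g, hpg, hgk, hg⟩ : ∃ g : Fin n, (p : ℕ) ≤ g ∧ (g : ℕ) < k ∧ y g = g := by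
    obtain ⟨t, h1, h2, h3, h4⟩ : ∃ t : Fin n, (i : ℕ) < t ∧ (t : ℕ) < k ∧ (p : ℕ) ≤ y t ∧
        (y t : ℕ) < k := by
      by_contra hc
      -- Without such a `t`, the positive surplus at `(k, p)` would make the surplus at `(k, k)` at
      -- least two.
      have h1 := h.formula' (k := k) (m := k) (by omega) (by omega) (by omega)
      have h2 : (Finset.univ.filter (fun a : Fin n => (i : ℕ) < a ∧ (a : ℕ) < k ∧
          ((p : ℕ) ≤ (y a : ℕ) ∧ (y a : ℕ) < k))) = ∅ := by
        rw [Finset.filter_eq_empty_iff]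
        rintro t - ⟨h1, h2, h3, h4⟩
        exact hc ⟨t, h1, h2, h3, h4⟩
      have h3 := hD' k p hip hpj.le (by omega) (by omega)
      rw [h2, Finset.card_empty] at h1
      omega
    rcases lt_trichotomy (t : ℕ) (y t) with h5 | h5 | h5
    · exact (nested t (y t) rfl h1 h5 (by omega) h3
        (fun k' m' h5 h6 h7 h8 => hD k' m' h5 (by omega) (by omega) h8)).elim
    · exact ⟨t, by omega, h2, Fin.ext h5.symm⟩
    · exact (nested (y t) t (hyinv t) (by omega) h5 (by omega) (by omega)
        (fun k' m' h5 h6 h7 h8 => hD k' m' h5 (by omega) (by omega) h8)).elim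
  have hyj : y j ≠ l := by
    intro he
    have := hyq' j (by omega)
    rw [he] at this
    exact nested j l he (by omega) hjl (by omega) (by omega)
      (fun k' m' h5 h6 h7 h8 => hD k' m' h5 (by omega) (by omega) h8)
  -- the rectangle where `cnt` increases strictly, extended to columns beyond `j`
  have hext : ∀ K : ℕ, K ≤ q → (∀ k' m' : ℕ, (j : ℕ) < k' → k' ≤ K → k' ≤ m' → m' ≤ q →
      cnt x k' m' < cnt y k' m') →
      ∀ k' m' : ℕ, (i : ℕ) < k' → k' ≤ K → (p : ℕ) < m' → m' ≤ q → cnt x k' m' < cnt y k' m' := by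
    intro K hK hall k' m' h1 h2 h3 h4
    rcases Nat.lt_or_ge j k' with h5 | h5
    · rcases Nat.lt_or_ge m' k' with h6 | h6
      · apply h.symm_lt (by omega) (by omega)
        rcases Nat.lt_or_ge j m' with h7 | h7
        · exact hall m' k' h7 (by omega) (by omega) (by omega)
        · exact hD m' k' (by omega) h7 (by omega) (by omega)
      · exact hall k' m' h5 h2 h6 h4
    · exact hD k' m' h1 h5 h3 h4
  -- If the surplus is positive at all these places, then it is so on all of `(i, q] × (p, q]` and
  -- `(i q)` can be shortened to `(i g)`. Otherwise take the first `K` where it vanishes.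
  by_cases hex : ∃ K : ℕ, (j : ℕ) < K ∧ ∃ M : ℕ, K ≤ M ∧ M ≤ q ∧ cnt y K M ≤ cnt x K M
  swap
  · have h1 := hext q le_rfl (fun k' m' h1 _ h3 h4 => by
      by_contra hc
      exact hex ⟨k', h1, m', h3, h4, by omega⟩)
    obtain ⟨z, z1, z2, z3, z4, z5, z6⟩ := exists_lower_fixed_left hx hy h.le hyi (g := g)
      (by omega) (by omega) hg (fun k' m' h2 h3 h4 h5 => h1 k' m' h2 h3 (by omega) h5)
    refine hno ⟨z, z1, z2, z3, ?_, ?_, Or.inr (Or.inl z4)⟩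
    · rintro rfl
      have := z6 j (hne (by omega)) (hne (by omega)) (hne (by omega))
      rw [hxj] at this
      exact hyj this.symm
    · rintro rfl
      rw [hyi] at z5
      rw [← z5] at hgk
      omega
  classical
  obtain ⟨hjK, M, hKM, hMq, hM⟩ := Nat.find_spec hex
  have hmin2 := fun K' (h : K' < Nat.find hex) => Nat.find_min hex h
  generalize Nat.find hex = K at hjK hKM hM hmin2
  have hDK : ∀ k' m' : ℕ, (i : ℕ) < k' → k' < K → (p : ℕ) < m' → m' ≤ q →
      cnt x k' m' < cnt y k' m' := by
    intro k' m' h1 h2 h3 h4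
    refine hext (K - 1) (by omega) ?_ k' m' h1 (by omega) h3 h4
    intro k'' m'' h5 h6 h7 h8
    by_contra hc
    exact hmin2 k'' (by omega) ⟨h5, m'', h7, h8, by omega⟩
  -- no fixed points of `x` in `[k, K)`
  have hfx : ∀ f : Fin n, k ≤ f → (f : ℕ) < K → x f ≠ f := by
    intro f h1 h2 h3
    have hu : Equiv.swap p f (x p) = i := by
      rw [hxp, Equiv.swap_apply_of_ne_of_ne (hne (by omega)) (hne (by omega))]
    have hv : Equiv.swap p f (x f) = p := by rw [h3, Equiv.swap_apply_right]
    obtain ⟨z2, z3⟩ := raise_between hx h.le (a := p) (b := f) (by omega)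
      (by rw [hxp, h3]; omega) hu hv hip
      (fun k' m' h4 h5 h6 h7 => by
        rw [hxp] at h6; rw [h3] at h7
        rcases Nat.lt_or_ge p m' with h8 | h8
        · exact hDK k' m' (by omega) (by omega) h8 (by omega)
        · exact h.symm_lt (by omega) (by omega)
            (hDK m' k' h6 (by omega) (by omega) (by omega)))
      (fun k' m' h4 h5 h6 h7 => hDK k' m' h4 (by omega) h6 (by omega))
      (fun k' m' h4 h5 _ _ h6 h7 _ _ => by omega)
    have z4 : (Equiv.swap p f * x * Equiv.swap p f) i = f := by
      rw [Equiv.Perm.mul_apply, Equiv.Perm.mul_apply,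
        Equiv.swap_apply_of_ne_of_ne (x := i) (hne (by omega)) (hne (by omega)), hxi,
        Equiv.swap_apply_left]
    refine hno ⟨_, conj_swap_mul_self hx p f, z2, z3, fun he => ?_, fun he => ?_,
      Or.inl (fixCount_conj_swap x p f)⟩
    · rw [he, hxi] at z4; rw [z4] at hpk; omega
    · rw [he, hyi] at z4; rw [← z4] at h2; omega
  -- no fixed points of `y` in `[k, K)`
  have hfy : ∀ f : Fin n, k ≤ f → (f : ℕ) < K → y f ≠ f := by
    intro f h1 h2 h3
    obtain ⟨z, z1, z2, z3, z4, z5, z6, z7, z8⟩ := exists_lower_unmerge hx hy h.le hyi (g := g)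
      (g' := f) (by omega) (by omega) (by omega) hg h3
      (fun k' m' h2 h3 h4 h5 => hDK k' m' h2 (by omega) (by omega) h5)
    refine hno ⟨z, z1, z2, z3, ?_, ?_, Or.inr (Or.inr z4)⟩
    · rintro rfl
      have hgp : p = g := by rw [← hxi, z5]
      by_cases hjf : j = f
      · apply hmerge
        rw [hgp, hjf, ← hxj, hjf, z6]
        exact z7
      · have hjf' : (j : ℕ) ≠ f := fun he => hjf (Fin.ext he)
        have := z8 j (hne (by omega)) (hne (by omega)) hjf (hne (by omega))
        rw [hxj] at this
        exact hyj this.symm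
    · rintro rfl
      rw [hyi] at z5
      rw [← z5] at hgk
      omega
  -- parity
  have hpar : ∀ s : ℕ, k ≤ s → s ≤ K → (cnt x s s + cnt y s s) % 2 = 1 := by
    intro s hs
    induction s, hs using Nat.le_induction with
    | base => intro _; omega
    | succ s hs ih =>
      intro hsK
      have h0 := ih (by omega)
      -- Neither involution has a fixed point here, so both diagonal counts change parity and the
      -- surplus stays odd, starting from its value one at `k`.
      have h1 := cnt_diag_succ hx (hfx ⟨s, by omega⟩ hs (by simp only; omega))
      have h2 := cnt_diag_succ hy (hfy ⟨s, by omega⟩ hs (by simp only; omega))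
      simp only at h1 h2
      omega
  have h1 := hpar K (by omega) le_rfl
  have h2 := h.cnt_le (k := K) (m := K) (by omega) (by omega)
  have hY : ∀ m' : ℕ, K ≤ m' → (Finset.univ.filter (fun a : Fin n => (i : ℕ) < a ∧ (a : ℕ) < K ∧
      (m' ≤ (y a : ℕ) ∧ (y a : ℕ) < q + 1))) = ∅ := by
    intro m' hm'
    rw [Finset.filter_eq_empty_iff]
    rintro t - ⟨h1, h2, h3, h4⟩
    have := hyq' t h1
    exact nested t (y t) rfl h1 (by omega) (by omega) (by omega)
      (fun k' m' h5 h6 h7 h8 => hDK k' m' h5 (by omega) (by omega) h8)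
  -- The diagonal surplus at `K` is odd, hence positive. With no band values of `y`, the surplus at
  -- `(K, M)` is at least as large, because the band `[M, q]` contains no more values of `x` than
  -- `[K, q]`. This contradicts the choice of `M`.
  have h3 := h.formula (k := K) (m := K) (by omega) (by omega) (by omega)
  have h4 := h.formula (k := K) (m := M) (by omega) (by omega) (by omega)
  rw [hY K le_rfl, Finset.card_empty] at h3
  rw [hY M hKM, Finset.card_empty] at h4
  have h5 := Finset.card_le_card (s := Finset.univ.filter (fun a : Fin n => (i : ℕ) < a ∧
      (a : ℕ) < K ∧ (M ≤ (x a : ℕ) ∧ (x a : ℕ) < q + 1)))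
    (t := Finset.univ.filter (fun a : Fin n => (i : ℕ) < a ∧
      (a : ℕ) < K ∧ (K ≤ (x a : ℕ) ∧ (x a : ℕ) < q + 1)))
    (fun a ha => by
      rw [Finset.mem_filter] at ha ⊢
      exact ⟨ha.1, ha.2.1, ha.2.2.1, by omega, ha.2.2.2.2⟩)
  omega

end FirstDiff

/-! ### When joining leaves the allowed range -/

theorem eq_one_of_bruhat_le_one {x : Equiv.Perm (Fin n)} (h : x ≤ 1) : x = 1 :=
  le_antisymm h (one_le_bruhat x)

/-- If going up from the first difference means joining two fixed points of `x` (and this does not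
lead to `y` at once), one can go down from `y` without losing fixed points. -/
theorem FirstDiff.exists_between_of_join {x y : Equiv.Perm (Fin n)} {i q : Fin n}
    (h : FirstDiff x y i i q) {j : Fin n} (hij : (i : ℕ) < j) (hjq : (j : ℕ) ≤ q) (hxj : x j = j)
    (hmin : ∀ t : Fin n, (i : ℕ) < t → (t : ℕ) < j → (i : ℕ) < x t → ¬ (x t : ℕ) ≤ q)
    (hjoin : x * Equiv.swap i j ≠ y) :
    ∃ z : Equiv.Perm (Fin n), z * z = 1 ∧ x ≤ z ∧ z ≤ y ∧ z ≠ x ∧ z ≠ y ∧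
      (fixCount z = fixCount y ∨ fixCount z = fixCount y + 2) := by
  classical
  have hx := h.hx
  have hy := h.hy
  have hxi := h.xi
  have hyi := h.yi
  have hyq := h.yq
  have hiq := h.pq
  have hq := q.isLt
  have hne : ∀ {a b : Fin n}, (a : ℕ) ≠ b → a ≠ b := fun h1 h2 => h1 (by rw [h2])
  -- Let `g` be the first position after `i` whose value under `y` lies in `[i, q)`; `q` itself is
  -- one. The band below any `m ≤ q` then contains no value of `y` before `g`, which makes the
  -- surplus positive on `(i, g] × (i, q]`. The move down depends on whether `g` is `q`, the left
  -- end of an arc, or a fixed point.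
  have hex : ∃ m : ℕ, ∃ a : Fin n, (a : ℕ) = m ∧ (i : ℕ) < a ∧ (i : ℕ) ≤ y a ∧ (y a : ℕ) < q :=
    ⟨q, q, rfl, hiq, by rw [hyq], by rw [hyq]; exact hiq⟩
  obtain ⟨g, hg, h1, h2, h3⟩ := Nat.find_spec hex
  have hgmin : ∀ t : Fin n, (i : ℕ) < t → (t : ℕ) < g → (i : ℕ) ≤ y t → ¬ (y t : ℕ) < q :=
    fun t ht1 ht2 ht3 ht4 => Nat.find_min hex (hg ▸ ht2) ⟨t, rfl, ht1, ht3, ht4⟩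
  have hgq : (g : ℕ) ≤ q := by
    rw [hg]
    exact Nat.find_min' hex ⟨q, rfl, hiq, by rw [hyq], by rw [hyq]; exact hiq⟩
  clear hg
  have hD : ∀ k m : ℕ, (i : ℕ) < k → k ≤ g → (i : ℕ) < m → m ≤ q → cnt x k m < cnt y k m := by
    intro k m e1 e2 e3 e4
    have h4 := h.formula' e1 e3 e4
    have h5 : (Finset.univ.filter (fun a : Fin n => (i : ℕ) < a ∧ (a : ℕ) < k ∧
        ((i : ℕ) ≤ (y a : ℕ) ∧ (y a : ℕ) < m))) = ∅ := by
      rw [Finset.filter_eq_empty_iff]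
      rintro t - ⟨t1, t2, t3, t4⟩
      exact hgmin t t1 (by omega) t3 (by omega)
    have h6 := h.cnt_le (k := k) (m := i) (by omega) (by omega)
    rw [h5, Finset.card_empty] at h4
    omega
  by_cases hgq' : g = q
  · subst hgq'
    obtain ⟨z, z1, z2, z3, z4, z5, z6, z7⟩ := exists_lower_split hy h.le hyi hiq hD
    refine ⟨z, z1, z2, z3, ?_, ?_, Or.inr z4⟩
    · rintro rfl
      by_cases hjg : j = g
      · subst hjg
        apply hjoin
        ext t
        by_cases e1 : t = i
        · subst e1; simp [hxj, hyi]
        by_cases e2 : t = j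
        · subst e2; simp [hxi, hyq]
        rw [join_apply_of_ne z e1 e2, z7 t e1 e2]
      · have h4 := z7 j (hne (by omega)) hjg
        have h5 : (j : ℕ) ≠ g := fun he => hjg (Fin.ext he)
        rw [hxj] at h4
        exact hgmin j hij (by omega) (by rw [← h4]; omega) (by rw [← h4]; omega)
    · rintro rfl
      rw [hyi] at z5; rw [z5] at hiq; omega
  · have hgq'' : (g : ℕ) < q := lt_of_le_of_ne hgq fun he => hgq' (Fin.ext he)
    rcases lt_trichotomy (g : ℕ) (y g) with h4 | h4 | h4
    · obtain ⟨z, z1, z2, z3, z4, z5, z6⟩ := exists_lower_nested hx hy h.le hyi h1 h4 h3 rfl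
        (fun k m e1 e2 e3 e4 => hD k m e1 e2 (by omega) e4)
      refine ⟨z, z1, z2, z3, ?_, ?_, Or.inl z4⟩
      · rintro rfl
        rw [hxi] at z5; rw [← z5] at h4; omega
      · rintro rfl
        rw [hyi] at z5; rw [← z5] at h3; omega
    · have hgg : y g = g := Fin.ext h4.symm
      obtain ⟨z, z1, z2, z3, z4, z5, z6, z7, z8⟩ := exists_lower_fixed_right hx hy h.le hyi h1 hgq''
        hgg hD
      refine ⟨z, z1, z2, z3, ?_, ?_, Or.inl z4⟩
      · rintro rfl
        have h5 : j ≠ g := by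
          rintro rfl
          exact hgq' (by rw [← hxj, z6])
        have h6 : j ≠ q := by
          rintro rfl
          exact hgq' (by rw [← hxj, z7])
        have h7 := z8 j (hne (by omega)) h5 h6
        rw [hxj] at h7
        have h5' : (j : ℕ) ≠ g := fun he => h5 (Fin.ext he)
        have h6' : (j : ℕ) ≠ q := fun he => h6 (Fin.ext he)
        rcases Nat.lt_or_ge j g with h8 | h8
        · exact hgmin j hij h8 (by rw [← h7]; omega) (by rw [← h7]; omega)
        · exact hmin g h1 (by omega) (by rw [z6]; exact hiq) (by rw [z6])
      · rintro rfl
        rw [hyi] at z5; rw [z5] at hiq; omega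
    -- A right end `g` is impossible: its partner `y g` would be an earlier choice.
    · have h5 : (i : ℕ) ≠ y g := fun he => by
        have : g = q := by rw [← apply_apply_of_mul_self hy g, ← Fin.ext he, hyi]
        exact hgq' this
      exact (hgmin (y g) (by omega) h4 (by rw [apply_apply_of_mul_self hy]; omega)
        (by rw [apply_apply_of_mul_self hy]; exact hgq'')).elim

/-! ### Covering relations for an interval of fixed point numbers -/

/-- In the set of involutions whose number of fixed points lies in a suitable interval, all
covering relations increase `inv + exc` by two. -/
theorem exists_involution_between {x y : Equiv.Perm (Fin n)} (hx : x * x = 1) (hy : y * y = 1)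
    (hle : x ≤ y) (hne : x ≠ y) {a₁ a₂ : ℕ} (ha₁ : a₁ % 2 = n % 2) (ha₂ : a₂ % 2 = n % 2)
    (hx₁ : a₁ ≤ fixCount x) (hx₂ : fixCount x ≤ a₂) (hy₁ : a₁ ≤ fixCount y)
    (hy₂ : fixCount y ≤ a₂) (hcond : a₁ ≤ 1 ∨ (a₁ = a₂ ∧ a₂ + 2 = n) ∨ a₁ + 2 ≤ a₂)
    (hR : invCount y + excCount y ≠ invCount x + excCount x + 2) :
    ∃ z : Equiv.Perm (Fin n), z * z = 1 ∧ x ≤ z ∧ z ≤ y ∧ z ≠ x ∧ z ≠ y ∧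
      a₁ ≤ fixCount z ∧ fixCount z ≤ a₂ := by
  obtain ⟨i, p, q, h⟩ := exists_firstDiff hx hy hle hne
  have px := two_mul_excCount_add_fixCount hx
  have py := two_mul_excCount_add_fixCount hy
  -- an involution obtained by a step up from `x`, followed by one with `c` fixed points
  have ivt : ∀ z : Equiv.Perm (Fin n), z * z = 1 → x ≤ z → z ≤ y →
      invCount z + excCount z = invCount x + excCount x + 2 → ∀ c, c % 2 = n % 2 →
      ((fixCount y < c ∧ c < fixCount z) ∨ (fixCount z < c ∧ c < fixCount y)) →
      ∃ w : Equiv.Perm (Fin n), w * w = 1 ∧ x ≤ w ∧ w ≤ y ∧ w ≠ x ∧ w ≠ y ∧ fixCount w = c := by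
    intro z z1 z2 z3 z4 c hc hzc
    obtain ⟨w, w1, w2, w3, w4⟩ := exists_fixCount_eq z1 hy z3 hc hzc
    refine ⟨w, w1, z2.trans w2, w3, ?_, ?_, w4⟩
    · rintro rfl
      rw [le_antisymm w2 z2] at z4
      omega
    · rintro rfl
      omega
  rcases h.step with ⟨z, h1, h2, h3, h4, h5⟩ | ⟨rfl, j, h1, h2, h3, h4, h5, h6, h7⟩ |
    ⟨j, l, h1, h2, h3, h4, h5, h6, h7, h8, h9⟩
  · refine ⟨z, h1, h2, h3, ?_, ?_, by omega, by omega⟩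
    · rintro rfl; omega
    · rintro rfl; omega
  · have hpj : p ≠ j := by rintro rfl; omega
    have hf := fixCount_join hpj h.xi h3
    have hz := join_mul_self hx h.xi h3
    by_cases hf1 : a₁ + 2 ≤ fixCount x
    · refine ⟨_, hz, h5, h6, fun he => ?_, fun he => ?_, by omega, by omega⟩
      · rw [he] at h7; omega
      · rw [he] at h7; omega
    -- Now `x` has exactly `a₁` fixed points and joining yields `a₁ - 2`. If `y` has more than `a₁`,
    -- the value `a₁` is passed on the way from the joined involution to `y`.
    by_cases hf2 : a₁ < fixCount y
    · obtain ⟨w, w1, w2, w3, w4, w5, w6⟩ := ivt _ hz h5 h6 h7 a₁ ha₁ (by omega)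
      exact ⟨w, w1, w2, w3, w4, w5, by omega, by omega⟩
    obtain ⟨w, w1, w2, w3, w4, w5, w6⟩ := h.exists_between_of_join h1 h2 h3 h4
      (fun he => by rw [he] at h7; omega)
    by_cases hf3 : fixCount w ≤ a₂
    · exact ⟨w, w1, w2, w3, w4, w5, by omega, hf3⟩
    -- Here `a₁ = a₂` and `w` has `a₂ + 2` fixed points. Joining needed two fixed points of `x`, so
    -- `a₁ ≤ 1` is excluded, and `a₂ + 2 = n` remains.
    have hw : w = 1 := (fixCount_eq_iff w).1 (by omega)
    subst hw
    exact (w4 (eq_one_of_bruhat_le_one w2).symm).elim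
  · have hf := fixCount_mergeArcs hx h1 h2 h3 h.xi h5
    have hz := mergeArcs_mul_self hx h1 h2 h3 h.xi h5
    by_cases hf1 : fixCount x + 2 ≤ a₂
    · refine ⟨_, hz, h7, h8, fun he => ?_, fun he => ?_, by omega, by omega⟩
      · rw [he] at h9; omega
      · rw [he] at h9; omega
    obtain ⟨w, w1, w2, w3, w4, w5, w6⟩ := h.exists_between_of_merge h1 h2 h3 h4 h5 h6
      (fun he => by rw [he] at h9; omega)
    by_cases hf2 : a₁ ≤ fixCount w
    · exact ⟨w, w1, w2, w3, w4, w5, hf2, by omega⟩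
    -- The remaining case has `a₂` fixed points in `x`, `a₁` in `y` and `a₁ - 2` in `w`. This
    -- excludes `a₁ ≤ 1`. If `a₂ + 2 = n`, merging would give the identity. If `a₁ + 2 ≤ a₂`, the
    -- value `a₂` is passed on the way from the merged involution to `y`.
    rcases hcond with hc | hc | hc
    · omega
    · have hw := (fixCount_eq_iff (mergeArcs x i p j l)).1 (by omega)
      rw [hw] at h7
      have := (fixCount_eq_iff x).2 (eq_one_of_bruhat_le_one h7)
      omega
    · obtain ⟨w, w1, w2, w3, w4, w5, w6⟩ := ivt _ hz h7 h8 h9 a₂ ha₂ (by omega)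
      exact ⟨w, w1, w2, w3, w4, w5, by omega, by omega⟩

/-! ### Minimal elements -/

theorem le_succ_of_bruhat_le {σ τ : Equiv.Perm (Fin n)} (h : σ ≤ τ)
    (hτ : ∀ a, (τ a : ℕ) ≤ a + 1) (a : Fin n) : (σ a : ℕ) ≤ a + 1 := by
  by_contra hc
  have h1 := (bruhat_le_iff σ τ).1 h (a + 1) (a + 2) (by omega) (by omega)
  have h2 : cnt τ (a + 1) (a + 2) = 0 := by
    rw [cnt, Finset.card_eq_zero, Finset.filter_eq_empty_iff]
    rintro t - ⟨h3, h4⟩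
    have := hτ t
    omega
  have h3 : 0 < cnt σ (a + 1) (a + 2) := by
    rw [cnt, Finset.card_pos]
    exact ⟨a, by rw [Finset.mem_filter]; exact ⟨Finset.mem_univ _, by omega, by omega⟩⟩
  omega

theorem invCount_eq_excCount {σ : Equiv.Perm (Fin n)} (hσ : σ * σ = 1)
    (h : ∀ a, (σ a : ℕ) ≤ a + 1) : invCount σ = excCount σ := by
  have hinv := fun t => apply_apply_of_mul_self hσ t
  symm
  unfold invCount excCount
  refine Finset.card_bij (fun a _ => (a, σ a)) ?_ (fun a _ b _ e => (Prod.mk.inj e).1) ?_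
  · intro a ha
    rw [Finset.mem_filter] at ha ⊢
    refine ⟨Finset.mem_univ _, ha.2, ?_⟩
    rw [hinv]; exact ha.2
  · rintro ⟨a, b⟩ hab
    rw [Finset.mem_filter] at hab
    obtain ⟨-, h1, h2⟩ := hab
    simp only [Fin.lt_def] at h1 h2
    have h3 := h a
    have h4 := h (σ b)
    rw [hinv] at h4
    have h5 : σ a = b := Fin.ext (by omega)
    refine ⟨a, ?_, by rw [h5]⟩
    rw [Finset.mem_filter]
    refine ⟨Finset.mem_univ _, ?_⟩
    rw [h5]; exact h1

/-- Otherwise `y` could only drop across adjacent arcs, and its values on `[i, y i]` would never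
fall below `y i`; but `y` takes the value `i` at `y i`. -/
theorem exists_descent {y : Equiv.Perm (Fin n)} (hy : y * y = 1) {i : Fin n}
    (hi : (i : ℕ) + 1 < y i) : ∃ t t' : Fin n, (t' : ℕ) = t + 1 ∧ (y t' : ℕ) < y t ∧ y t ≠ t' := by
  by_contra hc
  have hyq : y (y i) = i := apply_apply_of_mul_self hy i
  have key : ∀ s : ℕ, (i : ℕ) ≤ s → ∀ hs : s ≤ y i, (y i : ℕ) ≤ y ⟨s, by omega⟩ := by
    intro s hs
    induction s, hs using Nat.le_induction with
    | base => intro _; exact le_rfl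
    | succ s hs ih =>
      intro hs'
      have h1 := ih (by omega)
      by_contra h2
      by_cases h3 : y ⟨s, by omega⟩ = ⟨s + 1, by omega⟩
      · have h4 : y i = ⟨s + 1, by omega⟩ := by
          rw [h3] at h1
          exact Fin.ext (le_antisymm h1 hs')
        have h5 : i = ⟨s, by omega⟩ := y.injective (by rw [h4, h3])
        have h6 := congrArg Fin.val h4
        have h7 := congrArg Fin.val h5
        simp only at h6 h7
        omega
      · exact hc ⟨⟨s, by omega⟩, ⟨s + 1, by omega⟩, rfl, by omega, h3⟩
  have := key (y i) (by omega) le_rfl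
  rw [Fin.eta, hyq] at this
  omega

/-- An involution with at most `a₂ < n` fixed points is minimal among these involutions only if
`inv + exc = n - a₂`. -/
theorem exists_involution_lt_of_not_minimal {y : Equiv.Perm (Fin n)} (hy : y * y = 1) {a₂ : ℕ}
    (ha₂ : a₂ % 2 = n % 2) (ha : a₂ < n) (hy₂ : fixCount y ≤ a₂)
    (hR : invCount y + excCount y + a₂ ≠ n) :
    ∃ z : Equiv.Perm (Fin n), z * z = 1 ∧ z ≤ y ∧ z ≠ y ∧ fixCount y ≤ fixCount z ∧
      fixCount z ≤ a₂ := by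
  have hp := two_mul_excCount_add_fixCount hy
  by_cases hadj : ∀ a, (y a : ℕ) ≤ a + 1
  · have h1 := invCount_eq_excCount hy hadj
    obtain ⟨i, hi⟩ : ∃ i : Fin n, i < y i := by
      by_contra hc
      have : excCount y = 0 := by
        rw [excCount, Finset.card_eq_zero, Finset.filter_eq_empty_iff]
        exact fun t _ ht => hc ⟨t, ht⟩
      omega
    rw [Fin.lt_def] at hi
    have h2 := hadj i
    obtain ⟨z, z1, -, z3, z4, -⟩ := exists_lower_split hy (one_le_bruhat y)
      (i := i) (q := y i) rfl hi (fun k m e1 e2 e3 e4 => by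
        have hk : k = i + 1 := by omega
        have hm : m = i + 1 := by omega
        subst hk; subst hm
        have h3 : cnt (1 : Equiv.Perm (Fin n)) (i + 1) (i + 1) = 0 := by
          rw [cnt, Finset.card_eq_zero, Finset.filter_eq_empty_iff]
          rintro t - ⟨h3, h4⟩
          rw [Equiv.Perm.one_apply] at h4
          omega
        rw [h3, cnt, Finset.card_pos]
        exact ⟨i, by rw [Finset.mem_filter]; exact ⟨Finset.mem_univ _, by omega, by omega⟩⟩)
    refine ⟨z, z1, z3, ?_, by omega, by omega⟩
    rintro rfl
    omega
  · push Not at hadj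
    obtain ⟨i, hi⟩ := hadj
    obtain ⟨t, t', h1, h2, h3⟩ := exists_descent hy hi
    -- Conjugating by the adjacent transposition at a descent that is not itself an arc goes down
    -- and keeps the number of fixed points.
    have htt : (t : ℕ) < t' := by omega
    have huv : (Equiv.swap t t' (y t') : ℕ) < Equiv.swap t t' (y t) := by
      have h3' : (y t : ℕ) ≠ t' := fun e => h3 (Fin.ext e)
      rw [Equiv.swap_apply_def, Equiv.swap_apply_def]
      split_ifs <;> omega
    have hc := cnt_eq_conj_swap_add hy htt h2 rfl rfl huv
    refine ⟨_, conj_swap_mul_self hy t t', ?_, ?_, (fixCount_conj_swap y t t').ge,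
      (fixCount_conj_swap y t t').le.trans hy₂⟩
    · rw [bruhat_le_iff]
      intro k m _ _
      rw [hc]; omega
    · intro he
      have := hc (t + 1) (Equiv.swap t t' (y t))
      rw [he, if_pos (by omega)] at this
      omega

/-! ### The maximum -/

/-- The involution that reverses `{0, …, m - 1} ∪ {n - m, …, n - 1}` and fixes the rest. -/
def outerReverse (n m : ℕ) : Equiv.Perm (Fin n) :=
  Function.Involutive.toPerm
    (fun i : Fin n => if (i : ℕ) < m ∨ n ≤ i + m then Fin.rev i else i) (by
      intro i
      by_cases h : (i : ℕ) < m ∨ n ≤ i + m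
      · have h' : (Fin.rev i : ℕ) < m ∨ n ≤ (Fin.rev i : ℕ) + m := by
          rw [Fin.val_rev]; omega
        simp only [if_pos h, if_pos h', Fin.rev_rev]
      · simp only [if_neg h])

theorem outerReverse_val (m : ℕ) (i : Fin n) : (outerReverse n m i : ℕ) =
    if (i : ℕ) < m ∨ n ≤ i + m then n - 1 - i else i := by
  have h : outerReverse n m i = if (i : ℕ) < m ∨ n ≤ i + m then Fin.rev i else i := rfl
  rw [h]
  split_ifs
  · rw [Fin.val_rev]; omega
  · rfl

theorem outerReverse_mul_self (m : ℕ) : outerReverse n m * outerReverse n m = 1 := by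
  apply mul_self_of_apply_apply
  intro a
  apply Fin.ext
  rw [outerReverse_val, outerReverse_val]
  split_ifs <;> omega

theorem excCount_outerReverse {m : ℕ} (hm : 2 * m ≤ n) : excCount (outerReverse n m) = m := by
  rw [excCount]
  conv_rhs => rw [← card_filter_val_lt (n := n) (k := m) (by omega)]
  congr 1
  refine Finset.filter_congr fun a _ => ?_
  rw [Fin.lt_def, outerReverse_val]
  split_ifs <;> omega

/-- For `k ≤ l`, the points counted by `cnt σ k l` are exceedances, they are among the first `k`,
and their values are among the last `n - l`. The outer reversal attains the minimum of the three
bounds `k`, `n - l`, `m`. -/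
theorem le_outerReverse {σ : Equiv.Perm (Fin n)} (hσ : σ * σ = 1) {m : ℕ}
    (hm : excCount σ ≤ m) : σ ≤ outerReverse n m := by
  have key : ∀ k l : ℕ, k ≤ l → l ≤ n → cnt σ k l ≤ cnt (outerReverse n m) k l := by
    intro k l hkl hl
    have h1 : min (min k (n - l)) m ≤ cnt (outerReverse n m) k l := by
      rw [cnt]
      conv_lhs => rw [← card_filter_val_lt (n := n) (k := min (min k (n - l)) m) (by omega)]
      refine Finset.card_le_card fun a ha => ?_
      rw [Finset.mem_filter] at ha ⊢
      refine ⟨Finset.mem_univ _, by omega, ?_⟩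
      rw [outerReverse_val]
      split_ifs <;> omega
    have h2 : cnt σ k l ≤ k := by have := cnt_add_low σ (k := k) l (by omega); omega
    have h3 : cnt σ k l ≤ excCount σ := by
      refine Finset.card_le_card fun a ha => ?_
      rw [Finset.mem_filter] at ha ⊢
      exact ⟨Finset.mem_univ _, by rw [Fin.lt_def]; omega⟩
    have h4 : cnt σ k l ≤ n - l := by
      have h5 := cnt_symm hσ (k := k) (m := l) (by omega) hl
      have h6 : cnt σ l k ≤ n - k := by
        have h7 : cnt σ l k ≤ cnt σ n k := by
          refine Finset.card_le_card fun a ha => ?_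
          rw [Finset.mem_filter] at ha ⊢
          exact ⟨Finset.mem_univ _, by omega, ha.2.2⟩
        have h8 := cnt_symm hσ (k := n) (m := k) le_rfl (by omega)
        rw [cnt_eq_zero_of_le σ k le_rfl] at h8
        omega
      omega
    omega
  rw [bruhat_le_iff]
  intro k l hk hl
  rcases le_total k l with h | h
  · exact key k l h hl
  · have := key l k h hk
    have := cnt_diff_symm hσ (outerReverse_mul_self m) hk hl
    omega

theorem invCount_outerReverse {m : ℕ} (hm : 2 * m ≤ n) :
    invCount (outerReverse n m) + m = 2 * m * (n - m) := by
  have h1 : ∀ a : Fin n, cnt (outerReverse n m) a (outerReverse n m a) =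
      if (a : ℕ) < m then (a : ℕ) else if (a : ℕ) < n - m then m else a := by
    intro a
    have h2 : ∀ s : ℕ, s ≤ n → (∀ b : Fin n, ((b : ℕ) < a ∧
        (outerReverse n m a : ℕ) ≤ outerReverse n m b) ↔ (b : ℕ) < s) →
        cnt (outerReverse n m) a (outerReverse n m a) = s := by
      intro s hs h
      conv_rhs => rw [← card_filter_val_lt hs]
      rw [cnt]
      congr 1
      exact Finset.filter_congr fun b _ => h b
    apply h2
    · split_ifs <;> omega
    · intro b
      rw [outerReverse_val, outerReverse_val]
      split_ifs <;> omega
  rw [invCount_eq_sum, Finset.sum_congr rfl fun a _ => h1 a,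
    Fin.sum_univ_eq_sum_range
      (fun a : ℕ => if a < m then a else if a < n - m then m else a) n]
  obtain ⟨f, rfl⟩ : ∃ f, n = m + f + m := ⟨n - 2 * m, by omega⟩
  rw [Finset.sum_range_add, Finset.sum_range_add]
  have e1 : ∑ a ∈ Finset.range m, (if a < m then a else if a < m + f + m - m then m else a) =
      ∑ a ∈ Finset.range m, a :=
    Finset.sum_congr rfl fun a ha => if_pos (Finset.mem_range.1 ha)
  have e2 : ∑ a ∈ Finset.range f,
      (if m + a < m then m + a else if m + a < m + f + m - m then m else m + a) = f * m := by
    rw [Finset.sum_congr rfl (g := fun _ => m), Finset.sum_const, Finset.card_range, smul_eq_mul]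
    intro a ha
    have := Finset.mem_range.1 ha
    rw [if_neg (by omega), if_pos (by omega)]
  have e3 : ∑ a ∈ Finset.range m,
      (if m + f + a < m then m + f + a else if m + f + a < m + f + m - m then m else m + f + a) =
      m * (m + f) + ∑ a ∈ Finset.range m, a := by
    rw [Finset.sum_congr rfl (g := fun a => (m + f) + a), Finset.sum_add_distrib, Finset.sum_const,
      Finset.card_range, smul_eq_mul]
    intro a ha
    rw [if_neg (by omega), if_neg (by omega)]
  rw [e1, e2, e3]
  have e4 := Finset.sum_range_id_mul_two m
  have e5 : m + f + m - m = m + f := by omega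
  rw [e5]
  rcases m with _ | m
  · simp
  · simp only [Nat.add_sub_cancel] at e4
    nlinarith

/-! ### Rank functions and maximal chains -/

theorem IsMaxChain.mem_of_forall {P : Type*} [PartialOrder P] {c : Set P}
    (hc : IsMaxChain (· ≤ ·) c) {z : P} (hz : ∀ x ∈ c, x ≤ z ∨ z ≤ x) : z ∈ c := by
  have h1 : IsChain (· ≤ ·) (insert z c) := hc.1.insert fun b hb _ => (hz b hb).symm
  rw [hc.2 h1 (Set.subset_insert z c)]
  exact Set.mem_insert z c

theorem IsRankFunction.strictMono {P : Type*} [PartialOrder P] [Finite P] {ρ : P → ℕ}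
    (hρ : IsRankFunction ρ) : StrictMono ρ := by
  classical
  have := Fintype.ofFinite P
  let _ : LocallyFiniteOrder P := Fintype.toLocallyFiniteOrder
  refine (strictMono_iff_forall_covBy ρ).2 fun a b hab => ?_
  rw [hρ.2 a b hab]
  exact Nat.lt_succ_self _

/-- A finite poset with a rank function all of whose maximal elements have rank `R` is graded of
rank `R`. -/
theorem IsRankFunction.isGradedOfRank {P : Type*} [PartialOrder P] [Finite P] [Nonempty P]
    {ρ : P → ℕ} (hρ : IsRankFunction ρ) {R : ℕ} (hR : ∀ x, IsMax x → ρ x = R) :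
    IsGradedOfRank P R := by
  intro c hc
  have hmono := hρ.strictMono
  have hinj : Set.InjOn ρ c := by
    intro x hx y hy hxy
    by_contra hne
    rcases hc.1.total hx hy with h | h
    · exact (hmono (lt_of_le_of_ne h hne)).ne hxy
    · exact (hmono (lt_of_le_of_ne h (Ne.symm hne))).ne hxy.symm
  have hcne : c.Nonempty := hc.nonempty_iff.1 inferInstance
  obtain ⟨M, hM⟩ := (Set.toFinite c).exists_maximal hcne
  have hMtop : ∀ x ∈ c, x ≤ M := fun x hx =>
    (hc.1.total hx hM.1).elim id fun h => hM.2 hx h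
  have hMR : ρ M = R := hR M fun z hz =>
    hMtop z (hc.mem_of_forall fun x hx => Or.inl ((hMtop x hx).trans hz))
  -- The predecessor of `x` in a maximal chain is covered by `x` in the whole poset, so the ranks in
  -- `c` have no gaps below `R`.
  have hstep : ∀ x ∈ c, ρ x ≠ 0 → ∃ x' ∈ c, ρ x = ρ x' + 1 := by
    intro x hx hx0
    have hne : {w ∈ c | w < x}.Nonempty := by
      by_contra hemp
      rw [Set.not_nonempty_iff_eq_empty] at hemp
      apply hx0
      apply hρ.1
      intro z hz
      have hge : ∀ w ∈ c, x ≤ w := by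
        intro w hw
        rcases hc.1.total hx hw with h | h
        · exact h
        · rcases h.eq_or_lt with h | h
          · exact h.ge
          · exact (Set.eq_empty_iff_forall_notMem.1 hemp w ⟨hw, h⟩).elim
      exact hge z (hc.mem_of_forall fun w hw => Or.inr (hz.trans (hge w hw)))
    obtain ⟨x', hx'⟩ := (Set.toFinite {w ∈ c | w < x}).exists_maximal hne
    refine ⟨x', hx'.1.1, hρ.2 x' x ⟨hx'.1.2, fun z h1 h2 => ?_⟩⟩
    have hz : z ∈ c := hc.mem_of_forall fun w hw => by
      rcases hc.1.total hx hw with h | h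
      · exact Or.inr (h2.le.trans h)
      · rcases h.eq_or_lt with h | h
        · exact Or.inr (h ▸ h2.le)
        · rcases hc.1.total hw hx'.1.1 with h3 | h3
          · exact Or.inl (h3.trans h1.le)
          · exact Or.inl ((hx'.2 ⟨hw, h⟩ h3).trans h1.le)
    exact h1.not_ge (hx'.2 ⟨hz, h2⟩ h1.le)
  have hsurj : ∀ d : ℕ, d ≤ R → ∃ x ∈ c, ρ x = R - d := by
    intro d
    induction d with
    | zero => exact fun _ => ⟨M, hM.1, by omega⟩
    | succ d ih =>
      intro hd
      obtain ⟨x, hx, h1⟩ := ih (by omega)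
      obtain ⟨x', hx', h2⟩ := hstep x hx (by omega)
      exact ⟨x', hx', by omega⟩
  have himg : ρ '' c = Set.Iio (R + 1) := by
    ext k
    constructor
    · rintro ⟨x, hx, rfl⟩
      have := hmono.monotone (hMtop x hx)
      rw [Set.mem_Iio]
      omega
    · intro hk
      rw [Set.mem_Iio] at hk
      obtain ⟨x, hx, h1⟩ := hsurj (R - k) (by omega)
      exact ⟨x, hx, by omega⟩
  have hcard : c.ncard = R + 1 := by
    rw [← hinj.ncard_image, himg, Set.ncard_eq_toFinset_card']
    simp
  rw [hcard]
  push_cast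
  ring

/-! ### The rank function of the involution poset -/

/-- In the presence of the hypotheses of `exists_involution_between`, the difference of `inv + exc`
between comparable involutions is even. -/
theorem exists_rank_eq_add_two_mul {a₁ a₂ : ℕ} (ha₁ : a₁ % 2 = n % 2) (ha₂ : a₂ % 2 = n % 2)
    (hcond : a₁ ≤ 1 ∨ (a₁ = a₂ ∧ a₂ + 2 = n) ∨ a₁ + 2 ≤ a₂) :
    ∀ (d : ℕ) {x y : Equiv.Perm (Fin n)}, x * x = 1 → y * y = 1 → x ≤ y → a₁ ≤ fixCount x →
      fixCount x ≤ a₂ → a₁ ≤ fixCount y → fixCount y ≤ a₂ →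
      invCount y + excCount y = invCount x + excCount x + d → d % 2 = 0 := by
  intro d
  induction d using Nat.strong_induction_on with
  | _ d ih =>
    intro x y hx hy hle hx₁ hx₂ hy₁ hy₂ hd
    by_cases hne : x = y
    · subst hne; omega
    by_cases hd2 : d = 2
    · omega
    obtain ⟨z, hz, h1, h2, h3, h4, h5, h6⟩ := exists_involution_between hx hy hle hne ha₁ ha₂
      hx₁ hx₂ hy₁ hy₂ hcond (by omega)
    have h7 := rank_lt_rank hx hz h1 (Ne.symm h3)
    have h8 := rank_lt_rank hz hy h2 h4
    have h9 := ih (invCount z + excCount z - (invCount x + excCount x)) (by omega) hx hz h1 hx₁ hx₂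
      h5 h6 (by omega)
    have h10 := ih (invCount y + excCount y - (invCount z + excCount z)) (by omega) hz hy h2 h5 h6
      hy₁ hy₂ (by omega)
    omega

/-- Descend to an involution with `inv + exc + a₂ = n`; by parity the difference is even. This makes
the truncated subtraction and the halving in the rank function exact. -/
theorem exists_rank_add_eq {a₁ a₂ : ℕ} (ha₁ : a₁ % 2 = n % 2) (ha₂ : a₂ % 2 = n % 2)
    (ha : a₂ < n) (hcond : a₁ ≤ 1 ∨ (a₁ = a₂ ∧ a₂ + 2 = n) ∨ a₁ + 2 ≤ a₂)
    (R : ℕ) {y : Equiv.Perm (Fin n)} (hy : y * y = 1) (hy₁ : a₁ ≤ fixCount y)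
    (hy₂ : fixCount y ≤ a₂) (hR : invCount y + excCount y = R) :
    ∃ t, R + a₂ = n + 2 * t := by
  induction R using Nat.strong_induction_on generalizing y with
  | _ R ih =>
    by_cases h : invCount y + excCount y + a₂ = n
    · exact ⟨0, by omega⟩
    obtain ⟨z, hz, h1, h2, h3, h4⟩ := exists_involution_lt_of_not_minimal hy ha₂ ha hy₂ h
    have h5 := rank_lt_rank hz hy h1 h2
    obtain ⟨t, ht⟩ := ih _ (by omega) hz (by omega) h4 rfl
    have h6 := exists_rank_eq_add_two_mul ha₁ ha₂ hcond
      (R - (invCount z + excCount z)) hz hy h1 (by omega) h4 hy₁ hy₂ (by omega)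
    exact ⟨t + (R - (invCount z + excCount z)) / 2, by omega⟩

/-- The rank function of the poset of involutions whose number of fixed points lies in an interval,
with the identity possibly added. -/
theorem exists_isRankFunction {A : Finset ℕ} {a₁ a₂ : ℕ} (h₁₂ : a₁ ≤ a₂) (ha₁ : a₁ % 2 = n % 2)
    (ha₂ : a₂ % 2 = n % 2) (ha : a₂ < n)
    (hA : ∀ b, b ∈ A.erase n ↔ a₁ ≤ b ∧ b ≤ a₂ ∧ b % 2 = n % 2)
    (hcond : a₁ ≤ 1 ∨ (a₁ = a₂ ∧ a₂ + 2 = n) ∨ a₁ + 2 ≤ a₂) :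
    ∃ ρ : InvPoset n A → ℕ, IsRankFunction ρ ∧ (∀ σ, σ.1 = 1 → ρ σ = 0) ∧
      (∀ σ, σ.1 ≠ 1 → 2 * ρ σ + n = invCount σ.1 + excCount σ.1 + a₂ + 2 * if n ∈ A then 1 else 0) ∧
      ∃ R : ℕ, IsGradedOfRank (InvPoset n A) R ∧
        2 * R + n = (n - a₁) / 2 * (n + a₁) + a₂ + 2 * if n ∈ A then 1 else 0 := by
  classical
  have mem : ∀ z : Equiv.Perm (Fin n), z * z = 1 → a₁ ≤ fixCount z → fixCount z ≤ a₂ →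
      fixCount z ∈ A := fun z hz h1 h2 =>
    Finset.mem_of_mem_erase ((hA _).2 ⟨h1, h2, by have := two_mul_excCount_add_fixCount hz; omega⟩)
  have fix : ∀ σ : InvPoset n A, σ.1 ≠ 1 → a₁ ≤ fixCount σ.1 ∧ fixCount σ.1 ≤ a₂ := by
    intro σ hσ
    have := (hA (fixCount σ.1)).1 (Finset.mem_erase.2
      ⟨fun h => hσ ((fixCount_eq_iff _).1 h), σ.2.2⟩)
    exact ⟨this.1, this.2.1⟩
  have fix1 : fixCount (1 : Equiv.Perm (Fin n)) = n := (fixCount_eq_iff 1).2 rfl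
  set ρ : InvPoset n A → ℕ := fun σ => if σ.1 = 1 then 0 else
    (invCount σ.1 + excCount σ.1 + a₂ - n) / 2 + if n ∈ A then 1 else 0 with hρdef
  have hρ1 : ∀ σ, σ.1 = 1 → ρ σ = 0 := fun σ hσ => if_pos hσ
  have hρ : ∀ σ, σ.1 ≠ 1 →
      2 * ρ σ + n = invCount σ.1 + excCount σ.1 + a₂ + 2 * if n ∈ A then 1 else 0 := by
    intro σ hσ
    obtain ⟨t, ht⟩ := exists_rank_add_eq ha₁ ha₂ ha hcond _ σ.2.1 (fix σ hσ).1 (fix σ hσ).2 rfl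
    simp only [hρdef, if_neg hσ]
    split_ifs <;> omega
  have low : ∀ σ : InvPoset n A, σ.1 ≠ 1 → (∀ τ : InvPoset n A, τ < σ → τ.1 = 1) →
      invCount σ.1 + excCount σ.1 + a₂ = n := by
    intro σ hσ hmin
    by_contra h
    obtain ⟨z, hz, h1, h2, h3, h4⟩ :=
      exists_involution_lt_of_not_minimal σ.2.1 ha₂ ha (fix σ hσ).2 h
    have h5 := hmin ⟨z, hz, mem z hz ((fix σ hσ).1.trans h3) h4⟩ (lt_of_le_of_ne h1 fun he =>
      h2 (congrArg Subtype.val he))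
    simp only at h5
    subst h5
    omega
  have hrank : IsRankFunction ρ := by
    constructor
    · intro x hx
      by_cases hx1 : x.1 = 1
      · exact hρ1 x hx1
      have hn : n ∉ A := by
        intro hn
        have h1 : (⟨1, one_mul 1, fix1.symm ▸ hn⟩ : InvPoset n A) ≤ x := one_le_bruhat x.1
        have h2 := hx.eq_of_le h1
        exact hx1 (congrArg Subtype.val h2).symm
      have h1 := low x hx1 fun τ hτ => (hx.not_lt hτ).elim
      have h2 := hρ x hx1
      rw [if_neg hn] at h2
      omega
    · intro x y hxy
      have hne : x.1 ≠ y.1 := fun h => hxy.ne (Subtype.ext h)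
      have hle : x.1 ≤ y.1 := hxy.le
      have hy1 : y.1 ≠ 1 := fun h => hne (by rw [h] at hle ⊢; exact eq_one_of_bruhat_le_one hle)
      have hy := hρ y hy1
      by_cases hx1 : x.1 = 1
      · have hn : n ∈ A := by
          have := x.2.2
          rwa [hx1, fix1] at this
        rw [if_pos hn] at hy
        have h1 := low y hy1 fun τ hτ => by
          by_contra h
          exact hxy.2 (lt_of_le_of_ne (a := x) (b := τ) (by
            show x.1 ≤ τ.1
            rw [hx1]; exact one_le_bruhat _) fun he => h (he ▸ hx1)) hτ
        rw [hρ1 x hx1]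
        omega
      · have hx := hρ x hx1
        have h1 : invCount y.1 + excCount y.1 = invCount x.1 + excCount x.1 + 2 := by
          by_contra h
          obtain ⟨z, hz, h1, h2, h3, h4, h5, h6⟩ := exists_involution_between x.2.1 y.2.1 hle hne
            ha₁ ha₂ (fix x hx1).1 (fix x hx1).2 (fix y hy1).1 (fix y hy1).2 hcond h
          exact hxy.2 (c := ⟨z, hz, mem z hz h5 h6⟩)
            (lt_of_le_of_ne h1 fun he => h3 (congrArg Subtype.val he).symm)
            (lt_of_le_of_ne h2 fun he => h4 (congrArg Subtype.val he))
        omega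
  refine ⟨ρ, hrank, hρ1, hρ, ?_⟩
  -- The maximum has the fewest fixed points, hence `m = (n - a₁) / 2` arcs.
  obtain ⟨m, rfl⟩ : ∃ m, n = a₁ + 2 * m := ⟨(n - a₁) / 2, by omega⟩
  have hm : 2 * m ≤ a₁ + 2 * m := by omega
  have htop := outerReverse_mul_self (n := a₁ + 2 * m) m
  have hexc := excCount_outerReverse hm
  have hfix := two_mul_excCount_add_fixCount htop
  have hinv := invCount_outerReverse hm
  set T : InvPoset (a₁ + 2 * m) A :=
    ⟨outerReverse _ m, htop, mem _ htop (by omega) (by omega)⟩ with hT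
  have hT1 : T.1 ≠ 1 := fun h => by
    have h' : outerReverse (a₁ + 2 * m) m = 1 := h
    rw [hexc, h', fix1] at hfix
    omega
  have hTle : ∀ x : InvPoset (a₁ + 2 * m) A, x ≤ T := by
    intro x
    refine le_outerReverse x.2.1 ?_
    have h1 := two_mul_excCount_add_fixCount x.2.1
    by_cases hx1 : x.1 = 1
    · rw [hx1, fix1] at h1
      rw [hx1]
      omega
    · have := fix x hx1
      omega
  have : Nonempty (InvPoset (a₁ + 2 * m) A) := ⟨T⟩
  refine ⟨ρ T, hrank.isGradedOfRank fun x hx => by rw [hx.eq_of_le (hTle x)], ?_⟩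
  have h1 := hρ T hT1
  have h2 : (a₁ + 2 * m - a₁) / 2 = m := by omega
  have h3 : invCount T.1 + excCount T.1 = m * (a₁ + 2 * m + a₁) := by
    simp only [hT, hexc]
    rw [hinv]
    have : a₁ + 2 * m - m = a₁ + m := by omega
    rw [this]
    ring
  rw [h2]
  omega

/-! ### Gaps in `A` destroy gradedness -/

theorem rank_add_two_le {x y : Equiv.Perm (Fin n)} (hx : x * x = 1) (hy : y * y = 1) (hle : x ≤ y)
    (hne : x ≠ y) : invCount x + excCount x + 2 ≤ invCount y + excCount y := by
  obtain ⟨z, hz, -, h1, h2, -⟩ := exists_step hx hy hle hne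
  by_cases h : z = y
  · rw [← h, h2]
  · have := rank_lt_rank hz hy h1 h
    omega

/-- In a graded poset, a part of a maximal chain cannot be replaced by a longer chain. -/
theorem IsGraded.ncard_le {P : Type*} [PartialOrder P] [Finite P] (hP : IsGraded P) {C S D : Set P}
    (hC : IsMaxChain (· ≤ ·) C) (hD : IsChain (· ≤ ·) D) (hDS : D ⊆ S)
    (h : ∀ w ∈ C, w ∉ S → ∀ d ∈ D, w ≤ d ∨ d ≤ w) : D.ncard ≤ (C ∩ S).ncard := by
  obtain ⟨r, hr⟩ := hP
  have h1 : IsChain (· ≤ ·) (C \ S ∪ D) := by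
    rintro v (hv | hv) w (hw | hw) hne
    · exact hC.1 hv.1 hw.1 hne
    · exact h v hv.1 hv.2 w hw
    · exact (h w hw.1 hw.2 v hv).symm
    · exact hD hv hw hne
  obtain ⟨M, hM, h2⟩ := h1.exists_maxChain
  have h3 := Set.ncard_le_ncard h2 (Set.toFinite M)
  have h4 := hr C hC
  have h5 := hr M hM
  have h6 : (C \ S ∪ D).ncard = (C \ S).ncard + D.ncard :=
    Set.ncard_union_eq (Set.disjoint_left.2 fun w hw hw' => hw.2 (hDS hw')) (Set.toFinite _)
      (Set.toFinite _)
  have h7 := Set.ncard_inter_add_ncard_sdiff_eq_ncard C S (Set.toFinite C)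
  omega

/-- An involution with only adjacent arcs is below an involution that crosses every one of them. -/
theorem bruhat_le_of_adjacent {y z : Equiv.Perm (Fin n)} (hy : y * y = 1) (hz : z * z = 1)
    (hadj : ∀ a, (y a : ℕ) ≤ a + 1)
    (h : ∀ a, (y a : ℕ) = a + 1 → ∃ t : Fin n, (t : ℕ) ≤ a ∧ (a : ℕ) + 1 ≤ z t) : y ≤ z := by
  have key : ∀ k l : ℕ, k ≤ l → cnt y k l ≤ cnt z k l := by
    intro k l hkl
    rcases Nat.eq_zero_or_pos (cnt y k l) with h0 | h0
    · omega
    obtain ⟨a, ha⟩ := Finset.card_pos.1 h0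
    rw [Finset.mem_filter] at ha
    have h1 := hadj a
    have h2 : cnt y k l ≤ 1 := by
      refine Finset.card_le_one.2 fun s hs t ht => ?_
      rw [Finset.mem_filter] at hs ht
      have := hadj s
      have := hadj t
      exact Fin.ext (by omega)
    obtain ⟨t, ht1, ht2⟩ := h a (by omega)
    refine h2.trans (Finset.card_pos.2 ⟨t, ?_⟩)
    rw [Finset.mem_filter]
    exact ⟨Finset.mem_univ _, by omega, by omega⟩
  rw [bruhat_le_iff]
  intro k l hk hl
  rcases le_total k l with hkl | hkl
  · exact key k l hkl
  · have := key l k hkl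
    have := cnt_diff_symm hy hz hk hl
    omega

/-- The arc `(0 j)` together with the arcs `(2c 2c+1)` for `c ∈ P`. -/
def hookFun (j : ℕ) (P : Finset ℕ) (a : ℕ) : ℕ :=
  if a = 0 then j else if a = j then 0 else
    if a / 2 ∈ P then (if a % 2 = 0 then a + 1 else a - 1) else a

/-- The arcs of `hookFun j P` are disjoint and lie in `{0, …, n - 1}`. -/
structure HookCond (n j : ℕ) (P : Finset ℕ) : Prop where
  pos : 0 < j
  lt : j < n
  mem : ∀ c ∈ P, j < 2 * c ∧ 2 * c + 1 < n

theorem HookCond.hookFun_lt {j : ℕ} {P : Finset ℕ} (h : HookCond n j P) {a : ℕ} (ha : a < n) :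
    hookFun j P a < n := by
  have := h.lt
  have := h.pos
  unfold hookFun
  split_ifs with h1 h2 h3 h4
  · omega
  · omega
  · have := h.mem _ h3; omega
  · omega
  · omega

theorem HookCond.hookFun_hookFun {j : ℕ} {P : Finset ℕ} (h : HookCond n j P) (a : ℕ) :
    hookFun j P (hookFun j P a) = a := by
  have hpos := h.pos
  by_cases h1 : a = 0
  · simp [hookFun, h1, hpos.ne']
  by_cases h2 : a = j
  · simp [hookFun, h2, hpos.ne']
  by_cases h3 : a / 2 ∈ P
  · have h4 := h.mem _ h3
    rcases Nat.mod_two_eq_zero_or_one a with h5 | h5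
    · have e1 : hookFun j P a = a + 1 := by
        unfold hookFun
        rw [if_neg h1, if_neg h2, if_pos h3, if_pos h5]
      rw [e1]
      unfold hookFun
      have h6 : (a + 1) / 2 = a / 2 := by omega
      rw [if_neg (by omega), if_neg (by omega), h6, if_pos h3, if_neg (by omega)]
      omega
    · have e1 : hookFun j P a = a - 1 := by
        unfold hookFun
        rw [if_neg h1, if_neg h2, if_pos h3, if_neg (by omega)]
      rw [e1]
      unfold hookFun
      have h6 : (a - 1) / 2 = a / 2 := by omega
      rw [if_neg (by omega), if_neg (by omega), h6, if_pos h3, if_pos (by omega)]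
      omega
  · have e1 : hookFun j P a = a := by
      unfold hookFun
      rw [if_neg h1, if_neg h2, if_neg h3]
    rw [e1, e1]

/-- The involution in `S_n` given by `hookFun j P`. -/
def hookArcs {j : ℕ} {P : Finset ℕ} (h : HookCond n j P) : Equiv.Perm (Fin n) :=
  Function.Involutive.toPerm (fun a : Fin n => ⟨hookFun j P a, h.hookFun_lt a.isLt⟩)
    fun a => Fin.ext (h.hookFun_hookFun a)

section hook
variable {j : ℕ} {P : Finset ℕ}

theorem hookArcs_val (h : HookCond n j P) (a : Fin n) : (hookArcs h a : ℕ) = hookFun j P a := rfl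

theorem hookArcs_mul_self (h : HookCond n j P) : hookArcs h * hookArcs h = 1 :=
  mul_self_of_apply_apply fun a => Fin.ext (h.hookFun_hookFun a)

theorem excCount_hookArcs (h : HookCond n j P) : excCount (hookArcs h) = P.card + 1 := by
  have h0 : 0 ∉ P := fun h0 => by have := h.mem 0 h0; omega
  have hlt := h.lt
  have hpos := h.pos
  rw [← Finset.card_insert_of_notMem h0, excCount]
  symm
  refine Finset.card_bij (fun c hc => (⟨2 * c, ?_⟩ : Fin n)) ?_ ?_ ?_
  · rcases Finset.mem_insert.1 hc with rfl | hc
    · omega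
    · have := h.mem c hc; omega
  · intro c hc
    rw [Finset.mem_filter, Fin.lt_def, hookArcs_val]
    refine ⟨Finset.mem_univ _, ?_⟩
    simp only [hookFun]
    rcases Finset.mem_insert.1 hc with rfl | hc
    · simpa using hpos
    · have h1 := h.mem c hc
      have h2 : 2 * c / 2 = c := by omega
      rw [if_neg (by omega), if_neg (by omega), h2, if_pos hc, if_pos (by omega)]
      omega
  · intro c _ d _ hcd
    have := congrArg Fin.val hcd
    simp only at this
    omega
  · intro a ha
    rw [Finset.mem_filter, Fin.lt_def, hookArcs_val] at ha
    have ha := ha.2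
    unfold hookFun at ha
    split_ifs at ha with h1 h2 h3 h4
    · exact ⟨0, Finset.mem_insert_self _ _, Fin.ext (by simp [h1])⟩
    · omega
    · exact ⟨(a : ℕ) / 2, Finset.mem_insert_of_mem h3, Fin.ext (by simp only; omega)⟩
    · omega
    · omega

theorem fixCount_hookArcs (h : HookCond n j P) : fixCount (hookArcs h) + 2 * P.card + 2 = n := by
  have h1 := two_mul_excCount_add_fixCount (hookArcs_mul_self h)
  have h2 := excCount_hookArcs h
  omega

theorem hookArcs_le_succ (h : HookCond n 1 P) (a : Fin n) : (hookArcs h a : ℕ) ≤ a + 1 := by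
  rw [hookArcs_val]
  unfold hookFun
  split_ifs <;> omega

/-- This is conjugation by the adjacent transposition of `j` and the fixed point `j + 1`. No
position or value lies strictly between the two, so the emptiness conditions for the inversion count
are vacuous. -/
theorem hookArcs_succ (h : HookCond n j P) (h' : HookCond n (j + 1) P) :
    hookArcs h ≤ hookArcs h' ∧
      invCount (hookArcs h') + excCount (hookArcs h') =
        invCount (hookArcs h) + excCount (hookArcs h) + 2 := by
  have hlt := h'.lt
  have hpos := h.pos
  have hself := hookArcs_mul_self h
  set a : Fin n := ⟨j, h.lt⟩ with ha
  set b : Fin n := ⟨j + 1, h'.lt⟩ with hb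
  set o : Fin n := ⟨0, by omega⟩ with ho
  have hoa : o ≠ a := fun e => by have := congrArg Fin.val e; simp only [ho, ha] at this; omega
  have hob : o ≠ b := fun e => by have := congrArg Fin.val e; simp only [ho, hb] at this; omega
  have hab : a ≠ b := fun e => by have := congrArg Fin.val e; simp only [ha, hb] at this; omega
  have hP : (j + 1) / 2 ∉ P := fun hc => by have := h'.mem _ hc; omega
  have hP' : j / 2 ∉ P := fun hc => by have := h'.mem _ hc; omega
  have xa : hookArcs h a = o := Fin.ext (by
    rw [hookArcs_val]; simp only [hookFun, ha, ho]; rw [if_neg (by omega), if_pos trivial])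
  have xb : hookArcs h b = b := Fin.ext (by
    rw [hookArcs_val]; simp only [hookFun, hb]
    rw [if_neg (by omega), if_neg (by omega), if_neg hP])
  have xo : hookArcs h o = a := Fin.ext rfl
  have hconj : hookArcs h' = Equiv.swap a b * hookArcs h * Equiv.swap a b := by
    ext t
    rw [hookArcs_val, Equiv.Perm.mul_apply, Equiv.Perm.mul_apply]
    by_cases e1 : t = o
    · subst e1
      rw [Equiv.swap_apply_of_ne_of_ne hoa hob, xo, Equiv.swap_apply_left]
      simp [hookFun, ho, hb]
    by_cases e2 : t = a
    · subst e2
      rw [Equiv.swap_apply_left, xb, Equiv.swap_apply_right]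
      simp only [hookFun, ha]
      rw [if_neg (by omega), if_neg (by omega), if_neg hP']
    by_cases e3 : t = b
    · subst e3
      rw [Equiv.swap_apply_right, xa, Equiv.swap_apply_of_ne_of_ne hoa hob]
      simp only [hookFun, hb, ho]
      rw [if_neg (by omega), if_pos trivial]
    have f1 : (t : ℕ) ≠ 0 := fun e => e1 (Fin.ext e)
    have f2 : (t : ℕ) ≠ j := fun e => e2 (Fin.ext e)
    have f3 : (t : ℕ) ≠ j + 1 := fun e => e3 (Fin.ext e)
    have g1 : hookArcs h t ≠ a := fun e => e1 ((hookArcs h).injective (by rw [xo, e]))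
    have g2 : hookArcs h t ≠ b := fun e => e3 ((hookArcs h).injective (by rw [xb, e]))
    rw [Equiv.swap_apply_of_ne_of_ne e2 e3, Equiv.swap_apply_of_ne_of_ne g1 g2, hookArcs_val]
    simp only [hookFun, if_neg f1, if_neg f2, if_neg f3]
  have k1 : (a : ℕ) < b := Nat.lt_succ_self j
  have k2 : (hookArcs h a : ℕ) < hookArcs h b := by rw [xa, xb]; exact Nat.succ_pos j
  have k3 : Equiv.swap a b (hookArcs h a) = o := by
    rw [xa, Equiv.swap_apply_of_ne_of_ne hoa hob]
  have k4 : Equiv.swap a b (hookArcs h b) = a := by rw [xb, Equiv.swap_apply_right]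
  have k5 : (o : ℕ) < a := hpos
  constructor
  · rw [hconj, bruhat_le_iff]
    intro k m _ _
    rw [cnt_conj_swap hself k1 k2 k3 k4 k5]
    omega
  · have h1 := invCount_conj_swap hself k1 k2 k3 k4 k5
      (fun t t1 t2 => by simp only [ha, hb] at t1 t2; omega)
      (fun t _ _ t3 => by simp only [ha, hb] at t3; omega)
    have h2 := excCount_hookArcs h
    have h3 := excCount_hookArcs h'
    rw [← hconj] at h1
    omega

theorem hookArcs_add (h : HookCond n j P) (d : ℕ) (h' : HookCond n (j + d) P) :
    hookArcs h ≤ hookArcs h' ∧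
      invCount (hookArcs h') + excCount (hookArcs h') =
        invCount (hookArcs h) + excCount (hookArcs h) + 2 * d := by
  induction d with
  | zero => exact ⟨le_rfl, rfl⟩
  | succ d ih =>
    have hpos := h.pos
    have hlt := h'.lt
    have h1 : HookCond n (j + d) P :=
      ⟨by omega, by omega, fun c hc => by have := h'.mem c hc; omega⟩
    obtain ⟨i1, i2⟩ := ih h1
    obtain ⟨s1, s2⟩ := hookArcs_succ h1 h'
    exact ⟨i1.trans s1, by omega⟩

end hook

/-- Everything below an involution with adjacent arcs only has adjacent arcs only, so there `inv +
exc` is determined by the number of fixed points. -/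
theorem rank_eq_two_mul_excCount {w y : Equiv.Perm (Fin n)} (hw : w * w = 1) (hle : w ≤ y)
    (hadj : ∀ a, (y a : ℕ) ≤ a + 1) : invCount w + excCount w = 2 * excCount w := by
  rw [invCount_eq_excCount hw (le_succ_of_bruhat_le hle hadj), two_mul]

/-- If `x` is covered by `y` in a graded poset and all chains in `[y, z]` are short, then so are the
chains in `[x, z]`. -/
theorem IsGraded.card_le_of_cover {P : Type*} [PartialOrder P] [Finite P] (hP : IsGraded P)
    {x y z : P} (hxy : x ≤ y) (hyz : y ≤ z) (cover : ∀ w, x ≤ w → w ≤ y → w = x ∨ w = y)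
    {φ : P → ℕ} (hφ : ∀ v w, v < w → φ v + 2 ≤ φ w) {m : ℕ} (hm : φ z = φ y + 2 * m)
    {D : Set P} (hD : IsChain (· ≤ ·) D) (hDS : D ⊆ Set.Icc x z) : D.ncard ≤ m + 2 := by
  have hxz := hxy.trans hyz
  have hmono : Monotone φ := fun v w h => by
    rcases h.eq_or_lt with rfl | h
    · exact le_rfl
    · have := hφ v w h; omega
  have hchain : IsChain (· ≤ ·) ({x, y, z} : Set P) := by
    rintro s hs t ht -
    simp only [Set.mem_insert_iff, Set.mem_singleton_iff] at hs ht
    rcases hs with rfl | rfl | rfl <;> rcases ht with rfl | rfl | rfl <;>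
      simp [hxy, hyz, hxz]
  obtain ⟨C, hC, hsub⟩ := hchain.exists_maxChain
  have hxC : x ∈ C := hsub (by simp)
  have hyC : y ∈ C := hsub (by simp)
  have hzC : z ∈ C := hsub (by simp)
  have hle := hP.ncard_le hC hD hDS (by
    intro w hw hwS d hd
    rcases hC.1.total hw hxC with h1 | h1
    · exact Or.inl (h1.trans (hDS hd).1)
    rcases hC.1.total hzC hw with h2 | h2
    · exact Or.inr ((hDS hd).2.trans h2)
    exact (hwS ⟨h1, h2⟩).elim)
  have hyzcard : (C ∩ Set.Icc y z).ncard ≤ m + 1 := by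
    -- As `φ` grows by at least two along the chain, the halved difference takes distinct values in
    -- `0, …, m` on the part in `[y, z]`.
    have hinj : Set.InjOn (fun w : P => (φ w - φ y) / 2) (C ∩ Set.Icc y z) := by
      intro v hv w hw hvw
      by_contra hne
      simp only at hvw
      have hv' := hmono hv.2.1
      have hw' := hmono hw.2.1
      rcases hC.1.total hv.1 hw.1 with h | h
      · have := hφ v w (lt_of_le_of_ne h hne)
        omega
      · have := hφ w v (lt_of_le_of_ne h (Ne.symm hne))
        omega
    have himg : (fun w : P => (φ w - φ y) / 2) '' (C ∩ Set.Icc y z) ⊆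
        (Finset.range (m + 1) : Set ℕ) := by
      rintro _ ⟨w, ⟨-, h1, h2⟩, rfl⟩
      have := hmono h2
      rw [Finset.mem_coe, Finset.mem_range]
      simp only
      omega
    rw [← hinj.ncard_image]
    refine (Set.ncard_le_ncard himg (Finset.finite_toSet _)).trans ?_
    rw [Set.ncard_coe_finset, Finset.card_range]
  have hsub : C ∩ Set.Icc x z ⊆ insert x (C ∩ Set.Icc y z) := by
    rintro w ⟨hw, h1, h2⟩
    rcases hC.1.total hw hyC with h | h
    · rcases cover w h1 h with rfl | rfl
      · exact Set.mem_insert _ _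
      · exact Set.mem_insert_of_mem _ ⟨hw, le_rfl, h2⟩
    · exact Set.mem_insert_of_mem _ ⟨hw, h, h2⟩
  have h1 := Set.ncard_le_ncard hsub (Set.toFinite _)
  have h2 := Set.ncard_insert_le x (C ∩ Set.Icc y z)
  omega

theorem hookArcs_le_of_subset {P Q : Finset ℕ} (hPQ : P ⊆ Q) (h : HookCond n 1 P)
    (h' : HookCond n 1 Q) : hookArcs h ≤ hookArcs h' := by
  refine bruhat_le_of_adjacent (hookArcs_mul_self h) (hookArcs_mul_self h') (hookArcs_le_succ h)
    fun t ht => ⟨t, le_rfl, ?_⟩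
  rw [hookArcs_val] at ht ⊢
  unfold hookFun at ht ⊢
  split_ifs at ht with h1 h2 h3 h4
  · rw [if_pos h1]; omega
  · rw [if_neg h1, if_neg h2, if_pos (hPQ h3), if_pos h4]
  · omega
  · omega

/-- The arc `(0 j)` is above all adjacent arcs that it encloses. -/
theorem hookArcs_le_hookArcs {j : ℕ} {P Q : Finset ℕ} (h : HookCond n 1 Q) (h' : HookCond n j P)
    (hPQ : ∀ c ∈ Q, c ∈ P ∨ 2 * c + 1 ≤ j) : hookArcs h ≤ hookArcs h' := by
  have hpos := h'.pos
  have hlt := h'.lt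
  refine bruhat_le_of_adjacent (hookArcs_mul_self h) (hookArcs_mul_self h') (hookArcs_le_succ h)
    fun t ht => ?_
  rw [hookArcs_val] at ht
  by_cases htP : (t : ℕ) / 2 ∈ P
  · refine ⟨t, le_rfl, ?_⟩
    have h5 := h'.mem _ htP
    rw [hookArcs_val]
    unfold hookFun at ht ⊢
    split_ifs at ht with h1 h2 h3 h4
    · omega
    · rw [if_neg h1, if_neg (by omega), if_pos htP, if_pos h4]
    · omega
    · omega
  · refine ⟨⟨0, by omega⟩, Nat.zero_le _, ?_⟩
    rw [hookArcs_val]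
    unfold hookFun at ht ⊢
    rw [if_pos rfl]
    split_ifs at ht with h1 h2 h3 h4
    · omega
    · have := (hPQ _ h3).resolve_left htP
      omega
    · omega
    · omega

/-- With `b = a + 2m`, let `x` and `z` have the arc `(0 1)` and `(0 2m+1)` respectively, both with
the same adjacent arcs to the right, and let `y` have adjacent arcs only, filling the gap up to
`2m+1`. Elements between `x` and `y` have adjacent arcs only, and the gap in `A` makes `y` cover
`x`. A chain through `y` then has at most `m + 2` elements in `[x, z]`, but lengthening the first
arc one unit at a time gives `2m + 1`, which is larger since `m ≥ 2`. -/
theorem not_isGraded_of_gap {A : Finset ℕ} {a b : ℕ} (ha : a ∈ A) (hb : b ∈ A) (hab : a + 4 ≤ b)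
    (hbn : b + 2 ≤ n) (ha₂ : a % 2 = n % 2) (hb₂ : b % 2 = n % 2)
    (hgap : ∀ c ∈ A, a < c → b ≤ c) : ¬ IsGraded (InvPoset n A) := by
  intro hG
  obtain ⟨m, hm⟩ : ∃ m, b = a + 2 * m := ⟨(b - a) / 2, by omega⟩
  obtain ⟨r, hr⟩ : ∃ r, n = b + 2 + 2 * r := ⟨(n - b - 2) / 2, by omega⟩
  obtain ⟨P, memP, cardP⟩ : ∃ P : Finset ℕ, (∀ c, c ∈ P ↔ m + 1 ≤ c ∧ c < m + 1 + r) ∧ P.card = r :=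
    ⟨Finset.Ico (m + 1) (m + 1 + r), fun c => Finset.mem_Ico, by rw [Nat.card_Ico]; omega⟩
  obtain ⟨Q, memQ, cardQ⟩ : ∃ Q : Finset ℕ, (∀ c, c ∈ Q ↔ 1 ≤ c ∧ c < m + 1 + r) ∧
      Q.card = m + r :=
    ⟨Finset.Ico 1 (m + 1 + r), fun c => Finset.mem_Ico, by rw [Nat.card_Ico]; omega⟩
  have condP : ∀ j, 0 < j → j ≤ 2 * m + 1 → HookCond n j P := fun j h1 h2 =>
    ⟨h1, by omega, fun c hc => by rw [memP] at hc; omega⟩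
  have condQ : HookCond n 1 Q := ⟨one_pos, by omega, fun c hc => by rw [memQ] at hc; omega⟩
  have memA : ∀ j (h : HookCond n j P), fixCount (hookArcs h) ∈ A := fun j h => by
    have := fixCount_hookArcs h
    rwa [show fixCount (hookArcs h) = b by omega]
  have fixQ : fixCount (hookArcs condQ) ∈ A := by
    have := fixCount_hookArcs condQ
    rwa [show fixCount (hookArcs condQ) = a by omega]
  have cond1 := condP 1 one_pos (by omega)
  have condz := condP (1 + 2 * m) (by omega) (by omega)
  have rank_x := rank_eq_two_mul_excCount (hookArcs_mul_self cond1) le_rfl (hookArcs_le_succ cond1)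
  have rank_y := rank_eq_two_mul_excCount (hookArcs_mul_self condQ) le_rfl (hookArcs_le_succ condQ)
  have rank_z := (hookArcs_add cond1 (2 * m) condz).2
  have exc_x := excCount_hookArcs cond1
  have exc_y := excCount_hookArcs condQ
  have exc_z := excCount_hookArcs condz
  obtain ⟨g, hg⟩ : ∃ g : Fin (2 * m + 1) → InvPoset n A,
      ∀ (i : Fin (2 * m + 1)) (h : HookCond n (1 + (i : ℕ)) P),
      (g i).1 = hookArcs h :=
    ⟨fun i => ⟨hookArcs (condP (1 + i) (by omega) (by omega)), hookArcs_mul_self _, memA _ _⟩,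
      fun _ _ => rfl⟩
  obtain ⟨y, hy⟩ : ∃ y : InvPoset n A, y.1 = hookArcs condQ :=
    ⟨⟨hookArcs condQ, hookArcs_mul_self _, fixQ⟩, rfl⟩
  have hx : (g 0).1 = hookArcs cond1 := hg 0 cond1
  have hz : (g (Fin.last (2 * m))).1 = hookArcs condz := hg _ condz
  have gmono : Monotone g := by
    intro i i' hi
    have hi' : (i : ℕ) ≤ i' := hi
    obtain ⟨d, hd⟩ := Nat.exists_eq_add_of_le hi'
    have h1 : HookCond n (1 + i') P := condP _ (by omega) (by omega)
    have h2 : HookCond n (1 + i) P := condP _ (by omega) (by omega)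
    have h3 : (g i).1 ≤ (g i').1 := by
      rw [hg i h2, hg i' h1]
      have h4 : 1 + (i' : ℕ) = 1 + i + d := by omega
      revert h1
      rw [h4]
      exact fun h1 => (hookArcs_add h2 d h1).1
    exact h3
  have ginj : Function.Injective g := by
    intro i i' hi
    have h1 : HookCond n (1 + i) P := condP _ (by omega) (by omega)
    have h2 : HookCond n (1 + i') P := condP _ (by omega) (by omega)
    have h3 := congrArg Subtype.val hi
    rw [hg i h1, hg i' h2] at h3
    have h4 := congrArg (fun w : Equiv.Perm (Fin n) => (w ⟨0, by omega⟩ : ℕ)) h3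
    have h5 : 1 + (i : ℕ) = 1 + i' := h4
    exact Fin.ext (by omega)
  have hDcard : (Set.range g).ncard = 2 * m + 1 := by
    rw [← Set.image_univ, Set.ncard_image_of_injective _ ginj, Set.ncard_univ, Nat.card_fin]
  rw [← hx] at rank_x rank_z exc_x
  rw [← hy] at rank_y exc_y
  rw [← hz] at rank_z exc_z
  have hxy : (g 0).1 ≤ y.1 := by
    rw [hx, hy]
    exact hookArcs_le_of_subset (fun c hc => by rw [memP] at hc; rw [memQ]; omega) cond1 condQ
  have hyz : y.1 ≤ (g (Fin.last (2 * m))).1 := by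
    rw [hy, hz]
    exact hookArcs_le_hookArcs condQ condz fun c hc => by rw [memQ] at hc; rw [memP]; omega
  have hadj : ∀ a, (y.1 a : ℕ) ≤ a + 1 := hy ▸ hookArcs_le_succ condQ
  have key := hG.card_le_of_cover (x := g 0) (y := y) (z := g (Fin.last (2 * m))) hxy hyz
    (by
      intro w h1 h2
      by_contra hc
      rw [not_or] at hc
      have e1 := rank_lt_rank (g 0).2.1 w.2.1 h1 fun h => hc.1 (Subtype.ext h.symm)
      have e2 := rank_lt_rank w.2.1 y.2.1 h2 fun h => hc.2 (Subtype.ext h)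
      have e3 := rank_eq_two_mul_excCount w.2.1 h2 hadj
      have e4 := two_mul_excCount_add_fixCount w.2.1
      have e5 := hgap _ w.2.2 (by omega)
      omega)
    (φ := fun w => invCount w.1 + excCount w.1)
    (fun v w h => rank_add_two_le v.2.1 w.2.1 h.le fun e => h.ne (Subtype.ext e))
    (m := m) (by show _ = _ + _; omega) gmono.isChain_range
    (by rintro _ ⟨i, rfl⟩; exact ⟨gmono (Fin.zero_le i), gmono (Fin.le_last i)⟩)
  omega

/-! ### A single middle value in `A` destroys gradedness -/

/-- All permutations agree at `k = n`; going down to `k₀`, each removed position contributes equally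
to both sides. -/
theorem cnt_eq_of_forall_ge {x y : Equiv.Perm (Fin n)} {k₀ : ℕ}
    (h : ∀ t : Fin n, k₀ ≤ t → x t = y t) {k : ℕ} (hk₀ : k₀ ≤ k) (hk : k ≤ n) (m : ℕ) :
    cnt x k m = cnt y k m := by
  have tot : ∀ σ : Equiv.Perm (Fin n), cnt σ n m =
      (Finset.univ.filter (fun a : Fin n => m ≤ (a : ℕ))).card := by
    intro σ
    refine Finset.card_bij (fun a _ => σ a) ?_ (fun a _ b _ e => σ.injective e) ?_
    · intro a ha
      rw [Finset.mem_filter] at ha ⊢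
      exact ⟨Finset.mem_univ _, ha.2.2⟩
    · intro b hb
      rw [Finset.mem_filter] at hb
      refine ⟨σ.symm b, ?_, σ.apply_symm_apply b⟩
      rw [Finset.mem_filter, σ.apply_symm_apply]
      exact ⟨Finset.mem_univ _, Fin.isLt _, hb.2⟩
  induction hk using Nat.decreasingInduction with
  | self => rw [tot, tot]
  | of_succ k hkn ih =>
    have h1 := ih (by omega)
    have h2 := cnt_succ x ⟨k, hkn⟩ m
    have h3 := cnt_succ y ⟨k, hkn⟩ m
    rw [h ⟨k, hkn⟩ hk₀] at h2
    simp only at h2 h3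
    omega

/-- An interval `[x, y]` whose endpoints agree from `k₀` on consists of permutations with the same
property. -/
theorem apply_eq_of_between {x w y : Equiv.Perm (Fin n)} (h1 : x ≤ w) (h2 : w ≤ y) {k₀ : ℕ}
    (h : ∀ t : Fin n, k₀ ≤ t → x t = y t) {t : Fin n} (ht : k₀ ≤ t) : w t = x t := by
  rw [bruhat_le_iff] at h1 h2
  have key : ∀ m ≤ n, (m ≤ (w t : ℕ) ↔ m ≤ (x t : ℕ)) := by
    intro m hm
    have hlt := t.isLt
    have e1 := cnt_eq_of_forall_ge h ht (by omega) m
    have e2 := cnt_eq_of_forall_ge h (k := t + 1) (by omega) (by omega) m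
    have e3 := h1 t m (by omega) hm
    have e4 := h2 t m (by omega) hm
    have e5 := h1 (t + 1) m (by omega) hm
    have e6 := h2 (t + 1) m (by omega) hm
    have e7 := cnt_succ w t m
    have e8 := cnt_succ x t m
    split_ifs at e7 e8 <;> omega
  exact Fin.ext (le_antisymm ((key _ (w t).isLt.le).1 le_rfl) ((key _ (x t).isLt.le).2 le_rfl))

/-- Beyond the first six points `w` is determined by `apply_eq_of_between`. On them the ends are `(0
1)(2 3)` and `(0 3)(4 5)`, and the counts force `w` to preserve `{0, 1, 2, 3}` and `{4, 5}`. Since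
the number of fixed points is prescribed, the action on `{4, 5}` decides between the two ends. -/
theorem eq_or_eq_of_between_hookArcs {T : Finset ℕ} (hT : ∀ c ∈ T, 3 ≤ c)
    (hx : HookCond n 1 (insert 1 T)) (hy : HookCond n 3 (insert 2 T)) {w : Equiv.Perm (Fin n)}
    (hw : w * w = 1) (h1 : hookArcs hx ≤ w) (h2 : w ≤ hookArcs hy)
    (hfix : fixCount w = fixCount (hookArcs hx)) : w = hookArcs hx ∨ w = hookArcs hy := by
  have hn : 5 < n := (hy.mem 2 (Finset.mem_insert_self _ _)).2
  have hTx : ∀ t, 6 ≤ t → (t / 2 ∈ insert 1 T ↔ t / 2 ∈ T) := fun t ht => by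
    rw [Finset.mem_insert, or_iff_right (by omega)]
  have hTy : ∀ t, 6 ≤ t → (t / 2 ∈ insert 2 T ↔ t / 2 ∈ T) := fun t ht => by
    rw [Finset.mem_insert, or_iff_right (by omega)]
  have hT1 : 1 ∉ T := fun h => by have := hT 1 h; omega
  have hT2 : 2 ∉ T := fun h => by have := hT 2 h; omega
  have agree : ∀ t : Fin n, 6 ≤ (t : ℕ) → hookArcs hx t = hookArcs hy t := by
    intro t ht
    apply Fin.ext
    rw [hookArcs_val, hookArcs_val]
    simp only [hookFun, hTx t ht, hTy t ht]
    split_ifs <;> omega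
  have hwx : ∀ t : Fin n, 6 ≤ (t : ℕ) → w t = hookArcs hx t := fun t ht =>
    apply_eq_of_between h1 h2 agree ht
  have hfixy : fixCount (hookArcs hx) = fixCount (hookArcs hy) := by
    have e1 := fixCount_hookArcs hx
    have e2 := fixCount_hookArcs hy
    rw [Finset.card_insert_of_notMem hT1] at e1
    rw [Finset.card_insert_of_notMem hT2] at e2
    omega
  have vx : ∀ t (ht : t < n), (hookArcs hx ⟨t, ht⟩ : ℕ) = hookFun 1 (insert 1 T) t :=
    fun _ _ => rfl
  have vy : ∀ t (ht : t < n), (hookArcs hy ⟨t, ht⟩ : ℕ) = hookFun 3 (insert 2 T) t :=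
    fun _ _ => rfl
  have x0 : hookFun 1 (insert 1 T) 0 = 1 := by simp [hookFun]
  have x1 : hookFun 1 (insert 1 T) 1 = 0 := by simp [hookFun]
  have x2 : hookFun 1 (insert 1 T) 2 = 3 := by simp [hookFun]
  have x3 : hookFun 1 (insert 1 T) 3 = 2 := by simp [hookFun]
  have x4 : hookFun 1 (insert 1 T) 4 = 4 := by simp [hookFun, hT2]
  have x5 : hookFun 1 (insert 1 T) 5 = 5 := by simp [hookFun, hT2]
  have y0 : hookFun 3 (insert 2 T) 0 = 3 := by simp [hookFun]
  have y1 : hookFun 3 (insert 2 T) 1 = 1 := by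
    have : 0 ∉ T := fun h => by have := hT 0 h; omega
    simp [hookFun, this]
  have y2 : hookFun 3 (insert 2 T) 2 = 2 := by simp [hookFun, hT1]
  have y3 : hookFun 3 (insert 2 T) 3 = 0 := by simp [hookFun]
  have y4 : hookFun 3 (insert 2 T) 4 = 5 := by simp [hookFun]
  have y5 : hookFun 3 (insert 2 T) 5 = 4 := by simp [hookFun]
  have inv : ∀ i j (hi : i < n) (hj : j < n), (w ⟨i, hi⟩ : ℕ) = j → (w ⟨j, hj⟩ : ℕ) = i := by
    intro i j hi hj h
    have h3 : w ⟨i, hi⟩ = ⟨j, hj⟩ := Fin.ext h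
    rw [← h3, apply_apply_of_mul_self hw]
  have cases6 : ∀ t : Fin n, (t : ℕ) < 6 → t = ⟨0, by omega⟩ ∨ t = ⟨1, by omega⟩ ∨
      t = ⟨2, by omega⟩ ∨ t = ⟨3, by omega⟩ ∨ t = ⟨4, by omega⟩ ∨ t = ⟨5, by omega⟩ := by
    intro t ht
    simp only [Fin.ext_iff]
    omega
  rw [bruhat_le_iff] at h1 h2
  -- No arc of the upper end crosses the gap before `4`, hence none of `w` does.
  have low : ∀ t (ht : t < n), t < 4 → (w ⟨t, ht⟩ : ℕ) < 4 := by
    intro t ht ht4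
    have h3 : cnt (hookArcs hy) 4 4 = 0 := by
      rw [cnt, Finset.card_eq_zero, Finset.filter_eq_empty_iff]
      rintro s - ⟨hs1, hs2⟩
      rcases cases6 s (by omega) with rfl | rfl | rfl | rfl | rfl | rfl <;>
        rw [vy] at hs2 <;> simp only at hs1 <;> omega
    have h4 : cnt w 4 4 = 0 := by
      have := h2 4 4 (by omega) (by omega)
      omega
    rw [cnt, Finset.card_eq_zero, Finset.filter_eq_empty_iff] at h4
    by_contra hc
    exact h4 (Finset.mem_univ ⟨t, ht⟩) ⟨ht4, by omega⟩
  have high : ∀ t (ht : t < n), 6 ≤ t → 6 ≤ (w ⟨t, ht⟩ : ℕ) := by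
    intro t ht ht6
    rw [hwx ⟨t, ht⟩ ht6, vx]
    unfold hookFun
    split_ifs <;> omega
  have mid : ∀ t (ht : t < n), 4 ≤ t → t < 6 → 4 ≤ (w ⟨t, ht⟩ : ℕ) ∧ (w ⟨t, ht⟩ : ℕ) < 6 := by
    intro t ht ht4 ht6
    have h3 := inv t _ ht (w ⟨t, ht⟩).isLt rfl
    constructor
    · by_contra hc
      have := low _ (w ⟨t, ht⟩).isLt (by omega)
      omega
    · by_contra hc
      have := high _ (w ⟨t, ht⟩).isLt (by omega)
      omega
  have w0 : 1 ≤ (w ⟨0, by omega⟩ : ℕ) := by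
    have h3 : 0 < cnt (hookArcs hx) 1 1 := Finset.card_pos.2 ⟨⟨0, by omega⟩, by
      rw [Finset.mem_filter, vx, x0]
      exact ⟨Finset.mem_univ _, by simp⟩⟩
    obtain ⟨s, hs⟩ := Finset.card_pos.1 (h3.trans_le (h1 1 1 (by omega) (by omega)))
    rw [Finset.mem_filter] at hs
    rcases cases6 s (by omega) with rfl | rfl | rfl | rfl | rfl | rfl <;>
      simp only at hs <;> omega
  have w3 : (w ⟨3, by omega⟩ : ℕ) < 3 := by
    have h3 : 0 < cnt (hookArcs hx) 3 3 := Finset.card_pos.2 ⟨⟨2, by omega⟩, by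
      rw [Finset.mem_filter, vx, x2]
      exact ⟨Finset.mem_univ _, by simp⟩⟩
    obtain ⟨s, hs⟩ := Finset.card_pos.1 (h3.trans_le (h1 3 3 (by omega) (by omega)))
    rw [Finset.mem_filter] at hs
    have h4 := low s s.isLt (by omega)
    have h5 := inv s 3 s.isLt (by omega) (by simp only [Fin.eta] at h4 ⊢; omega)
    omega
  have w01 : ¬ (2 ≤ (w ⟨0, by omega⟩ : ℕ) ∧ 2 ≤ (w ⟨1, by omega⟩ : ℕ)) := by
    rintro ⟨hc1, hc2⟩
    have h3 : cnt (hookArcs hy) 2 2 ≤ 1 := by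
      refine Finset.card_le_one.2 fun s hs t ht => ?_
      rw [Finset.mem_filter] at hs ht
      rcases cases6 s (by omega) with rfl | rfl | rfl | rfl | rfl | rfl <;>
      rcases cases6 t (by omega) with rfl | rfl | rfl | rfl | rfl | rfl <;>
        first
        | rfl
        | (rw [vy] at hs ht; simp only at hs ht; omega)
    have h4 : 1 < cnt w 2 2 := by
      refine Finset.one_lt_card.2 ⟨⟨0, by omega⟩, ?_, ⟨1, by omega⟩, ?_, ?_⟩
      · rw [Finset.mem_filter]; exact ⟨Finset.mem_univ _, Nat.zero_lt_two, hc1⟩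
      · rw [Finset.mem_filter]; exact ⟨Finset.mem_univ _, Nat.one_lt_two, hc2⟩
      · intro h; simp [Fin.ext_iff] at h
    have := h2 2 2 (by omega) (by omega)
    omega
  have l0 := low 0 (by omega) (by omega)
  have l1 := low 1 (by omega) (by omega)
  have l2 := low 2 (by omega) (by omega)
  have m4 := mid 4 (by omega) le_rfl (by omega)
  have m5 := mid 5 (by omega) (by omega) (by omega)
  have i01 := inv 0 1 (by omega) (by omega)
  have i02 := inv 0 2 (by omega) (by omega)
  have i03 := inv 0 3 (by omega) (by omega)
  have i10 := inv 1 0 (by omega) (by omega)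
  have i12 := inv 1 2 (by omega) (by omega)
  have i20 := inv 2 0 (by omega) (by omega)
  have i21 := inv 2 1 (by omega) (by omega)
  have i23 := inv 2 3 (by omega) (by omega)
  have i45 := inv 4 5 (by omega) (by omega)
  have i54 := inv 5 4 (by omega) (by omega)
  -- If `4` and `5` are fixed, every fixed point of the lower end is one of `w`; otherwise every
  -- fixed point of `w` is one of the upper end. Equal cardinalities make these inclusions
  -- equalities.
  by_cases w4 : (w ⟨4, by omega⟩ : ℕ) = 4
  · left
    have hsub : (Finset.univ.filter fun t => hookArcs hx t = t) ⊆
        Finset.univ.filter fun t => w t = t := by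
      intro t ht
      rw [Finset.mem_filter] at ht ⊢
      refine ⟨Finset.mem_univ _, ?_⟩
      rcases Nat.lt_or_ge t 6 with ht6 | ht6
      · have ht := congrArg Fin.val ht.2
        apply Fin.ext
        rcases cases6 t ht6 with rfl | rfl | rfl | rfl | rfl | rfl <;> rw [vx] at ht <;>
          simp only at ht ⊢ <;> omega
      · rw [hwx t ht6, ht.2]
    have heq := Finset.eq_of_subset_of_card_le hsub hfix.le
    have nofix : ∀ t (ht : t < n), (w ⟨t, ht⟩ : ℕ) = t → hookFun 1 (insert 1 T) t = t := by
      intro t ht h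
      have h3 : (⟨t, ht⟩ : Fin n) ∈ Finset.univ.filter fun t => w t = t := by
        rw [Finset.mem_filter]; exact ⟨Finset.mem_univ _, Fin.ext h⟩
      rw [← heq, Finset.mem_filter] at h3
      exact congrArg Fin.val h3.2
    have n1 := nofix 1 (by omega)
    have n2 := nofix 2 (by omega)
    ext t
    rcases Nat.lt_or_ge t 6 with ht6 | ht6
    · rcases cases6 t ht6 with rfl | rfl | rfl | rfl | rfl | rfl <;> rw [vx] <;> omega
    · rw [hwx t ht6]
  · right
    have hsub : (Finset.univ.filter fun t => w t = t) ⊆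
        Finset.univ.filter fun t => hookArcs hy t = t := by
      intro t ht
      rw [Finset.mem_filter] at ht ⊢
      refine ⟨Finset.mem_univ _, ?_⟩
      rcases Nat.lt_or_ge t 6 with ht6 | ht6
      · have ht := congrArg Fin.val ht.2
        apply Fin.ext
        rcases cases6 t ht6 with rfl | rfl | rfl | rfl | rfl | rfl <;> rw [vy] <;>
          simp only at ht ⊢ <;> omega
      · rw [← agree t ht6, ← hwx t ht6, ht.2]
    have heq := Finset.eq_of_subset_of_card_le hsub (by
      rw [hfixy] at hfix; exact hfix.ge)
    have fix : ∀ t (ht : t < n), hookFun 3 (insert 2 T) t = t → (w ⟨t, ht⟩ : ℕ) = t := by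
      intro t ht h
      have h3 : (⟨t, ht⟩ : Fin n) ∈ Finset.univ.filter fun t => hookArcs hy t = t := by
        rw [Finset.mem_filter]; exact ⟨Finset.mem_univ _, Fin.ext h⟩
      rw [← heq, Finset.mem_filter] at h3
      exact congrArg Fin.val h3.2
    have n1 := fix 1 (by omega) y1
    have n2 := fix 2 (by omega) y2
    ext t
    rcases Nat.lt_or_ge t 6 with ht6 | ht6
    · rcases cases6 t ht6 with rfl | rfl | rfl | rfl | rfl | rfl <;> rw [vy] <;> omega
    · rw [hwx t ht6, agree t ht6]

/-- Among the non-identity elements, `x = (0 1)(2 3)` is minimal and is covered by `y = (0 3)(4 5)`,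
with the arcs from `T` added to both. The chain with first arc `(0 1)`, `(0 2)`, `(0 3)` and fixed
arc `(4 5)` also ends at `y` but has three elements. The identity, if present, lies below everything
and does not affect the comparison. -/
theorem not_isGraded_of_single {A : Finset ℕ} {a : ℕ} (ha : a ∈ A) (ha2 : 2 ≤ a) (han : a + 4 ≤ n)
    (hpar : a % 2 = n % 2) (hA : ∀ c ∈ A, c = a ∨ c = n) : ¬ IsGraded (InvPoset n A) := by
  intro hG
  obtain ⟨r, hr⟩ : ∃ r, n = a + 4 + 2 * r := ⟨(n - a - 4) / 2, by omega⟩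
  obtain ⟨T, memT, cardT⟩ : ∃ T : Finset ℕ, (∀ c, c ∈ T ↔ 3 ≤ c ∧ c < 3 + r) ∧ T.card = r :=
    ⟨Finset.Ico 3 (3 + r), fun c => Finset.mem_Ico, by rw [Nat.card_Ico]; omega⟩
  have hT1 : 1 ∉ T := fun h => by rw [memT] at h; omega
  have hT2 : 2 ∉ T := fun h => by rw [memT] at h; omega
  have card1 := Finset.card_insert_of_notMem hT1
  have card2 := Finset.card_insert_of_notMem hT2
  have cond1 : HookCond n 1 (insert 1 T) := ⟨one_pos, by omega, fun c hc => by
    rw [Finset.mem_insert, memT] at hc; omega⟩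
  have cond2 : ∀ j, 0 < j → j ≤ 3 → HookCond n j (insert 2 T) := fun j hj1 hj2 =>
    ⟨hj1, by omega, fun c hc => by rw [Finset.mem_insert, memT] at hc; omega⟩
  have mem2 : ∀ j (h : HookCond n j (insert 2 T)), fixCount (hookArcs h) ∈ A := fun j h => by
    have := fixCount_hookArcs h
    rwa [show fixCount (hookArcs h) = a by omega]
  have fixx : fixCount (hookArcs cond1) = a := by
    have := fixCount_hookArcs cond1
    omega
  have exc1 := excCount_hookArcs cond1
  have h21 := cond2 1 one_pos (by omega)
  have h22 := cond2 2 two_pos (by omega)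
  have h23 := cond2 3 (by omega) le_rfl
  obtain ⟨x, hx⟩ : ∃ x : InvPoset n A, x.1 = hookArcs cond1 :=
    ⟨⟨hookArcs cond1, hookArcs_mul_self _, by rwa [fixx]⟩, rfl⟩
  obtain ⟨x', hx'⟩ : ∃ x : InvPoset n A, x.1 = hookArcs h21 :=
    ⟨⟨hookArcs h21, hookArcs_mul_self _, mem2 _ _⟩, rfl⟩
  obtain ⟨u, hu⟩ : ∃ x : InvPoset n A, x.1 = hookArcs h22 :=
    ⟨⟨hookArcs h22, hookArcs_mul_self _, mem2 _ _⟩, rfl⟩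
  obtain ⟨y, hy⟩ : ∃ x : InvPoset n A, x.1 = hookArcs h23 :=
    ⟨⟨hookArcs h23, hookArcs_mul_self _, mem2 _ _⟩, rfl⟩
  have hxy' : hookArcs cond1 ≤ hookArcs h23 := hookArcs_le_hookArcs _ _ fun c hc => by
    rcases Finset.mem_insert.1 hc with rfl | hc
    · exact Or.inr le_rfl
    · exact Or.inl (Finset.mem_insert_of_mem hc)
  have hxy : x ≤ y := by
    show x.1 ≤ y.1
    rwa [hx, hy]
  have hxu : x' ≤ u := by
    show x'.1 ≤ u.1
    rw [hx', hu]
    exact (hookArcs_succ h21 h22).1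
  have huy : u ≤ y := by
    show u.1 ≤ y.1
    rw [hu, hy]
    exact (hookArcs_succ h22 h23).1
  have val0 : ∀ j (h : HookCond n j (insert 2 T)), (hookArcs h ⟨0, by omega⟩ : ℕ) = j :=
    fun _ _ => rfl
  have ne : ∀ j j' (h : HookCond n j (insert 2 T)) (h' : HookCond n j' (insert 2 T)), j ≠ j' →
      hookArcs h ≠ hookArcs h' := fun j j' h h' hj e => hj (by rw [← val0 j h, ← val0 j' h', e])
  have hxu' : x' ≠ u := fun h => ne _ _ h21 h22 (by omega) (by rw [← hx', ← hu, h])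
  have hxy' : x' ≠ y := fun h => ne _ _ h21 h23 (by omega) (by rw [← hx', ← hy, h])
  have huy' : u ≠ y := fun h => ne _ _ h22 h23 (by omega) (by rw [← hu, ← hy, h])
  have ne_one : ∀ j (h : HookCond n j (insert 2 T)), hookArcs h ≠ 1 := fun j h e => by
    have h1 := fixCount_hookArcs h
    have h2 := (fixCount_eq_iff (hookArcs h)).2 e
    omega
  have hadj : ∀ a, (x.1 a : ℕ) ≤ a + 1 := hx ▸ hookArcs_le_succ cond1
  have hfix : ∀ w : InvPoset n A, w.1 ≠ 1 → fixCount w.1 = a := fun w hw =>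
    (hA _ w.2.2).resolve_right fun h => hw ((fixCount_eq_iff _).1 h)
  have hmin : ∀ w : InvPoset n A, w.1 ≠ 1 → w ≤ x → w = x := by
    intro w hw1 hw
    by_contra hne
    have e1 := rank_lt_rank w.2.1 x.2.1 hw fun e => hne (Subtype.ext e)
    have e2 := rank_eq_two_mul_excCount w.2.1 hw hadj
    have e3 := rank_eq_two_mul_excCount x.2.1 le_rfl hadj
    have e4 := two_mul_excCount_add_fixCount w.2.1
    have e5 := two_mul_excCount_add_fixCount x.2.1
    have e6 := hfix w hw1
    rw [← hx] at fixx
    omega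
  have cover : ∀ w : InvPoset n A, w.1 ≠ 1 → x ≤ w → w ≤ y → w = x ∨ w = y := by
    intro w hw1 e1 e2
    have e1' : x.1 ≤ w.1 := e1
    have e2' : w.1 ≤ y.1 := e2
    rw [hx] at e1'
    rw [hy] at e2'
    rcases eq_or_eq_of_between_hookArcs (fun c hc => ((memT c).1 hc).1) cond1 h23 w.2.1 e1' e2'
      ((hfix w hw1).trans fixx.symm) with h | h
    · exact Or.inl (Subtype.ext (h.trans hx.symm))
    · exact Or.inr (Subtype.ext (h.trans hy.symm))
  have hchain : IsChain (· ≤ ·) ({x, y} : Set (InvPoset n A)) := by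
    rintro s hs t ht -
    simp only [Set.mem_insert_iff, Set.mem_singleton_iff] at hs ht
    rcases hs with rfl | rfl <;> rcases ht with rfl | rfl <;> simp [hxy]
  obtain ⟨C, hC, hsub⟩ := hchain.exists_maxChain
  have hxC : x ∈ C := hsub (by simp)
  have hyC : y ∈ C := hsub (by simp)
  have hDchain : IsChain (· ≤ ·) ({x', u, y} : Set (InvPoset n A)) := by
    have hxy := hxu.trans huy
    rintro s hs t ht -
    simp only [Set.mem_insert_iff, Set.mem_singleton_iff] at hs ht
    rcases hs with rfl | rfl | rfl <;> rcases ht with rfl | rfl | rfl <;>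
      simp [hxy, hxu, huy]
  have hDy : ∀ d ∈ ({x', u, y} : Set (InvPoset n A)), d ≤ y ∧ d.1 ≠ 1 := by
    intro d hd
    simp only [Set.mem_insert_iff, Set.mem_singleton_iff] at hd
    rcases hd with rfl | rfl | rfl
    · exact ⟨hxu.trans huy, hx' ▸ ne_one _ _⟩
    · exact ⟨huy, hu ▸ ne_one _ _⟩
    · exact ⟨le_rfl, hy ▸ ne_one _ _⟩
  have hle := hG.ncard_le hC hDchain (S := {w | w ≤ y ∧ w.1 ≠ 1}) hDy (by
    intro w hw hwS d hd
    by_cases hw1 : w.1 = 1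
    · left
      show w.1 ≤ d.1
      rw [hw1]
      exact one_le_bruhat _
    · rcases hC.1.total hw hyC with h | h
      · exact (hwS ⟨h, hw1⟩).elim
      · exact Or.inr ((hDy d hd).1.trans h))
  have hDcard : ({x', u, y} : Set (InvPoset n A)).ncard = 3 :=
    Set.ncard_eq_three.2 ⟨x', u, y, hxu', hxy', huy', rfl⟩
  have hsub : C ∩ {w | w ≤ y ∧ w.1 ≠ 1} ⊆ {x, y} := by
    rintro w ⟨hw, h1, h2⟩
    rcases hC.1.total hw hxC with h | h
    · exact Or.inl (hmin w h2 h)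
    · exact cover w h2 h h1
  have h1 := Set.ncard_le_ncard hsub (Set.toFinite _)
  have h2 := Set.ncard_insert_le x ({y} : Set (InvPoset n A))
  rw [Set.ncard_singleton] at h2
  omega

/-! ### Classification and conclusion -/

theorem isGradedOfRank_of_erase_eq_empty {n : ℕ} {A : Finset ℕ} (h : A.erase n = ∅) :
    ∃ r, IsGradedOfRank (InvPoset n A) r ∧ IsRankFunction fun _ : InvPoset n A => 0 := by
  have hsub : Subsingleton (InvPoset n A) := by
    have h1 : ∀ σ : InvPoset n A, σ.1 = 1 := by
      intro σ
      rw [← fixCount_eq_iff]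
      by_contra hne
      have := Finset.mem_erase.2 ⟨hne, σ.2.2⟩
      rw [h] at this
      exact Finset.notMem_empty _ this
    exact ⟨fun σ τ => Subtype.ext ((h1 σ).trans (h1 τ).symm)⟩
  have hrank : IsRankFunction fun _ : InvPoset n A => 0 :=
    ⟨fun _ _ => rfl, fun x y hxy => (hxy.ne (Subsingleton.elim x y)).elim⟩
  rcases isEmpty_or_nonempty (InvPoset n A) with he | he
  · exact ⟨-1, fun c _ => by rw [Set.eq_empty_of_isEmpty c, Set.ncard_empty]; rfl, hrank⟩
  · exact ⟨_, hrank.isGradedOfRank (R := 0) fun _ _ => rfl, hrank⟩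

theorem erase_eq_filter_of_isGraded {n : ℕ} {A : Finset ℕ} (hle : ∀ a ∈ A, a ≤ n)
    (hpar : ∀ a ∈ A, a % 2 = n % 2) (hG : IsGraded (InvPoset n A)) {a₁ a₂ : ℕ}
    (h₁ : a₁ ∈ A.erase n) (h₂ : a₂ ∈ A.erase n) (hmin : ∀ b ∈ A.erase n, a₁ ≤ b)
    (hmax : ∀ b ∈ A.erase n, b ≤ a₂) :
    (∀ b, b ∈ A.erase n ↔ a₁ ≤ b ∧ b ≤ a₂ ∧ b % 2 = n % 2) ∧
      (a₁ ≤ 1 ∨ a₂ + 2 = n ∨ a₁ + 2 ≤ a₂) := by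
  have mem : ∀ b ∈ A.erase n, b ∈ A ∧ b + 2 ≤ n ∧ b % 2 = n % 2 := by
    intro b hb
    obtain ⟨hb1, hb2⟩ := Finset.mem_erase.1 hb
    have e1 := hle b hb2
    have e2 := hpar b hb2
    exact ⟨hb2, by omega, e2⟩
  have hconv : ∀ b, b ∈ A.erase n ↔ a₁ ≤ b ∧ b ≤ a₂ ∧ b % 2 = n % 2 := by
    refine fun c => ⟨fun hc => ⟨hmin c hc, hmax c hc, (mem c hc).2.2⟩, ?_⟩
    rintro ⟨hc1, hc2, hc3⟩
    by_contra hc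
    have hlow : ((A.erase n).filter (· < c)).Nonempty := ⟨a₁, Finset.mem_filter.2 ⟨h₁,
      lt_of_le_of_ne hc1 fun e => hc (e ▸ h₁)⟩⟩
    have hhigh : ((A.erase n).filter (c < ·)).Nonempty := ⟨a₂, Finset.mem_filter.2 ⟨h₂,
      lt_of_le_of_ne hc2 fun e => hc (e ▸ h₂)⟩⟩
    -- The neighbours of a missing `c` in `A.erase n` on either side are consecutive elements of `A`
    -- at distance at least four.
    obtain ⟨ha, hac⟩ := Finset.mem_filter.1 (Finset.max'_mem _ hlow)
    obtain ⟨hb, hbc⟩ := Finset.mem_filter.1 (Finset.min'_mem _ hhigh)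
    have hamax : ∀ d ∈ (A.erase n).filter (· < c), d ≤ ((A.erase n).filter (· < c)).max' hlow :=
      fun d hd => Finset.le_max' ((A.erase n).filter (· < c)) d hd
    have hbmin : ∀ d ∈ (A.erase n).filter (c < ·), ((A.erase n).filter (c < ·)).min' hhigh ≤ d :=
      fun d hd => Finset.min'_le ((A.erase n).filter (c < ·)) d hd
    generalize ((A.erase n).filter (· < c)).max' hlow = a at *
    generalize ((A.erase n).filter (c < ·)).min' hhigh = b at *
    obtain ⟨ha1, ha2, ha3⟩ := mem a ha
    obtain ⟨hb1, hb2, hb3⟩ := mem b hb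
    refine not_isGraded_of_gap ha1 hb1 (by omega) hb2 ha3 hb3 (fun d hd had => ?_) hG
    by_contra hdb
    have hd' : d ∈ A.erase n := Finset.mem_erase.2 ⟨by omega, hd⟩
    rcases lt_trichotomy d c with h | h | h
    · have := hamax d (Finset.mem_filter.2 ⟨hd', h⟩)
      omega
    · exact hc (h ▸ hd')
    · exact hdb (hbmin d (Finset.mem_filter.2 ⟨hd', h⟩))
  refine ⟨hconv, ?_⟩
  by_contra hcond
  obtain ⟨e1, e2, e3⟩ := mem a₁ h₁
  obtain ⟨f1, f2, f3⟩ := mem a₂ h₂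
  have h₁₂ := hmin a₂ h₂
  refine not_isGraded_of_single e1 (by omega) (by omega) e3 (fun c hc => ?_) hG
  by_cases hcn : c = n
  · exact Or.inr hcn
  · have hc' := Finset.mem_erase.2 ⟨hcn, hc⟩
    have := hmin c hc'
    have := hmax c hc'
    left
    omega

theorem theorem1 (n : ℕ) (A : Finset ℕ) (hle : ∀ a ∈ A, a ≤ n)
    (hpar : ∀ a ∈ A, a ≡ n [MOD 2]) :
    (IsGraded (InvPoset n A) ↔
      A.erase n = ∅ ∨
      ∃ a₁ a₂ : ℕ, a₁ ≤ a₂ ∧ a₁ ≡ a₂ [MOD 2] ∧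
        A.erase n = (Finset.Icc a₁ a₂).filter (fun i => i ≡ a₁ [MOD 2]) ∧
        ((a₁ = 0 ∨ a₁ = 1) ∨ a₂ + 2 = n ∨ a₁ + 2 ≤ a₂)) ∧
    (IsGraded (InvPoset n A) →
      (∃ ρ : InvPoset n A → ℕ, IsRankFunction ρ ∧
        (∀ σ : InvPoset n A, σ.1 = 1 → ρ σ = 0) ∧
        ∀ (hne : (A.erase n).Nonempty) (σ : InvPoset n A), σ.1 ≠ 1 → (ρ σ : ℚ) =
          ((invCount σ.1 : ℚ) + excCount σ.1 - n + (A.erase n).max' hne) / 2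
            + (if n ∈ A then 1 else 0)) ∧
      ∀ (hne : (A.erase n).Nonempty) (hA : A.Nonempty),
        ∃ r : ℤ, IsGradedOfRank (InvPoset n A) r ∧
          (r : ℚ) =
            (((n : ℚ) - A.min' hA) / 2 * (n + A.min' hA) - n + (A.erase n).max' hne) / 2
              + (if n ∈ A then 1 else 0)) := by
  have hpar' : ∀ a ∈ A, a % 2 = n % 2 := hpar
  have graded : ∀ {a₁ a₂ : ℕ}, a₁ ∈ A.erase n → a₂ ∈ A.erase n → a₁ ≤ a₂ →
      (∀ b, b ∈ A.erase n ↔ a₁ ≤ b ∧ b ≤ a₂ ∧ b % 2 = n % 2) →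
      (a₁ ≤ 1 ∨ a₂ + 2 = n ∨ a₁ + 2 ≤ a₂) → _ :=
    fun {a₁ a₂} h₁ h₂ h₁₂ hB hcond => exists_isRankFunction (A := A) h₁₂ ((hB _).1 h₁).2.2
      ((hB _).1 h₂).2.2
      (lt_of_le_of_ne (hle _ (Finset.mem_of_mem_erase h₂)) (Finset.ne_of_mem_erase h₂)) hB
      (by
        have := ((hB _).1 h₁).2.2
        have := ((hB _).1 h₂).2.2
        omega)
  have classify : IsGraded (InvPoset n A) → ∀ hne : (A.erase n).Nonempty, _ := fun hG hne =>
    erase_eq_filter_of_isGraded hle hpar' hG (Finset.min'_mem _ hne) (Finset.max'_mem _ hne)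
      (fun b hb => Finset.min'_le _ b hb) (fun b hb => Finset.le_max' _ b hb)
  refine ⟨⟨fun hG => ?_, ?_⟩, fun hG => ⟨?_, fun hne hA => ?_⟩⟩
  · rcases (A.erase n).eq_empty_or_nonempty with he | hne
    · exact Or.inl he
    · right
      obtain ⟨hB, hcond⟩ := classify hG hne
      have h₁ := (hB _).1 (Finset.min'_mem _ hne)
      have h₂ := (hB _).1 (Finset.max'_mem _ hne)
      refine ⟨_, _, h₁.2.1, h₁.2.2.trans h₂.2.2.symm, ?_, by omega⟩
      ext b
      rw [hB, Finset.mem_filter, Finset.mem_Icc, and_assoc]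
      refine and_congr_right fun _ => and_congr_right fun _ => ?_
      rw [Nat.ModEq, h₁.2.2]
  · rintro (he | ⟨a₁, a₂, h₁₂, hmod, hB, hcond⟩)
    · obtain ⟨r, hr, -⟩ := isGradedOfRank_of_erase_eq_empty he
      exact ⟨r, hr⟩
    · have h₁ : a₁ ∈ A.erase n := by
        rw [hB, Finset.mem_filter, Finset.mem_Icc]
        exact ⟨⟨le_rfl, h₁₂⟩, rfl⟩
      have h₂ : a₂ ∈ A.erase n := by
        rw [hB, Finset.mem_filter, Finset.mem_Icc]
        exact ⟨⟨h₁₂, le_rfl⟩, hmod.symm⟩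
      have hp := hpar' _ (Finset.mem_of_mem_erase h₁)
      obtain ⟨ρ, -, -, -, R, hR, -⟩ := graded h₁ h₂ h₁₂ (fun b => by
        rw [hB, Finset.mem_filter, Finset.mem_Icc, and_assoc, Nat.ModEq, hp]) (by omega)
      exact ⟨R, hR⟩
  · rcases (A.erase n).eq_empty_or_nonempty with he | hne
    · obtain ⟨r, -, hr⟩ := isGradedOfRank_of_erase_eq_empty he
      exact ⟨_, hr, fun _ _ => rfl, fun hne => (hne.ne_empty he).elim⟩
    · obtain ⟨hB, hcond⟩ := classify hG hne
      obtain ⟨ρ, h1, h2, h3, -⟩ := graded (Finset.min'_mem _ hne) (Finset.max'_mem _ hne)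
        ((hB _).1 (Finset.min'_mem _ hne)).2.1 hB hcond
      refine ⟨ρ, h1, h2, fun _ σ hσ => ?_⟩
      have h4 := congrArg (Nat.cast : ℕ → ℚ) (h3 σ hσ)
      push_cast at h4
      linarith
  · obtain ⟨hB, hcond⟩ := classify hG hne
    obtain ⟨ρ, -, -, -, R, hR, h4⟩ := graded (Finset.min'_mem _ hne) (Finset.max'_mem _ hne)
      ((hB _).1 (Finset.min'_mem _ hne)).2.1 hB hcond
    refine ⟨R, hR, ?_⟩
    have hmem := Finset.min'_mem _ hne
    have hmin : A.min' hA = (A.erase n).min' hne := by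
      apply le_antisymm
      · exact Finset.min'_le _ _ (Finset.mem_of_mem_erase hmem)
      · refine Finset.le_min' _ _ _ fun b hb => ?_
        by_cases hbn : b = n
        · rw [hbn]
          exact hle _ (Finset.mem_of_mem_erase hmem)
        · exact Finset.min'_le _ _ (Finset.mem_erase.2 ⟨hbn, hb⟩)
    rw [hmin]
    -- Since `n` and the minimum have equal parity, halving in `ℕ` agrees with halving in `ℚ`.
    obtain ⟨m, hm⟩ : ∃ m, n = (A.erase n).min' hne + 2 * m :=
      ⟨(n - (A.erase n).min' hne) / 2, by
        have := hle _ (Finset.mem_of_mem_erase hmem)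
        have := hpar' _ (Finset.mem_of_mem_erase hmem)
        omega⟩
    have h5 : (n - (A.erase n).min' hne) / 2 = m := by omega
    rw [h5] at h4
    have h6 := congrArg (Nat.cast : ℕ → ℚ) h4
    have h7 : (n : ℚ) = (A.erase n).min' hne + 2 * m := by exact_mod_cast hm
    push_cast at h6 ⊢
    have h8 : ((n : ℚ) - (A.erase n).min' hne) / 2 = m := by linarith
    rw [h8]
    linarith
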